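/- Let $d,n$ be natural numbers, $T\in\mathbb{R}$, $\sigma_x,\sigma_\theta\ge 0$, and let $(\Omega,\mathbb{P})$ be a probability space carrying a uniformly distributed real random variable. Let $\mathcal{P}_2(\mathbb{R}^d)$ be the set of Borel probability measures on $\mathbb{R}^d$ with finite second moment, with the Wasserstein distance $\mathcal{W}_2$, and write $M_2(m)=(\int|x|^2m(dx))^{1/2}$. A function $U:\mathbb{R}^d\times\mathcal{P}_2(\mathbb{R}^d)\to\mathbb{R}^d$ is called $L^2$-monotone if $\mathbb{E}[(U(X,\mathcal{L}(X))-U(Y,\mathcal{L}(Y)))\cdot(X-Y)]\ge 0$ for all $X,Y\in L^2(\Omega,\mathbb{R}^d)$. Let $b:\mathbb{R}^n\to\mathbb{R}^n$, $F,G:\mathbb{R}^d\times\mathbb{R}^n\times\mathcal{P}_2(\mathbb{R}^d)\times\mathbb{R}^d\to\mathbb{R}^d$ and $W_0:\mathbb{R}^d\times\mathbb{R}^n\times\mathcal{P}_2(\mathbb{R}^d)\to\mathbb{R}^d$ be Lipschitz in all their arguments (with respect to $\mathcal{W}_2$ in the measure). Assume that $W_0(\cdot,\theta,\cdot)$ is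 $L^2$-monotone for every $\theta\in\mathbb{R}^n$, and that for all $\theta\in\mathbb{R}^n$ and $X,Y,U,V\in L^2(\Omega,\mathbb{R}^d)$ $$\mathbb{E}\big[(F(X,\theta,\mathcal{L}(X),U)-F(Y,\theta,\mathcal{L}(Y),V))\cdot(U-V)+(G(X,\theta,\mathcal{L}(X),U)-G(Y,\theta,\mathcal{L}(Y),V))\cdot(X-Y)\big]\ge 0.$$ Let $W:[0,T)\times\mathbb{R}^d\times\mathbb{R}^n\times\mathcal{P}_2(\mathbb{R}^d)\to\mathbb{R}^d$ be a smooth solution of $$\partial_tW+F(x,\theta,m,W)\cdot\nabla_xW+b(\theta)\cdot\nabla_\theta W-\sigma_x\Delta_xW-\sigma_\theta\Delta_\theta W+\int_{\mathbb{R}^d}F(y,\theta,m,W(t,y,\theta,m))\cdot D_mW(t,x,\theta,m)(y)\,m(dy)-\sigma_x\int_{\mathbb{R}^d}\mathrm{div}_y(D_mW(t,x,\theta,m)(y))\,m(dy)=G(x,\theta,m,W)$$ in $(0,T)\times\mathbb{R}^d\times\mathbb{R}^n\times\mathcal{P}_2(\mathbb{R}^d)$, with both integrals convergent and $W(0,x,\theta,m)=W_0(x,\theta,m)$.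 Then $W(t,\cdot,\theta,\cdot)$ is $L^2$-monotone for every $t\in[0,T)$ and $\theta\in\mathbb{R}^n$. Here $\nabla_mU(m)$ is the continuous function $\psi$ on $\mathbb{R}^d$, integrable against every $\nu\in\mathcal{P}_2(\mathbb{R}^d)$, with $\int\psi\,dm=0$ and $\lim_{\varepsilon\to0^+}\varepsilon^{-1}(U(m+\varepsilon(\nu-m))-U(m))=\int\psi\,d(\nu-m)$ for all $\nu\in\mathcal{P}_2(\mathbb{R}^d)$, and $D_mU(m)(y)=D_y\nabla_mU(m)(y)$. "Smooth" means: $W$ is continuous on $[0,T)\times\mathbb{R}^d\times\mathbb{R}^n\times\mathcal{P}_2(\mathbb{R}^d)$ and for every $a<T$ there is $C$ with $|W(t,x,\theta,m)|\le C(1+|x|+|\theta|+M_2(m))$ for $t\in[0,a]$; for $t\in(0,T)$ the derivatives $\partial_tW$, $D_xW$, $D_x^2W$, $D_\theta W$, $D^2_\theta W$, $D_mW$, $D_yD_mW$ exist and are jointly continuous in all their variables ($\mathcal{W}_2$ in $m$); and each of them has polynomial growth: it is bounded by $C(1+|x|+|\theta|+M_2(m)\,[+|y|])^q$, with $q$ independent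 of $t$ and $C$ uniform for $t$ in compact subsets of $(0,T)$. -/

import Mathlib

open MeasureTheory Set Filter Topology
open scoped ENNReal

noncomputable section

/-- The Euclidean space `ℝ^k`. -/
abbrev E (k : ℕ) : Type := EuclideanSpace ℝ (Fin k)

/-- `𝒫₂(ℝ^d)`: Borel probability measures on `ℝ^d` with finite second moment. -/
structure P2 (d : ℕ) where
  toMeasure : Measure (E d)
  isProb : IsProbabilityMeasure toMeasure
  memLp_id : MemLp (fun x : E d => x) 2 toMeasure

namespace P2

variable {d : ℕ}

/-- The couplings `Γ(μ, ν)`: measures on `ℝ^d × ℝ^d` with marginals `μ` and `ν`. -/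
def couplings (μ ν : P2 d) : Set (Measure (E d × E d)) :=
  {γ | γ.map Prod.fst = μ.toMeasure ∧ γ.map Prod.snd = ν.toMeasure}

/-- The Wasserstein distance `𝒲₂(μ, ν)`. The infimum is finite, since the product
coupling has finite cost. -/
def W2 (μ ν : P2 d) : ℝ :=
  Real.sqrt (⨅ γ ∈ couplings μ ν, ∫⁻ z, ‖z.1 - z.2‖ₑ ^ 2 ∂γ).toReal

/-- The topology of the metric `𝒲₂`: a set is open when it contains a `𝒲₂`-ball around
each of its points. -/
instance : TopologicalSpace (P2 d) where
  IsOpen s := ∀ μ ∈ s, ∃ ε > 0, ∀ ν, W2 μ ν < ε → ν ∈ s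
  isOpen_univ := fun _ _ => ⟨1, one_pos, fun _ _ => trivial⟩
  isOpen_inter := by
    rintro s t hs ht μ ⟨h1, h2⟩
    obtain ⟨ε, hε, h⟩ := hs μ h1
    obtain ⟨δ, hδ, h'⟩ := ht μ h2
    exact ⟨min ε δ, lt_min hε hδ, fun ν hν =>
      ⟨h ν (lt_of_lt_of_le hν (min_le_left _ _)), h' ν (lt_of_lt_of_le hν (min_le_right _ _))⟩⟩
  isOpen_sUnion := by
    rintro S hS μ ⟨s, hs, hμ⟩
    obtain ⟨ε, hε, h⟩ := hS s hs μ hμ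
    exact ⟨ε, hε, fun ν hν => ⟨s, hs, h ν hν⟩⟩

/-- `(∫ |x|² μ(dx))^{1/2}`. -/
def moment (μ : P2 d) : ℝ := Real.sqrt (∫ x, ‖x‖ ^ 2 ∂μ.toMeasure)

/-- The convex combination `m + ε (ν - m) = (1 - ε) m + ε ν` for `ε ∈ [0, 1]`. -/
def mix (m ν : P2 d) (ε : Icc (0 : ℝ) 1) : P2 d where
  toMeasure := ENNReal.ofReal (1 - ε) • m.toMeasure + ENNReal.ofReal ε • ν.toMeasure
  isProb := by
    have := m.isProb
    have := ν.isProb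
    constructor
    have h0 : (0 : ℝ) ≤ 1 - ε := by linarith [ε.2.2]
    simp only [Measure.coe_add, Measure.coe_smul, Pi.add_apply, Pi.smul_apply, measure_univ,
      smul_eq_mul, mul_one]
    rw [← ENNReal.ofReal_add h0 ε.2.1]
    simp
  memLp_id := by
    have h1 := m.memLp_id.smul_measure (ENNReal.ofReal_ne_top (r := 1 - (ε : ℝ)))
    have h2 := ν.memLp_id.smul_measure (ENNReal.ofReal_ne_top (r := (ε : ℝ)))
    have h1' := (memLp_two_iff_integrable_sq_norm h1.1).1 h1
    have h2' := (memLp_two_iff_integrable_sq_norm h2.1).1 h2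
    exact (memLp_two_iff_integrable_sq_norm aestronglyMeasurable_id).2 (h1'.add_measure h2')

end P2

/-- The law `ℒ(X) ∈ 𝒫₂(ℝ^d)` of a square integrable random variable `X`. -/
def law {Ω : Type*} [MeasurableSpace Ω] {P : Measure Ω} [IsProbabilityMeasure P] {d : ℕ}
    {X : Ω → E d} (hX : MemLp X 2 P) : P2 d where
  toMeasure := P.map X
  isProb := Measure.isProbabilityMeasure_map hX.aestronglyMeasurable.aemeasurable
  memLp_id :=
    (memLp_map_measure_iff aestronglyMeasurable_id hX.aestronglyMeasurable.aemeasurable).2 hX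

/-- `U : ℝ^d × 𝒫₂(ℝ^d) → ℝ^d` is `L²`-monotone (with respect to the probability space
`(Ω, P)`): `𝔼[(U(X, ℒ(X)) - U(Y, ℒ(Y))) · (X - Y)] ≥ 0` for all `X, Y ∈ L²(Ω, ℝ^d)`. -/
def IsL2Monotone {Ω : Type*} [MeasurableSpace Ω] (P : Measure Ω) [IsProbabilityMeasure P]
    {d : ℕ} (U : E d → P2 d → E d) : Prop :=
  ∀ (X Y : Ω → E d) (hX : MemLp X 2 P) (hY : MemLp Y 2 P),
    0 ≤ ∫ ω, inner ℝ (U (X ω) (law hX) - U (Y ω) (law hY)) (X ω - Y ω) ∂P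

/-- Joint `L²`-monotonicity of the pair `(F, G)` in `(x, w)`, for every `θ`. -/
def IsJointlyL2Monotone {Ω : Type*} [MeasurableSpace Ω] (P : Measure Ω) [IsProbabilityMeasure P]
    {d n : ℕ} (F G : E d → E n → P2 d → E d → E d) : Prop :=
  ∀ (θ : E n) (X Y U V : Ω → E d) (hX : MemLp X 2 P) (hY : MemLp Y 2 P)
    (_ : MemLp U 2 P) (_ : MemLp V 2 P),
    0 ≤ ∫ ω, (inner ℝ (F (X ω) θ (law hX) (U ω) - F (Y ω) θ (law hY) (V ω)) (U ω - V ω)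
      + inner ℝ (G (X ω) θ (law hX) (U ω) - G (Y ω) θ (law hY) (V ω)) (X ω - Y ω)) ∂P

/-- Lipschitz continuity of the initial datum in `(x, θ, m)`, with respect to `𝒲₂` in `m`. -/
def IsLipschitzInitial {d n : ℕ} (W₀ : E d → E n → P2 d → E d) : Prop :=
  ∃ C : ℝ, ∀ (x y : E d) (θ θ' : E n) (μ ν : P2 d),
    ‖W₀ x θ μ - W₀ y θ' ν‖ ≤ C * (‖x - y‖ + ‖θ - θ'‖ + P2.W2 μ ν)

/-- Lipschitz continuity of a coefficient in `(x, θ, m, w)`, with respect to `𝒲₂` in `m`. -/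
def IsLipschitzCoeff {d n : ℕ} (F : E d → E n → P2 d → E d → E d) : Prop :=
  ∃ C : ℝ, ∀ (x y : E d) (θ θ' : E n) (μ ν : P2 d) (p q : E d),
    ‖F x θ μ p - F y θ' ν q‖ ≤ C * (‖x - y‖ + ‖θ - θ'‖ + P2.W2 μ ν + ‖p - q‖)

/-- `ψ` is the normalized derivative `∇_m U(m)` of `U` at `m`: `ψ` is continuous, integrable
against every `ν ∈ 𝒫₂(ℝ^d)`, satisfies `∫ ψ dm = 0`, and
`(U(m + ε(ν - m)) - U(m)) / ε → ∫ ψ d(ν - m)` as `ε → 0⁺`, for every `ν ∈ 𝒫₂(ℝ^d)`. -/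
structure HasFlatDeriv {d : ℕ} (U : P2 d → E d) (m : P2 d) (ψ : E d → E d) : Prop where
  continuous : Continuous ψ
  integrable : ∀ ν : P2 d, Integrable ψ ν.toMeasure
  normalized : ∫ y, ψ y ∂m.toMeasure = 0
  deriv : ∀ ν : P2 d,
    HasDerivWithinAt (fun ε : ℝ => U (P2.mix m ν (projIcc 0 1 zero_le_one ε)))
      ((∫ y, ψ y ∂ν.toMeasure) - ∫ y, ψ y ∂m.toMeasure) (Icc 0 1) 0

/-- The `i`-th standard basis vector of `ℝ^k`. -/
abbrev basisVec {k : ℕ} (i : Fin k) : E k := EuclideanSpace.single i 1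

/-- `∑ᵢ A i eᵢ`. When `A i` is the derivative of `∂ᵢ f`, this is the Laplacian `Δ f`; when `A i`
is the derivative in `y` of the `i`-th column of `D_m W`, it is `div_y (D_m W)` (componentwise
in `W`). -/
def trace₂ {k d : ℕ} (A : Fin k → (E k →L[ℝ] E d)) : E d :=
  ∑ i, A i (basisVec i)

/-- The partial derivatives of a function `W(t, x, θ, m)`: `∂ₜW`, `D_x W`, `D²_x W`, `D_θ W`,
`D²_θ W`, the measure derivative `∇_m W(t, x, θ, m)(y)`, its gradient `D_m W = D_y ∇_m W`, and
`D_y D_m W`. A second derivative such as `D²_x W` is given by the derivatives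
`D_x (∂_{xᵢ} W)`, one for each `i`. They are tied to `W` in `IsSmooth`. -/
structure Jet (d n : ℕ) where
  dt : ℝ → E d → E n → P2 d → E d
  dx : ℝ → E d → E n → P2 d → (E d →L[ℝ] E d)
  dxx : ℝ → E d → E n → P2 d → Fin d → (E d →L[ℝ] E d)
  dθ : ℝ → E d → E n → P2 d → (E n →L[ℝ] E d)
  dθθ : ℝ → E d → E n → P2 d → Fin n → (E n →L[ℝ] E d)
  flat : ℝ → E d → E n → P2 d → E d → E d
  dm : ℝ → E d → E n → P2 d → E d → (E d →L[ℝ] E d)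
  dmy : ℝ → E d → E n → P2 d → E d → Fin d → (E d →L[ℝ] E d)

/-- `f(t, x, θ, m)` is continuous on `(0, T) × ℝ^d × ℝ^n × 𝒫₂(ℝ^d)` and has polynomial growth
in `(x, θ, m)`, locally uniformly in `t ∈ (0, T)`. -/
def IsAdmissible {d n : ℕ} {V : Type*} [NormedAddCommGroup V] (T : ℝ)
    (f : ℝ → E d → E n → P2 d → V) : Prop :=
  ContinuousOn (fun z : ℝ × E d × E n × P2 d => f z.1 z.2.1 z.2.2.1 z.2.2.2)
    (Ioo 0 T ×ˢ univ) ∧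
  ∃ q : ℕ, ∀ a b : ℝ, 0 < a → b < T → ∃ C : ℝ, ∀ t ∈ Icc a b, ∀ x θ m,
    ‖f t x θ m‖ ≤ C * (1 + ‖x‖ + ‖θ‖ + m.moment) ^ q

/-- The same for functions `f(t, x, θ, m, y)` with an additional variable `y ∈ ℝ^d`. -/
def IsAdmissible' {d n : ℕ} {V : Type*} [NormedAddCommGroup V] (T : ℝ)
    (f : ℝ → E d → E n → P2 d → E d → V) : Prop :=
  ContinuousOn (fun z : ℝ × E d × E n × P2 d × E d => f z.1 z.2.1 z.2.2.1 z.2.2.2.1 z.2.2.2.2)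
    (Ioo 0 T ×ˢ univ) ∧
  ∃ q : ℕ, ∀ a b : ℝ, 0 < a → b < T → ∃ C : ℝ, ∀ t ∈ Icc a b, ∀ x θ m y,
    ‖f t x θ m y‖ ≤ C * (1 + ‖x‖ + ‖θ‖ + m.moment + ‖y‖) ^ q

/-- `W` is smooth on `[0, T)` with derivatives `J`: `W` is continuous on
`[0, T) × ℝ^d × ℝ^n × 𝒫₂(ℝ^d)` with linear growth, locally uniformly in `t ∈ [0, T)`, and for
`t ∈ (0, T)` the derivatives `∂ₜW, D_x W, D²_x W, D_θ W, D²_θ W, D_m W, D_y D_m W` exist, are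
jointly continuous, and have polynomial growth. -/
structure IsSmooth {d n : ℕ} (T : ℝ) (W : ℝ → E d → E n → P2 d → E d) (J : Jet d n) : Prop where
  continuousOn : ContinuousOn
    (fun z : ℝ × E d × E n × P2 d => W z.1 z.2.1 z.2.2.1 z.2.2.2) (Ico 0 T ×ˢ univ)
  linearGrowth : ∀ a < T, ∃ C : ℝ, ∀ t ∈ Icc 0 a, ∀ x θ m,
    ‖W t x θ m‖ ≤ C * (1 + ‖x‖ + ‖θ‖ + m.moment)
  hasDeriv_t : ∀ t ∈ Ioo 0 T, ∀ x θ m, HasDerivAt (fun s => W s x θ m) (J.dt t x θ m) t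
  hasDeriv_x : ∀ t ∈ Ioo 0 T, ∀ x θ m, HasFDerivAt (fun x' => W t x' θ m) (J.dx t x θ m) x
  hasDeriv_xx : ∀ t ∈ Ioo 0 T, ∀ x θ m i,
    HasFDerivAt (fun x' => J.dx t x' θ m (basisVec i)) (J.dxx t x θ m i) x
  hasDeriv_θ : ∀ t ∈ Ioo 0 T, ∀ x θ m, HasFDerivAt (fun θ' => W t x θ' m) (J.dθ t x θ m) θ
  hasDeriv_θθ : ∀ t ∈ Ioo 0 T, ∀ x θ m i,
    HasFDerivAt (fun θ' => J.dθ t x θ' m (basisVec i)) (J.dθθ t x θ m i) θ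
  hasDeriv_m : ∀ t ∈ Ioo 0 T, ∀ x θ m,
    HasFlatDeriv (fun m' => W t x θ m') m (J.flat t x θ m)
  hasDeriv_my : ∀ t ∈ Ioo 0 T, ∀ x θ m y,
    HasFDerivAt (fun y' => J.flat t x θ m y') (J.dm t x θ m y) y
  hasDeriv_myy : ∀ t ∈ Ioo 0 T, ∀ x θ m y i,
    HasFDerivAt (fun y' => J.dm t x θ m y' (basisVec i)) (J.dmy t x θ m y i) y
  admissible_dt : IsAdmissible T J.dt
  admissible_dx : IsAdmissible T J.dx
  admissible_dxx : ∀ i, IsAdmissible T (fun t x θ m => J.dxx t x θ m i)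
  admissible_dθ : IsAdmissible T J.dθ
  admissible_dθθ : ∀ i, IsAdmissible T (fun t x θ m => J.dθθ t x θ m i)
  admissible_dm : IsAdmissible' T J.dm
  admissible_dmy : ∀ i, IsAdmissible' T (fun t x θ m y => J.dmy t x θ m y i)

/-- `W` is a smooth solution on `[0, T)` of
`∂ₜW + F(x,θ,m,W)·∇_x W + b(θ)·∇_θ W - σx Δ_x W - σθ Δ_θ W
  + ∫ F(y,θ,m,W(t,y,θ,m))·D_m W(t,x,θ,m)(y) m(dy) - σx ∫ div_y(D_m W(t,x,θ,m)(y)) m(dy)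
  = G(x,θ,m,W)`, with `W(0,·) = W₀`; both integrals are required to converge. -/
def IsSmoothSolution {d n : ℕ} (T σx σθ : ℝ) (b : E n → E n)
    (F G : E d → E n → P2 d → E d → E d) (W₀ : E d → E n → P2 d → E d)
    (W : ℝ → E d → E n → P2 d → E d) : Prop :=
  (∀ x θ m, W 0 x θ m = W₀ x θ m) ∧
  ∃ J : Jet d n, IsSmooth T W J ∧
    ∀ t ∈ Ioo 0 T, ∀ x θ m,
      Integrable (fun y => J.dm t x θ m y (F y θ m (W t y θ m))) m.toMeasure ∧
      Integrable (fun y => trace₂ (J.dmy t x θ m y)) m.toMeasure ∧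
      J.dt t x θ m + J.dx t x θ m (F x θ m (W t x θ m)) + J.dθ t x θ m (b θ)
        - σx • trace₂ (J.dxx t x θ m) - σθ • trace₂ (J.dθθ t x θ m)
        + (∫ y, J.dm t x θ m y (F y θ m (W t y θ m)) ∂m.toMeasure)
        - σx • (∫ y, trace₂ (J.dmy t x θ m y) ∂m.toMeasure)
      = G x θ m (W t x θ m)

end

/-!
Suppose that the pairing
`Φ(t, θ, X, Y) = E[(W(t, X, θ, ℒ(X)) - W(t, Y, θ, ℒ(Y))) · (X - Y)]`
is negative at some point. It depends only on the joint law of `(X, Y)`, so the sample space may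
be taken to be `[0, 1]^ℕ` (`exists_map_prod_eq`), and variables with moments of high order are
enough (`exists_tendsto_bounded`). The contradiction comes from a minimum principle
(`corr_nonneg`) applied to `Φ` as a function of time and of the configuration `(θ, X, Y)`, plus a
barrier `ε e^{lt} (1 + |θ|^p + E|X|^p + E|Y|^p)` whose even exponent `p` exceeds the growth of all
derivatives of `W`.

There is no compactness in `Lᵖ`. The minimum is provided by the variational principle of Borwein
and Preiss (`exists_min_add_gauge`): after adding a small series of `p`-th powers of distances, the
minimum is attained (`Config.exists_test`), and at a positive time because the initial value is
monotone. The minimiser is compared with the following competitors: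

* itself at an earlier time, which gives `∂_t W`;
* `θ` moved along `-b(θ)`, which gives `b(θ) · ∇_θ W`;
* `θ ± √h e_j`, which gives `Δ_θ W`;
* `X` and `Y` moved along `-F`, which gives the transport terms, local and nonlocal, and the product
  of the increments of `F` and `W`;
* `X ± √h e_i` and `Y ± √h e_i`, with a common sign read from a far coordinate of `[0, 1]^ℕ`. In the
  limit this sign is independent of `(X, Y)`, so the first-order terms cancel; the difference
  `X - Y` does not move, and the terms left are `Δ_x W` and the integral of `div_y D_m W`
  (`Config.tendsto_corr_noisy`, `Config.tendsto_noisyCorr`).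

The expansion of `W` along a displacement of the law uses the mean value theorem along a segment of
measures (`tendsto_integral_step`). It needs no second derivative in the measure: the linear
derivative is taken at a point of the segment, which tends to the initial law, and is then expanded
to second order in its space variable, where the first-order term has mean zero. The increments of
the barrier and of the perturbation are of order `h`, by `norm_add_smul_pow_le` and
`norm_symm_pow_le`. In the sum of the comparisons, the equation at `X` and at `Y`
(`integral_equation`) turns the derivatives of `Φ` into the expression which the joint monotonicity
of `(F, G)` makes nonnegative, while the barrier contributes a negative amount as soon as `l` is
large.
-/

noncomputable section

/-! ### Metric and affine structure of `𝒫₂(ℝᵈ)`; laws of random variables -/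

namespace P2

variable {d : ℕ}

theorem ext_toMeasure {μ ν : P2 d} (h : μ.toMeasure = ν.toMeasure) : μ = ν := by
  cases μ; cases ν; cases h; rfl

/-- `μ` and `ν` admit a coupling of quadratic cost at most `c`. -/
def CostLE (μ ν : P2 d) (c : ℝ≥0∞) : Prop :=
  ∃ γ ∈ couplings μ ν, ∫⁻ z, ‖z.1 - z.2‖ₑ ^ 2 ∂γ ≤ c

theorem CostLE.W2_le {μ ν : P2 d} {c : ℝ} (hc : 0 ≤ c) (h : CostLE μ ν (ENNReal.ofReal (c ^ 2))) :
    W2 μ ν ≤ c := by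
  obtain ⟨γ, hγ, hle⟩ := h
  have h1 : (⨅ γ ∈ couplings μ ν, ∫⁻ z, ‖z.1 - z.2‖ₑ ^ 2 ∂γ) ≤ ENNReal.ofReal (c ^ 2) :=
    (iInf₂_le γ hγ).trans hle
  refine Real.sqrt_le_iff.2 ⟨hc, ?_⟩
  have := ENNReal.toReal_mono ENNReal.ofReal_ne_top h1
  rwa [ENNReal.toReal_ofReal (sq_nonneg c)] at this

theorem costLE_self (μ : P2 d) (c : ℝ≥0∞) : CostLE μ μ c := by
  refine ⟨μ.toMeasure.map (fun x => (x, x)), ⟨?_, ?_⟩, ?_⟩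
  · rw [Measure.map_map measurable_fst (by fun_prop)]; exact Measure.map_id
  · rw [Measure.map_map measurable_snd (by fun_prop)]; exact Measure.map_id
  · rw [lintegral_map (by fun_prop) (by fun_prop)]; simp

theorem mix_toMeasure (m ν : P2 d) (ε : Icc (0 : ℝ) 1) : (mix m ν ε).toMeasure =
    ENNReal.ofReal (1 - ε) • m.toMeasure + ENNReal.ofReal ε • ν.toMeasure := rfl

theorem ofReal_one_sub_add (ε : Icc (0 : ℝ) 1) :
    ENNReal.ofReal (1 - ε) + ENNReal.ofReal ε = 1 := by
  have h0 : (0 : ℝ) ≤ 1 - ε := by linarith [ε.2.2]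
  rw [← ENNReal.ofReal_add h0 ε.2.1]; simp

/-- The set of measures within a given transport cost of `m` is convex. -/
theorem CostLE.mix {m μ ν : P2 d} {c : ℝ≥0∞} (hμ : CostLE m μ c) (hν : CostLE m ν c)
    (ε : Icc (0 : ℝ) 1) : CostLE m (mix μ ν ε) c := by
  obtain ⟨γ, ⟨h1, h2⟩, h3⟩ := hμ
  obtain ⟨γ', ⟨h1', h2'⟩, h3'⟩ := hν
  refine ⟨ENNReal.ofReal (1 - ε) • γ + ENNReal.ofReal ε • γ', ⟨?_, ?_⟩, ?_⟩
  · rw [Measure.map_add _ _ measurable_fst, Measure.map_smul, Measure.map_smul, h1, h1',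
      ← add_smul, ofReal_one_sub_add, one_smul]
  · rw [Measure.map_add _ _ measurable_snd, Measure.map_smul, Measure.map_smul, h2, h2',
      mix_toMeasure]
  · rw [lintegral_add_measure, lintegral_smul_measure, lintegral_smul_measure]
    calc _ ≤ ENNReal.ofReal (1 - ε) • c + ENNReal.ofReal ε • c := by gcongr
      _ = c := by rw [← add_smul, ofReal_one_sub_add, one_smul]

/-- The topology of `P2` is defined by balls, so only the distance from the limit matters. -/
theorem tendsto_nhds_of_W2 {ι : Type*} {l : Filter ι} {u : ι → P2 d} {m : P2 d}
    (h : Tendsto (fun i => W2 m (u i)) l (𝓝 0)) : Tendsto u l (𝓝 m) := by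
  intro s hs
  obtain ⟨o, hos, ho, hm⟩ := mem_nhds_iff.1 hs
  obtain ⟨ε, hε, H⟩ := ho m hm
  exact (h.eventually (gt_mem_nhds hε)).mono fun i hi => hos (H _ hi)

theorem tendsto_nhds_of_costLE {ι : Type*} {l : Filter ι} {u : ι → P2 d} {m : P2 d} {c : ι → ℝ}
    (hc : Tendsto c l (𝓝 0)) (h : ∀ᶠ i in l, CostLE m (u i) (ENNReal.ofReal (c i))) :
    Tendsto u l (𝓝 m) := by
  refine tendsto_nhds_of_W2 ?_
  have h0 : Tendsto (fun i => Real.sqrt |c i|) l (𝓝 0) := by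
    simpa using (hc.abs).sqrt
  refine squeeze_zero' (Eventually.of_forall fun i => Real.sqrt_nonneg _) ?_ h0
  filter_upwards [h] with i hi
  obtain ⟨γ, hγ, hle⟩ := hi
  refine CostLE.W2_le (Real.sqrt_nonneg _) ⟨γ, hγ, hle.trans ?_⟩
  rw [Real.sq_sqrt (abs_nonneg _)]
  exact ENNReal.ofReal_le_ofReal (le_abs_self _)

theorem integral_mix {V : Type*} [NormedAddCommGroup V] [NormedSpace ℝ V] {m ν : P2 d}
    {φ : E d → V} (h1 : Integrable φ m.toMeasure) (h2 : Integrable φ ν.toMeasure)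
    (ε : Icc (0 : ℝ) 1) : ∫ y, φ y ∂(mix m ν ε).toMeasure =
      (1 - (ε : ℝ)) • ∫ y, φ y ∂m.toMeasure + (ε : ℝ) • ∫ y, φ y ∂ν.toMeasure := by
  have h0 : (0 : ℝ) ≤ 1 - ε := by linarith [ε.2.2]
  rw [mix_toMeasure, integral_add_measure (h1.smul_measure ENNReal.ofReal_ne_top)
    (h2.smul_measure ENNReal.ofReal_ne_top), integral_smul_measure, integral_smul_measure,
    ENNReal.toReal_ofReal h0, ENNReal.toReal_ofReal ε.2.1]

theorem integrable_sq_norm (m : P2 d) : Integrable (fun x : E d => ‖x‖ ^ 2) m.toMeasure :=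
  (memLp_two_iff_integrable_sq_norm m.memLp_id.1).1 m.memLp_id

theorem moment_nonneg (m : P2 d) : 0 ≤ m.moment := Real.sqrt_nonneg _

theorem moment_sq (m : P2 d) : m.moment ^ 2 = ∫ x, ‖x‖ ^ 2 ∂m.toMeasure :=
  Real.sq_sqrt (integral_nonneg fun _ => by positivity)

theorem moment_mix_le {m ν : P2 d} {B : ℝ} (h1 : m.moment ≤ B) (h2 : ν.moment ≤ B)
    (ε : Icc (0 : ℝ) 1) : (mix m ν ε).moment ≤ B := by
  have hB : 0 ≤ B := m.moment_nonneg.trans h1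
  refine abs_le_of_sq_le_sq' ?_ hB |>.2
  rw [moment_sq, integral_mix m.integrable_sq_norm ν.integrable_sq_norm, ← moment_sq, ← moment_sq]
  have h3 := pow_le_pow_left₀ m.moment_nonneg h1 2
  have h4 := pow_le_pow_left₀ ν.moment_nonneg h2 2
  have := ε.2.1
  have := ε.2.2
  simp only [smul_eq_mul]
  nlinarith

/-- Moving from a point of the segment `[m, ν]` towards its end point `ν`. -/
theorem mix_mix_right (m ν : P2 d) (a e c : Icc (0 : ℝ) 1) (h : (c : ℝ) = a + e * (1 - a)) :
    mix (mix m ν a) ν e = mix m ν c := by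
  have ha := a.2.2; have ha0 := a.2.1; have he := e.2.2; have he0 := e.2.1
  refine ext_toMeasure ?_
  rw [mix_toMeasure, mix_toMeasure, mix_toMeasure, smul_add, smul_smul, smul_smul, add_assoc,
    ← add_smul, ← ENNReal.ofReal_mul (by linarith), ← ENNReal.ofReal_mul (by linarith),
    ← ENNReal.ofReal_add (mul_nonneg (by linarith) ha0) he0, h]
  congr 3 <;> ring

/-- Moving from a point of the segment `[m, ν]` towards its initial point `m`. -/
theorem mix_mix_left (m ν : P2 d) (a e c : Icc (0 : ℝ) 1) (h : (c : ℝ) = a - e * a) :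
    mix (mix m ν a) m e = mix m ν c := by
  have ha := a.2.2; have ha0 := a.2.1; have he := e.2.2; have he0 := e.2.1
  refine ext_toMeasure ?_
  rw [mix_toMeasure, mix_toMeasure, mix_toMeasure, smul_add, smul_smul, smul_smul, add_right_comm,
    ← add_smul, ← ENNReal.ofReal_mul (by linarith), ← ENNReal.ofReal_mul (by linarith),
    ← ENNReal.ofReal_add (mul_nonneg (by linarith) (by linarith)) he0, h]
  congr 3 <;> ring

theorem mix_zero (m ν : P2 d) (a : Icc (0 : ℝ) 1) (h : (a : ℝ) = 0) : mix m ν a = m := by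
  refine ext_toMeasure ?_
  rw [mix_toMeasure, h]; simp

theorem mix_one (m ν : P2 d) (a : Icc (0 : ℝ) 1) (h : (a : ℝ) = 1) : mix m ν a = ν := by
  refine ext_toMeasure ?_
  rw [mix_toMeasure, h]; simp

end P2

section law

variable {Ω : Type*} [MeasurableSpace Ω] {P : Measure Ω} [IsProbabilityMeasure P] {d : ℕ}

theorem costLE_law {X Y : Ω → E d} (hX : MemLp X 2 P) (hY : MemLp Y 2 P) :
    P2.CostLE (law hX) (law hY) (∫⁻ ω, ‖X ω - Y ω‖ₑ ^ 2 ∂P) := by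
  have h1 := hX.1.aemeasurable
  have h2 := hY.1.aemeasurable
  refine ⟨P.map (fun ω => (X ω, Y ω)), ⟨?_, ?_⟩, ?_⟩
  · rw [AEMeasurable.map_map_of_aemeasurable measurable_fst.aemeasurable (h1.prodMk h2)]; rfl
  · rw [AEMeasurable.map_map_of_aemeasurable measurable_snd.aemeasurable (h1.prodMk h2)]; rfl
  · rw [lintegral_map' (by fun_prop) (h1.prodMk h2)]

theorem integral_law {V : Type*} [NormedAddCommGroup V] [NormedSpace ℝ V] {X : Ω → E d}
    (hX : MemLp X 2 P) {φ : E d → V} (hφ : Continuous φ) :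
    ∫ y, φ y ∂(law hX).toMeasure = ∫ ω, φ (X ω) ∂P :=
  integral_map hX.1.aemeasurable hφ.aestronglyMeasurable

theorem integrable_law_iff {V : Type*} [NormedAddCommGroup V] {X : Ω → E d}
    (hX : MemLp X 2 P) {φ : E d → V} (hφ : Continuous φ) :
    Integrable φ (law hX).toMeasure ↔ Integrable (fun ω => φ (X ω)) P :=
  integrable_map_measure hφ.aestronglyMeasurable hX.1.aemeasurable

theorem moment_law_sq {X : Ω → E d} (hX : MemLp X 2 P) :
    (law hX).moment ^ 2 = ∫ ω, ‖X ω‖ ^ 2 ∂P := by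
  rw [P2.moment_sq, integral_law hX (by fun_prop)]

theorem lintegral_enorm_sq_eq {P : Measure Ω} {X : Ω → E d} (hX : MemLp X 2 P) :
    ∫⁻ ω, ‖X ω‖ₑ ^ 2 ∂P = ENNReal.ofReal (∫ ω, ‖X ω‖ ^ 2 ∂P) := by
  rw [ofReal_integral_eq_lintegral_ofReal ((memLp_two_iff_integrable_sq_norm hX.1).1 hX)
    (Eventually.of_forall fun _ => by positivity)]
  refine lintegral_congr fun ω => ?_
  rw [ENNReal.ofReal_pow (norm_nonneg _), ofReal_norm]

theorem costLE_law' {X Y : Ω → E d} (hX : MemLp X 2 P) (hY : MemLp Y 2 P) :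
    P2.CostLE (law hX) (law hY) (ENNReal.ofReal (∫ ω, ‖X ω - Y ω‖ ^ 2 ∂P)) := by
  have := costLE_law hX hY
  rwa [lintegral_enorm_sq_eq (X := fun ω => X ω - Y ω) (hX.sub hY)] at this

theorem W2_law_le {X Y : Ω → E d} (hX : MemLp X 2 P) (hY : MemLp Y 2 P) :
    P2.W2 (law hX) (law hY) ≤ Real.sqrt (∫ ω, ‖X ω - Y ω‖ ^ 2 ∂P) := by
  refine P2.CostLE.W2_le (Real.sqrt_nonneg _) ?_
  rw [Real.sq_sqrt (integral_nonneg fun _ => by positivity)]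
  exact costLE_law' hX hY

end law

/-! ### A smooth variational principle -/

/-- **Smooth variational principle** (Borwein–Preiss). A continuous function `f`, bounded
below on a complete metric space, attains its minimum after adding an arbitrarily small
series of translates `2⁻ⁱ ρ(·, xᵢ)` of a gauge `ρ`; the minimiser can be taken in a given
nonempty strict sublevel set of `f`, and within gauge `1` of every `xᵢ`. -/
theorem exists_min_add_gauge {M : Type*} [MetricSpace M] [CompleteSpace M] {f : M → ℝ}
    (hf : Continuous f) (hbdd : BddBelow (range f)) {ρ : M → M → ℝ}
    (hρc : ∀ x, Continuous (fun y => ρ y x)) (hρ0 : ∀ x y, 0 ≤ ρ x y) (hρs : ∀ x, ρ x x = 0)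
    (hρd : ∀ ε > 0, ∃ δ > 0, ∀ x y, ρ x y ≤ δ → dist x y ≤ ε)
    {c : ℝ} (hc : ∃ x, f x < c) {δ : ℝ} (hδ : 0 < δ) :
    ∃ (z : M) (x : ℕ → M), f z < c ∧ (∀ i, ρ z (x i) ≤ 1) ∧ Tendsto x atTop (𝓝 z) ∧
      ∀ y, Summable (fun i => (1 / 2 : ℝ) ^ i * ρ y (x i)) →
        f z + δ * ∑' i, (1 / 2 : ℝ) ^ i * ρ z (x i) ≤
        f y + δ * ∑' i, (1 / 2 : ℝ) ^ i * ρ y (x i) := by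
  classical
  -- almost minimisers on a set
  have step : ∀ (g : M → ℝ) (S : Set M), BddBelow (range g) → S.Nonempty → ∀ η > 0,
      ∃ p ∈ S, ∀ y ∈ S, g p ≤ g y + η := by
    intro g S hg hS η hη
    have hb : BddBelow (g '' S) := hg.mono (image_subset_range _ _)
    obtain ⟨_, ⟨p, hp, rfl⟩, hlt⟩ := exists_lt_of_csInf_lt (hS.image g)
      (lt_add_of_pos_right (sInf (g '' S)) hη)
    exact ⟨p, hp, fun y hy => by linarith [csInf_le hb (mem_image_of_mem g hy)]⟩
  have bdd : ∀ (g : M → ℝ) (r : ℝ) (p : M), 0 ≤ r → BddBelow (range g) →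
      BddBelow (range fun y => g y + r * ρ y p) := by
    rintro g r p hr ⟨B, hB⟩
    refine ⟨B, ?_⟩
    rintro _ ⟨y, rfl⟩
    have := hB ⟨y, rfl⟩
    have := mul_nonneg hr (hρ0 y p)
    simp only
    linarith
  -- a state: the perturbed function, the current centre, the set still under consideration; the
  -- tolerance `4⁻ⁿ` against the weight `2⁻ⁿ` of the gauge confines the next set to gauge `2⁻ⁿ`
  let Good : ℕ → (M → ℝ) × M × Set M → Prop := fun n s =>
    BddBelow (range s.1) ∧ Continuous s.1 ∧ IsClosed s.2.2 ∧ s.2.1 ∈ s.2.2 ∧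
      ∀ y ∈ s.2.2, s.1 s.2.1 ≤ s.1 y + δ * (1 / 4) ^ n
  let nf : ℕ → (M → ℝ) × M × Set M → (M → ℝ) := fun n s y => s.1 y + δ * (1 / 2) ^ n * ρ y s.2.1
  let nS : ℕ → (M → ℝ) × M × Set M → Set M := fun n s => s.2.2 ∩ {y | nf n s y ≤ s.1 s.2.1}
  have hex : ∀ n s, Good n s → ∃ s', Good (n + 1) s' ∧ s'.1 = nf n s ∧ s'.2.2 = nS n s := by
    rintro n s ⟨h1, h2, h3, h4, h5⟩
    have hr : 0 ≤ δ * (1 / 2) ^ n := by positivity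
    have hb := bdd s.1 _ s.2.1 hr h1
    have hne : (nS n s).Nonempty := ⟨s.2.1, h4, by simp [nf, hρs]⟩
    obtain ⟨p, hp, hp'⟩ := step (nf n s) (nS n s) hb hne (δ * (1 / 4) ^ (n + 1)) (by positivity)
    have hcn : Continuous (nf n s) := h2.add (continuous_const.mul (hρc _))
    exact ⟨(nf n s, p, nS n s), ⟨hb, hcn, h3.inter (isClosed_le hcn continuous_const), hp, hp'⟩,
      rfl, rfl⟩
  obtain ⟨p0, hp0⟩ := hc
  obtain ⟨q0, hq0, hq0'⟩ := step f {y | f y ≤ f p0} hbdd ⟨p0, le_refl (f p0)⟩ δ hδ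
  have G0 : Good 0 (f, q0, univ) := by
    refine ⟨hbdd, hf, isClosed_univ, mem_univ _, fun y _ => ?_⟩
    simp only [pow_zero, mul_one]
    by_cases hy : f y ≤ f p0
    · exact hq0' y hy
    · have : f q0 ≤ f p0 := hq0
      push Not at hy
      linarith
  let T := fun n => {s : (M → ℝ) × M × Set M // Good n s}
  let st : ∀ n, T n := fun n => Nat.rec (motive := T) ⟨_, G0⟩
    (fun n s => ⟨(hex n s.1 s.2).choose, (hex n s.1 s.2).choose_spec.1⟩) n
  have st1 : ∀ n, (st (n + 1)).1.1 = nf n (st n).1 := fun n =>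
    (hex n (st n).1 (st n).2).choose_spec.2.1
  have st2 : ∀ n, (st (n + 1)).1.2.2 = nS n (st n).1 := fun n =>
    (hex n (st n).1 (st n).2).choose_spec.2.2
  let x : ℕ → M := fun n => (st n).1.2.1
  let S : ℕ → Set M := fun n => (st n).1.2.2
  let g : ℕ → M → ℝ := fun n => (st n).1.1
  have hg0 : g 0 = f := rfl
  have hgs : ∀ n y, g (n + 1) y = g n y + δ * (1 / 2) ^ n * ρ y (x n) := fun n y =>
    congrFun (st1 n) y
  have hSs : ∀ n, S (n + 1) = S n ∩ {y | g (n + 1) y ≤ g n (x n)} := fun n => by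
    have := st2 n
    simp only [nS, ← st1 n] at this
    exact this
  have hcl : ∀ n, IsClosed (S n) := fun n => (st n).2.2.2.1
  have hxS : ∀ n, x n ∈ S n := fun n => (st n).2.2.2.2.1
  have hmin : ∀ n, ∀ y ∈ S n, g n (x n) ≤ g n y + δ * (1 / 4) ^ n := fun n =>
    (st n).2.2.2.2.2
  have hanti : Antitone S := antitone_nat_of_succ_le fun n => by
    rw [hSs]; exact inter_subset_left
  have hsmall : ∀ n, ∀ y ∈ S (n + 1), ρ y (x n) ≤ (1 / 2) ^ n := by
    intro n y hy
    have hy' := hy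
    rw [hSs] at hy'
    have h1 : g (n + 1) y ≤ g n (x n) := hy'.2
    have h2 := hmin n y hy'.1
    rw [hgs] at h1
    have h3 : δ * (1 / 2) ^ n * ρ y (x n) ≤ δ * (1 / 2) ^ n * (1 / 2) ^ n := by
      rw [mul_assoc δ, mul_assoc δ, ← mul_pow]
      norm_num at h1 h2 ⊢
      linarith
    exact le_of_mul_le_mul_left h3 (by positivity)
  have hdist : ∀ ε > 0, ∃ n, ∀ y ∈ S n, ∀ y' ∈ S n, dist y y' ≤ ε := by
    intro ε hε
    obtain ⟨η, hη, H⟩ := hρd (ε / 2) (by linarith)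
    obtain ⟨n, hn⟩ := exists_pow_lt_of_lt_one hη (by norm_num : (1 / 2 : ℝ) < 1)
    refine ⟨n + 1, fun y hy y' hy' => ?_⟩
    have h1 := H y (x n) ((hsmall n y hy).trans hn.le)
    have h2 := H y' (x n) ((hsmall n y' hy').trans hn.le)
    linarith [dist_triangle_right y y' (x n)]
  have hcau : CauchySeq x := by
    refine Metric.cauchySeq_iff'.2 fun ε hε => ?_
    obtain ⟨n, hn⟩ := hdist (ε / 2) (by linarith)
    exact ⟨n, fun m hm => (hn _ (hanti hm (hxS m)) _ (hxS n)).trans_lt (by linarith)⟩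
  obtain ⟨z, hz⟩ := cauchySeq_tendsto_of_complete hcau
  have hzS : ∀ n, z ∈ S n := fun n => (hcl n).mem_of_tendsto hz
    ((eventually_ge_atTop n).mono fun m hm => hanti hm (hxS m))
  have hgsum : ∀ n y, g n y = f y + δ * ∑ i ∈ Finset.range n, (1 / 2 : ℝ) ^ i * ρ y (x i) := by
    intro n y
    induction n with
    | zero => simp [hg0]
    | succ n ih => rw [hgs, ih, Finset.sum_range_succ]; ring
  have hterm : ∀ y i, 0 ≤ (1 / 2 : ℝ) ^ i * ρ y (x i) := fun y i =>
    mul_nonneg (by positivity) (hρ0 _ _)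
  have hz1 : ∀ n, ρ z (x n) ≤ (1 / 2) ^ n := fun n => hsmall n z (hzS _)
  have hz1' : ∀ n, ρ z (x n) ≤ 1 := fun n =>
    (hz1 n).trans (pow_le_one₀ (by norm_num) (by norm_num))
  have hdec : ∀ n, g (n + 1) (x (n + 1)) ≤ g n (x n) := fun n => by
    have := hxS (n + 1)
    rw [hSs] at this
    exact this.2
  have hdec' : Antitone fun n => g n (x n) := antitone_nat_of_succ_le hdec
  have hzg : ∀ n, g (n + 1) z ≤ g n (x n) := fun n => by
    have := hzS (n + 1)
    rw [hSs] at this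
    exact this.2
  have hfz : f z ≤ f p0 := by
    have h1 := hzg 0
    have h2 : f q0 ≤ f p0 := hq0
    rw [hgs, hg0] at h1
    have h3 : 0 ≤ δ * (1 / 2) ^ 0 * ρ z (x 0) := mul_nonneg (by positivity) (hρ0 _ _)
    have h4 : f (x 0) = f q0 := rfl
    linarith
  refine ⟨z, x, hfz.trans_lt hp0, hz1', hz, fun y hy => ?_⟩
  have hzsum : Summable (fun i => (1 / 2 : ℝ) ^ i * ρ z (x i)) := by
    refine Summable.of_nonneg_of_le (hterm z) (fun i => ?_) summable_geometric_two
    exact mul_le_of_le_one_right (by positivity) (hz1' i)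
  have hlim : ∀ n, f z + δ * ∑' i, (1 / 2 : ℝ) ^ i * ρ z (x i) ≤ g n (x n) := by
    intro n
    have ht : Tendsto (fun m => g (m + 1) z) atTop
        (𝓝 (f z + δ * ∑' i, (1 / 2 : ℝ) ^ i * ρ z (x i))) := by
      have := (hzsum.hasSum.tendsto_sum_nat.const_mul δ).const_add (f z)
      refine (this.comp (tendsto_add_atTop_nat 1)).congr fun m => ?_
      rw [hgsum]; rfl
    exact le_of_tendsto ht ((eventually_ge_atTop n).mono fun m hm => (hzg m).trans (hdec' hm))
  have hley : ∀ n, g n y ≤ f y + δ * ∑' i, (1 / 2 : ℝ) ^ i * ρ y (x i) := by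
    intro n
    rw [hgsum]
    have := hy.sum_le_tsum (Finset.range n) (fun i _ => hterm y i)
    gcongr
  by_cases hyS : ∀ n, y ∈ S n
  · -- then `y` is a limit of the same sequence
    have : y = z := by
      refine dist_le_zero.1 (le_of_forall_pos_le_add fun ε hε => ?_)
      obtain ⟨n, hn⟩ := hdist ε hε
      simpa using hn y (hyS n) z (hzS n)
    rw [this]
  · -- otherwise `y` is discarded at some step, where the perturbed function is too large at `y`
    push Not at hyS
    have hfind := Nat.find_spec hyS
    obtain ⟨n, hn⟩ : ∃ n, Nat.find hyS = n + 1 := by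
      refine Nat.exists_eq_succ_of_ne_zero fun h => ?_
      rw [h] at hfind
      exact hfind (mem_univ _)
    have hyn : y ∈ S n := by
      by_contra h
      have := Nat.find_min' hyS h
      omega
    rw [hn, hSs] at hfind
    have : g n (x n) < g (n + 1) y := by
      by_contra h
      exact hfind ⟨hyn, not_lt.1 h⟩
    linarith [hlim n, hley (n + 1)]

/-! ### Increments of powers of norms -/

theorem norm_add_pow_le {V : Type*} [SeminormedAddCommGroup V] (a v : V) (p : ℕ) :
    ‖a + v‖ ^ p ≤ 2 ^ p * (‖a‖ ^ p + ‖v‖ ^ p) := by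
  calc ‖a + v‖ ^ p ≤ (‖a‖ + ‖v‖) ^ p := by gcongr; exact norm_add_le _ _
    _ ≤ 2 ^ (p - 1) * (‖a‖ ^ p + ‖v‖ ^ p) := add_pow_le (norm_nonneg _) (norm_nonneg _) p
    _ ≤ 2 ^ p * (‖a‖ ^ p + ‖v‖ ^ p) := by
      gcongr
      · norm_num
      · omega

/-- A drift of size `h` changes `‖·‖ ^ p` by `O(h)`, by convexity along `[a, a + v]`. -/
theorem norm_add_smul_pow_le {V : Type*} [SeminormedAddCommGroup V] [NormedSpace ℝ V] (a v : V)
    (p : ℕ) {h : ℝ} (h0 : 0 ≤ h) (h1 : h ≤ 1) :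
    ‖a + h • v‖ ^ p ≤ ‖a‖ ^ p + h * (2 ^ p * (‖a‖ ^ p + ‖v‖ ^ p)) := by
  have hA := norm_nonneg a
  have hB := norm_nonneg v
  have e : ‖a + h • v‖ ≤ (1 - h) * ‖a‖ + h * (‖a‖ + ‖v‖) := by
    calc ‖a + h • v‖ ≤ ‖a‖ + h * ‖v‖ := by
          refine (norm_add_le _ _).trans ?_
          rw [norm_smul, Real.norm_of_nonneg h0]
      _ = _ := by ring
  have h2 := (convexOn_pow (𝕜 := ℝ) p).2 (mem_Ici.2 hA) (mem_Ici.2 (add_nonneg hA hB))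
    (by linarith : 0 ≤ 1 - h) h0 (by ring)
  have h3 : (‖a‖ + ‖v‖) ^ p ≤ 2 ^ p * (‖a‖ ^ p + ‖v‖ ^ p) := by
    refine (add_pow_le hA hB p).trans ?_
    gcongr
    · norm_num
    · omega
  simp only [smul_eq_mul] at h2
  calc ‖a + h • v‖ ^ p ≤ ((1 - h) * ‖a‖ + h * (‖a‖ + ‖v‖)) ^ p := by gcongr
    _ ≤ (1 - h) * ‖a‖ ^ p + h * (‖a‖ + ‖v‖) ^ p := h2
    _ ≤ 1 * ‖a‖ ^ p + h * (2 ^ p * (‖a‖ ^ p + ‖v‖ ^ p)) := by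
      gcongr
      linarith
    _ = _ := by ring

/-- The even part in `s` of `(α + β s² + 2 s c)^k`, as a function of `s² ∈ [0, 1]`, lies below its
chord: it is a polynomial in `s²` with nonnegative coefficients. -/
theorem even_part_pow_le {α β c s : ℝ} (hα : 0 ≤ α) (hβ : 0 ≤ β) (hs0 : 0 ≤ s) (hs1 : s ≤ 1)
    (k : ℕ) :
    (α + β * s ^ 2 + 2 * s * c) ^ k + (α + β * s ^ 2 - 2 * s * c) ^ k ≤
      (1 - s ^ 2) * (2 * α ^ k) + s ^ 2 * ((α + β + 2 * c) ^ k + (α + β - 2 * c) ^ k) := by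
  have hh0 : 0 ≤ s ^ 2 := sq_nonneg s
  have hh1 : s ^ 2 ≤ 1 := pow_le_one₀ hs0 hs1
  -- with `A = α + β s²` and `B = 2 s c`, the induction carries the even part
  -- `(A + B)^k + (A - B)^k` together with `B ((A + B)^k - (A - B)^k)`
  suffices H : ∀ k : ℕ,
      (α + β * s ^ 2 + 2 * s * c) ^ k + (α + β * s ^ 2 - 2 * s * c) ^ k ≤
        (1 - s ^ 2) * (2 * α ^ k) + s ^ 2 * ((α + β + 2 * c) ^ k + (α + β - 2 * c) ^ k) ∧
      2 * s * c * ((α + β * s ^ 2 + 2 * s * c) ^ k - (α + β * s ^ 2 - 2 * s * c) ^ k) ≤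
        s ^ 2 * (2 * c * ((α + β + 2 * c) ^ k - (α + β - 2 * c) ^ k)) ∧
      0 ≤ 2 * c * ((α + β + 2 * c) ^ k - (α + β - 2 * c) ^ k) ∧
      2 * α ^ k ≤ (α + β + 2 * c) ^ k + (α + β - 2 * c) ^ k from (H k).1
  clear k
  intro k
  induction k with
  | zero => exact ⟨by norm_num; linarith, by norm_num, by norm_num, by norm_num⟩
  | succ k ih =>
    obtain ⟨i1, i2, i3, i4⟩ := ih
    set h := s ^ 2 with hh
    set S := (α + β * h + 2 * s * c) ^ k + (α + β * h - 2 * s * c) ^ k with hS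
    set D := 2 * s * c * ((α + β * h + 2 * s * c) ^ k - (α + β * h - 2 * s * c) ^ k) with hD
    set S1 := (α + β + 2 * c) ^ k + (α + β - 2 * c) ^ k with hS1
    set D1 := 2 * c * ((α + β + 2 * c) ^ k - (α + β - 2 * c) ^ k) with hD1
    have eS : (α + β * h + 2 * s * c) ^ (k + 1) + (α + β * h - 2 * s * c) ^ (k + 1) =
        (α + β * h) * S + D := by rw [hS, hD]; ring
    have eD : 2 * s * c * ((α + β * h + 2 * s * c) ^ (k + 1) -
        (α + β * h - 2 * s * c) ^ (k + 1)) = (α + β * h) * D + 4 * h * c ^ 2 * S := by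
      rw [hS, hD, hh]; ring
    have eS1 : (α + β + 2 * c) ^ (k + 1) + (α + β - 2 * c) ^ (k + 1) =
        (α + β) * S1 + D1 := by rw [hS1, hD1]; ring
    have eD1 : 2 * c * ((α + β + 2 * c) ^ (k + 1) - (α + β - 2 * c) ^ (k + 1)) =
        (α + β) * D1 + 4 * c ^ 2 * S1 := by rw [hS1, hD1]; ring
    rw [eS, eD, eS1, eD1]
    have hαk : 0 ≤ α ^ k := pow_nonneg hα k
    rw [pow_succ α k]
    clear_value S D S1 D1 h
    clear eS eD eS1 eD1
    generalize α ^ k = a at *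
    have hS1' : 0 ≤ S1 := by linarith
    have hSle : S ≤ S1 := by nlinarith
    have hc2 : 0 ≤ c ^ 2 * S1 := mul_nonneg (sq_nonneg c) hS1'
    have hD1' : 0 ≤ (α + β) * D1 := mul_nonneg (by linarith) i3
    refine ⟨?_, ?_, by linarith, ?_⟩
    · have e1 : (α + β * h) * S ≤ (α + β * h) * ((1 - h) * (2 * a) + h * S1) := by gcongr
      have e2 : 0 ≤ h * (1 - h) * β * (S1 - 2 * a) :=
        mul_nonneg (mul_nonneg (mul_nonneg hh0 (by linarith)) hβ) (by linarith)
      linarith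
    · have e1 : (α + β * h) * D ≤ (α + β * h) * (h * D1) := by gcongr
      have e2 : (α + β * h) * (h * D1) ≤ (α + β) * (h * D1) := by
        gcongr
        nlinarith
      have e3 : 4 * h * c ^ 2 * S ≤ 4 * h * c ^ 2 * S1 := by gcongr
      linarith
    · have e1 : α * (2 * a) ≤ (α + β) * S1 := by gcongr; linarith
      linarith

/-- A symmetric perturbation of size `s` changes the mean of an even power of the norm only by
`O(s²)`. -/
theorem norm_symm_pow_le {V : Type*} [NormedAddCommGroup V] [InnerProductSpace ℝ V] (a v : V)
    (k : ℕ) {s : ℝ} (hs0 : 0 ≤ s) (hs1 : s ≤ 1) :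
    (‖a + s • v‖ ^ (2 * k) + ‖a - s • v‖ ^ (2 * k)) / 2 ≤
      ‖a‖ ^ (2 * k) + s ^ 2 * (2 ^ (2 * k) * (‖a‖ ^ (2 * k) + ‖v‖ ^ (2 * k))) := by
  have key := even_part_pow_le (α := ‖a‖ ^ 2) (β := ‖v‖ ^ 2) (c := inner ℝ a v) (by positivity)
    (by positivity) hs0 hs1 k
  have e1 : ∀ r : ℝ, ‖a + r • v‖ ^ 2 = ‖a‖ ^ 2 + ‖v‖ ^ 2 * r ^ 2 + 2 * r * inner ℝ a v := by
    intro r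
    rw [norm_add_sq_real, norm_smul, inner_smul_right, mul_pow, Real.norm_eq_abs, sq_abs]; ring
  have e2 : ∀ r : ℝ, ‖a - r • v‖ ^ 2 = ‖a‖ ^ 2 + ‖v‖ ^ 2 * r ^ 2 - 2 * r * inner ℝ a v := by
    intro r
    rw [norm_sub_sq_real, norm_smul, inner_smul_right, mul_pow, Real.norm_eq_abs, sq_abs]; ring
  have e3 := e1 1
  have e4 := e2 1
  simp only [one_smul, one_pow, mul_one] at e3 e4
  rw [← e1, ← e2, ← e3, ← e4, ← pow_mul, ← pow_mul, ← pow_mul, ← pow_mul, ← pow_mul] at key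
  have h1 := norm_add_pow_le a v (2 * k)
  have h2 := norm_add_pow_le a (-v) (2 * k)
  rw [norm_neg, ← sub_eq_add_neg] at h2
  have h3 : 0 ≤ ‖a‖ ^ (2 * k) := by positivity
  have h4 : 0 ≤ s ^ 2 := sq_nonneg s
  nlinarith [mul_nonneg h4 h3, mul_le_mul_of_nonneg_left (add_le_add h1 h2) h4]

/-! ### Resampling sequences of independent uniform variables -/

/-- The sample space `[0, 1]^ℕ` of a sequence of independent uniform variables. -/
abbrev UnifSeq : Type := ℕ → unitInterval

/-- The law of a sequence of independent uniform variables. -/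
abbrev unifSeq : Measure UnifSeq := Measure.infinitePi fun _ : ℕ => (volume : Measure unitInterval)

/-- Resampling of the `j`-th coordinate. -/
def resample (j : ℕ) (z : UnifSeq × unitInterval) : UnifSeq := Function.update z.1 j z.2

theorem measurable_resample (j : ℕ) : Measurable (resample j) := by
  refine measurable_pi_iff.2 fun i => ?_
  by_cases h : i = j
  · subst h; simpa [resample] using measurable_snd
  · simpa [resample, Function.update_of_ne h] using
      show Measurable fun z : UnifSeq × unitInterval => z.1 i from
        (measurable_pi_apply i).comp measurable_fst

theorem measurePreserving_resample (j : ℕ) :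
    MeasurePreserving (resample j) (unifSeq.prod (volume : Measure unitInterval)) unifSeq := by
  classical
  refine ⟨measurable_resample j, Measure.eq_infinitePi _ fun s t ht => ?_⟩
  rw [Measure.map_apply (measurable_resample j)
    (MeasurableSet.pi s.countable_toSet fun i _ => ht i)]
  by_cases hj : j ∈ s
  · have : resample j ⁻¹' (Set.pi s t) = (Set.pi (s.erase j) t) ×ˢ t j := by
      ext z
      simp only [resample, mem_preimage, Set.mem_pi, mem_prod, Finset.mem_coe, Finset.mem_erase]
      constructor
      · refine fun h => ⟨fun i hi => ?_, ?_⟩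
        · simpa [Function.update_of_ne hi.1] using h i hi.2
        · simpa using h j hj
      · rintro ⟨h1, h2⟩ i hi
        by_cases h : i = j
        · subst h; simpa using h2
        · simpa [Function.update_of_ne h] using h1 i ⟨h, hi⟩
    rw [this, Measure.prod_prod, Measure.infinitePi_pi _ fun i _ => ht i,
      Finset.prod_erase_mul _ _ hj]
  · have : resample j ⁻¹' (Set.pi s t) = (Set.pi s t) ×ˢ univ := by
      ext z
      simp only [resample, mem_preimage, Set.mem_pi, mem_prod, Finset.mem_coe, mem_univ, and_true]
      refine forall₂_congr fun i hi => ?_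
      rw [Function.update_of_ne (fun h : i = j => hj (h ▸ hi))]
    rw [this, Measure.prod_prod, Measure.infinitePi_pi _ fun i _ => ht i, measure_univ, mul_one]

theorem tendsto_resample (z : UnifSeq × unitInterval) :
    Tendsto (fun j => resample j z) atTop (𝓝 z.1) := by
  refine tendsto_pi_nhds.2 fun i => tendsto_const_nhds.congr' ?_
  filter_upwards [eventually_gt_atTop i] with j hj
  simp [resample, Function.update_of_ne hj.ne]

/-- Resampling a far away coordinate has a negligible effect on a given random variable. -/
theorem tendsto_eLpNorm_resample {F : Type*} [NormedAddCommGroup F] [NormedSpace ℝ F] {p : ℝ≥0∞}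
    (hp1 : 1 ≤ p) (hp : p ≠ ∞) {X : UnifSeq → F} (hX : MemLp X p unifSeq) :
    Tendsto (fun j => eLpNorm (X ∘ resample j - X ∘ Prod.fst) p
      (unifSeq.prod (volume : Measure unitInterval))) atTop (𝓝 0) := by
  refine ENNReal.tendsto_nhds_zero.2 fun η hη => ?_
  have hη3 : η / 3 ≠ 0 := by simpa using hη.ne'
  obtain ⟨g, hg, hgm⟩ := hX.exists_boundedContinuous_eLpNorm_sub_le hp hη3
  have hfst : MeasurePreserving (Prod.fst : UnifSeq × unitInterval → UnifSeq)
    (unifSeq.prod (volume : Measure unitInterval)) unifSeq := measurePreserving_fst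
  have hgj : ∀ j, MemLp (g ∘ resample j) p (unifSeq.prod (volume : Measure unitInterval)) :=
    fun j => hgm.comp_measurePreserving (measurePreserving_resample j)
  have hgf := hgm.comp_measurePreserving hfst
  have hlim : Tendsto (fun j => eLpNorm (g ∘ resample j - g ∘ Prod.fst) p
      (unifSeq.prod (volume : Measure unitInterval))) atTop (𝓝 0) := by
    refine tendsto_Lp_finite_of_tendsto_ae hp1 hp (fun j => (hgj j).1) hgf ?_ ?_
    · refine unifIntegrable_of hp1 hp (fun j => (hgj j).1) fun ε hε => ⟨‖g‖₊ + 1, fun j => ?_⟩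
      have : {x | ‖g‖₊ + 1 ≤ ‖(g ∘ resample j) x‖₊} = ∅ := by
        refine eq_empty_of_forall_notMem fun x hx => ?_
        have h1 : ‖g‖₊ + 1 ≤ ‖g (resample j x)‖₊ := hx
        have h2 : ‖g (resample j x)‖₊ ≤ ‖g‖₊ := g.nnnorm_coe_le_nnnorm _
        exact absurd (h1.trans h2) (by simp)
      rw [this]; simp
    · exact Eventually.of_forall fun z => (g.continuous.tendsto _).comp (tendsto_resample z)
  filter_upwards [ENNReal.tendsto_nhds_zero.1 hlim (η / 3) (pos_iff_ne_zero.2 hη3)] with j hj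
  have hd : MemLp (X - ⇑g) p unifSeq := hX.sub hgm
  have e : X ∘ resample j - X ∘ Prod.fst = (X - ⇑g) ∘ resample j +
      ((g ∘ resample j - g ∘ Prod.fst) - (X - ⇑g) ∘ Prod.fst) := by
    ext z; simp
  have h1 := hd.comp_measurePreserving (measurePreserving_resample j)
  have h2 := hd.comp_measurePreserving hfst
  rw [e]
  calc _ ≤ _ := (eLpNorm_add_le h1.1 (((hgj j).sub hgf).sub h2).1 hp1).trans
        (add_le_add_right (eLpNorm_sub_le ((hgj j).sub hgf).1 h2.1 hp1) _)
    _ ≤ η / 3 + (η / 3 + η / 3) := by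
      rw [eLpNorm_comp_measurePreserving hd.1 (measurePreserving_resample j),
        eLpNorm_comp_measurePreserving hd.1 hfst]
      gcongr
    _ = η := by rw [← add_assoc, ENNReal.add_thirds]

/-- A fair random sign on `[0, 1]`. -/
def fairSign (s : unitInterval) : ℝ := if (s : ℝ) < 1 / 2 then 1 else -1

theorem measurable_fairSign : Measurable fairSign :=
  Measurable.ite (measurableSet_lt measurable_subtype_coe measurable_const) measurable_const
    measurable_const

theorem abs_fairSign (s : unitInterval) : |fairSign s| = 1 := by
  unfold fairSign; split_ifs <;> simp

theorem fairSign_eq (s : unitInterval) : fairSign s = 1 ∨ fairSign s = -1 := by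
  unfold fairSign; split_ifs <;> simp

theorem volume_fairSign : volume {s | fairSign s = 1} = ENNReal.ofReal (1 / 2) ∧
    volume {s | fairSign s = 1}ᶜ = ENNReal.ofReal (1 / 2) := by
  have e : {s | fairSign s = 1} = Iio (⟨1 / 2, by norm_num, by norm_num⟩ : unitInterval) := by
    ext s
    simp only [mem_ofPred_eq, fairSign, mem_Iio, ← Subtype.coe_lt_coe]
    split_ifs with h
    · simp only [true_iff]; exact h
    · simp only [h, iff_false]; norm_num
  have h1 : volume {s | fairSign s = 1} = ENNReal.ofReal (1 / 2) := by
    rw [e, unitInterval.volume_Iio]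
  refine ⟨h1, ?_⟩
  have hm : MeasurableSet {s | fairSign s = 1} := measurable_fairSign (measurableSet_singleton 1)
  rw [measure_compl hm (measure_ne_top _ _), h1,
    measure_univ, ← ENNReal.ofReal_one, ← ENNReal.ofReal_sub _ (by norm_num)]
  norm_num

theorem integral_fairSign {F : Type*} [NormedAddCommGroup F] [NormedSpace ℝ F] [CompleteSpace F]
    (g : ℝ → F) :
    ∫ s, g (fairSign s) = (1 / 2 : ℝ) • (g 1 + g (-1)) := by
  set A : Set unitInterval := {s | fairSign s = 1} with hA
  have hAm : MeasurableSet A := measurable_fairSign (measurableSet_singleton 1)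
  have e : (fun s => g (fairSign s)) =
      fun s => A.indicator (fun _ => g 1) s + Aᶜ.indicator (fun _ => g (-1)) s := by
    ext s
    by_cases h : fairSign s = 1
    · have h1 : s ∈ A := h
      simp [h1, h]
    · have h1 : s ∉ A := h
      simp [h1, (fairSign_eq s).resolve_left h]
  rw [e, integral_add ((integrable_const _).indicator hAm)
    ((integrable_const _).indicator hAm.compl),
    integral_indicator_const _ hAm, integral_indicator_const _ hAm.compl, measureReal_def,
    measureReal_def, volume_fairSign.1, volume_fairSign.2, ENNReal.toReal_ofReal (by norm_num),
    smul_add]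

/-! ### Mean value inequalities -/

section meanValue

variable {F H : Type*} [NormedAddCommGroup F] [NormedSpace ℝ F] [NormedAddCommGroup H]
  [InnerProductSpace ℝ H]

theorem hasDerivAt_inner_line {U : F → H} {U' : F → F →L[ℝ] H}
    (hU : ∀ y, HasFDerivAt U (U' y) y) (r : H) (x v : F) (τ : ℝ) :
    HasDerivAt (fun τ : ℝ => inner ℝ r (U (x + τ • v))) (inner ℝ r (U' (x + τ • v) v)) τ := by
  have h1 : HasDerivAt (fun τ : ℝ => x + τ • v) v τ := by
    simpa using ((hasDerivAt_id τ).smul_const v).const_add x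
  exact ((innerSL ℝ r).hasFDerivAt.comp_hasDerivAt τ ((hU _).comp_hasDerivAt τ h1))

theorem exists_inner_sub_eq {U : F → H} {U' : F → F →L[ℝ] H} (hU : ∀ y, HasFDerivAt U (U' y) y)
    (r : H) (x v : F) {h : ℝ} (hh : 0 < h) :
    ∃ ζ : F, ‖ζ‖ ≤ h * ‖v‖ ∧ inner ℝ r (U (x + h • v) - U x) = h * inner ℝ r (U' (x + ζ) v) := by
  obtain ⟨c, hc, e⟩ := exists_hasDerivAt_eq_slope (fun τ : ℝ => inner ℝ r (U (x + τ • v)))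
    (fun τ => inner ℝ r (U' (x + τ • v) v)) hh
    (fun τ _ => (hasDerivAt_inner_line hU r x v τ).continuousAt.continuousWithinAt)
    (fun τ _ => hasDerivAt_inner_line hU r x v τ)
  refine ⟨c • v, ?_, ?_⟩
  · rw [norm_smul, Real.norm_of_nonneg hc.1.le]
    gcongr
    exact hc.2.le
  · rw [e, inner_sub_right]
    simp only [zero_smul, add_zero, sub_zero]
    field_simp

/-- Second order mean value theorem for symmetric differences. -/
theorem exists_inner_symm_eq {U : F → H} {U' : F → F →L[ℝ] H} {e : F} {U2 : F → F →L[ℝ] H}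
    (hU : ∀ y, HasFDerivAt U (U' y) y) (hU2 : ∀ y, HasFDerivAt (fun y => U' y e) (U2 y) y)
    (r : H) (x : F) {s : ℝ} (hs : 0 < s) :
    ∃ ζ : F, ‖ζ‖ ≤ s * ‖e‖ ∧ inner ℝ r ((1 / 2 : ℝ) • (U (x + s • e) + U (x + (-s) • e)) - U x) =
      s ^ 2 * inner ℝ r ((1 / 2 : ℝ) • U2 (x + ζ) e) := by
  have hw := hasDerivAt_inner_line hU r x e
  have hw2 := hasDerivAt_inner_line hU2 r x e
  have hφ : ∀ τ : ℝ, HasDerivAt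
      (fun τ : ℝ => inner ℝ r (U (x + τ • e)) + inner ℝ r (U (x + (-τ) • e)))
      (inner ℝ r (U' (x + τ • e) e) - inner ℝ r (U' (x + (-τ) • e) e)) τ := by
    intro τ
    have h1 := (hw (-τ)).scomp τ (hasDerivAt_neg τ)
    refine ((hw τ).add h1).congr_deriv ?_
    rw [neg_one_smul, sub_eq_add_neg]
  have hsq : ∀ τ : ℝ, HasDerivAt (fun τ : ℝ => τ ^ 2) (2 * τ) τ := fun τ => by
    simpa using hasDerivAt_pow 2 τ
  -- Cauchy's mean value theorem against `τ²`, then Lagrange's on `[-c, c]`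
  obtain ⟨c, hc, e1⟩ := exists_ratio_hasDerivAt_eq_ratio_slope _ _ hs
    (fun τ _ => (hφ τ).continuousAt.continuousWithinAt) (fun τ _ => hφ τ) _ _
    (fun τ _ => (hsq τ).continuousAt.continuousWithinAt) (fun τ _ => hsq τ)
  obtain ⟨c', hc', e2⟩ := exists_hasDerivAt_eq_slope _ _ (by linarith [hc.1] : -c < c)
    (fun τ _ => (hw2 τ).continuousAt.continuousWithinAt) (fun τ _ => hw2 τ)
  refine ⟨c' • e, ?_, ?_⟩
  · rw [norm_smul]
    gcongr
    exact abs_le.2 ⟨by linarith [hc'.1, hc.2], by linarith [hc'.2, hc.2]⟩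
  · have hc0 : c ≠ 0 := hc.1.ne'
    rw [eq_div_iff (by linarith [hc.1])] at e2
    rw [← e2] at e1
    simp only [neg_zero, zero_smul, add_zero] at e1
    rw [inner_smul_right, inner_sub_right, inner_smul_right, inner_add_right]
    have e3 : (2 * c) * (s ^ 2 * inner ℝ r (U2 (x + c' • e) e)) =
      (2 * c) * (inner ℝ r (U (x + s • e)) + inner ℝ r (U (x + -s • e)) -
        2 * inner ℝ r (U x)) := by
      linear_combination e1
    have e4 := mul_left_cancel₀ (mul_ne_zero two_ne_zero hc0) e3
    linear_combination -(1 / 2) * e4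

end meanValue

section flat

variable {d : ℕ}

/-- The derivative of `U` along the segment from `μ` to `ν`, at an arbitrary point of it. -/
theorem hasDerivWithinAt_mix {U : P2 d → E d} {flat : P2 d → E d → E d}
    (hU : ∀ m, HasFlatDeriv U m (flat m)) (μ ν : P2 d) {l : ℝ} (hl : l ∈ Icc (0 : ℝ) 1) :
    HasDerivWithinAt (fun l : ℝ => U (P2.mix μ ν (projIcc 0 1 zero_le_one l)))
      ((∫ y, flat (P2.mix μ ν ⟨l, hl⟩) y ∂ν.toMeasure) -
        ∫ y, flat (P2.mix μ ν ⟨l, hl⟩) y ∂μ.toMeasure) (Icc 0 1) l := by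
  set M := P2.mix μ ν ⟨l, hl⟩ with hM
  have hint := P2.integral_mix ((hU M).integrable μ) ((hU M).integrable ν) ⟨l, hl⟩
  rw [← hM] at hint
  simp only at hint
  have hmem : ∀ {t : ℝ}, t ∈ Icc (0 : ℝ) 1 → projIcc 0 1 zero_le_one t = t := fun ht => by
    rw [projIcc_of_mem _ ht]
  have hright : l < 1 → HasDerivWithinAt (fun l : ℝ => U (P2.mix μ ν (projIcc 0 1 zero_le_one l)))
      ((∫ y, flat M y ∂ν.toMeasure) - ∫ y, flat M y ∂μ.toMeasure) (Icc l 1) l := by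
    intro hl1
    have h1 : 0 < 1 - l := by linarith
    have hin : HasDerivWithinAt (fun t : ℝ => (t - l) / (1 - l)) (1 / (1 - l)) (Icc l 1) l :=
      (((hasDerivAt_id l).sub_const l).div_const _).hasDerivWithinAt
    have hmaps : MapsTo (fun t : ℝ => (t - l) / (1 - l)) (Icc l 1) (Icc 0 1) := fun t ht =>
      ⟨div_nonneg (by linarith [ht.1]) h1.le, (div_le_one h1).2 (by linarith [ht.2])⟩
    have key := ((hU M).deriv ν).scomp_of_eq l hin hmaps (by simp)
    have hval : (1 / (1 - l)) • ((∫ y, flat M y ∂ν.toMeasure) - ∫ y, flat M y ∂M.toMeasure) =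
        (∫ y, flat M y ∂ν.toMeasure) - ∫ y, flat M y ∂μ.toMeasure := by
      rw [hint, ← smul_right_injective (E d) h1.ne' |>.eq_iff]
      simp only [smul_smul, mul_one_div_cancel h1.ne', one_smul]
      module
    rw [hval] at key
    refine key.congr_of_mem (fun t ht => ?_) ⟨le_rfl, hl.2⟩
    have ht0 : t ∈ Icc (0 : ℝ) 1 := ⟨hl.1.trans ht.1, ht.2⟩
    simp only [Function.comp_apply, hM]
    rw [P2.mix_mix_right μ ν _ _ (projIcc 0 1 zero_le_one t)]
    rw [hmem ht0, hmem (hmaps ht), div_mul_cancel₀ _ h1.ne']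
    ring
  have hleft : 0 < l → HasDerivWithinAt (fun l : ℝ => U (P2.mix μ ν (projIcc 0 1 zero_le_one l)))
      ((∫ y, flat M y ∂ν.toMeasure) - ∫ y, flat M y ∂μ.toMeasure) (Icc 0 l) l := by
    intro hl0
    have hin : HasDerivWithinAt (fun t : ℝ => (l - t) / l) (-1 / l) (Icc 0 l) l :=
      (((hasDerivAt_id l).const_sub l).div_const _).hasDerivWithinAt
    have hmaps : MapsTo (fun t : ℝ => (l - t) / l) (Icc 0 l) (Icc 0 1) := fun t ht =>
      ⟨div_nonneg (by linarith [ht.2]) hl0.le, (div_le_one hl0).2 (by linarith [ht.1])⟩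
    have key := ((hU M).deriv μ).scomp_of_eq l hin hmaps (by simp)
    have hval : (-1 / l) • ((∫ y, flat M y ∂μ.toMeasure) - ∫ y, flat M y ∂M.toMeasure) =
        (∫ y, flat M y ∂ν.toMeasure) - ∫ y, flat M y ∂μ.toMeasure := by
      rw [hint, ← smul_right_injective (E d) hl0.ne' |>.eq_iff]
      simp only [smul_smul, mul_div_cancel₀ _ hl0.ne']
      module
    rw [hval] at key
    refine key.congr_of_mem (fun t ht => ?_) ⟨hl.1, le_rfl⟩
    have ht0 : t ∈ Icc (0 : ℝ) 1 := ⟨ht.1, ht.2.trans hl.2⟩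
    simp only [Function.comp_apply, hM]
    rw [P2.mix_mix_left μ ν _ _ (projIcc 0 1 zero_le_one t)]
    rw [hmem ht0, hmem (hmaps ht), div_mul_cancel₀ _ hl0.ne']
    ring
  rcases hl.1.eq_or_lt with h0 | h0
  · have := hright (by linarith)
    rwa [← h0] at this ⊢
  · rcases hl.2.eq_or_lt with h1 | h1
    · have := hleft h0
      rwa [h1] at this ⊢
    · have := (hleft h0).union (hright h1)
      rwa [Icc_union_Icc_eq_Icc hl.1 hl.2] at this

/-- Mean value theorem along the segment from `μ` to `ν`. -/
theorem exists_inner_sub_eq_flat {U : P2 d → E d} {flat : P2 d → E d → E d}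
    (hU : ∀ m, HasFlatDeriv U m (flat m)) (r : E d) (μ ν : P2 d) :
    ∃ l : Icc (0 : ℝ) 1, inner ℝ r (U ν - U μ) =
      inner ℝ r ((∫ y, flat (P2.mix μ ν l) y ∂ν.toMeasure) -
        ∫ y, flat (P2.mix μ ν l) y ∂μ.toMeasure) := by
  have hmem : ∀ {t : ℝ}, t ∈ Icc (0 : ℝ) 1 → (projIcc 0 1 zero_le_one t : ℝ) = t := fun ht => by
    rw [projIcc_of_mem _ ht]
  have hd : ∀ l ∈ Icc (0 : ℝ) 1, HasDerivWithinAt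
      (fun l : ℝ => inner ℝ r (U (P2.mix μ ν (projIcc 0 1 zero_le_one l))))
      (inner ℝ r ((∫ y, flat (P2.mix μ ν (projIcc 0 1 zero_le_one l)) y ∂ν.toMeasure) -
        ∫ y, flat (P2.mix μ ν (projIcc 0 1 zero_le_one l)) y ∂μ.toMeasure)) (Icc 0 1) l := by
    intro l hl
    have := hasDerivWithinAt_mix hU μ ν hl
    rw [← projIcc_of_mem zero_le_one hl] at this
    exact (innerSL ℝ r).hasFDerivAt.comp_hasDerivWithinAt l this
  obtain ⟨c, hc, e⟩ := exists_hasDerivAt_eq_slope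
    (fun l : ℝ => inner ℝ r (U (P2.mix μ ν (projIcc 0 1 zero_le_one l)))) _
    (zero_lt_one (α := ℝ)) (fun l hl => (hd l hl).continuousWithinAt)
    (fun l hl => (hd l (Ioo_subset_Icc_self hl)).hasDerivAt (Icc_mem_nhds hl.1 hl.2))
  refine ⟨projIcc 0 1 zero_le_one c, ?_⟩
  rw [e, P2.mix_zero μ ν _ (hmem ⟨le_rfl, zero_le_one⟩),
    P2.mix_one μ ν _ (hmem ⟨zero_le_one, le_rfl⟩), inner_sub_right]
  simp

end flat

/-! ### Generators of infinitesimal displacements -/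

/-- The data of an infinitesimal displacement on the sample space: during a time `h` a point `x`
moves to `x + a h ω` or `x + b h ω`, with probability `1/2` each. The vectors `Lw`, `Lm` are the
generators of this motion, in the space variable of `w` and in the variable `y` of the flat
derivative of `w` respectively, and `V` controls the size of the displacement. -/
structure IsGenerator {Ω : Type*} {d : ℕ} (w : E d → P2 d → E d)
    (flat : E d → P2 d → E d → E d) (V : Ω → E d) (a b : ℝ → Ω → E d)
    (Lw : Ω → E d → P2 d → E d) (Lm : Ω → E d → P2 d → E d → E d) (C : ℝ) (q : ℕ) : Prop where
  hasFlatDeriv : ∀ x m, HasFlatDeriv (w x) m (flat x m)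
  continuous_w : Continuous fun z : E d × P2 d => w z.1 z.2
  norm_a : ∀ h ∈ Ioc (0 : ℝ) 1, ∀ ω, ‖a h ω‖ ≤ Real.sqrt h * ‖V ω‖
  norm_b : ∀ h ∈ Ioc (0 : ℝ) 1, ∀ ω, ‖b h ω‖ ≤ Real.sqrt h * ‖V ω‖
  mean_w : ∀ h ∈ Ioc (0 : ℝ) 1, ∀ ω r m x, ∃ ζ : E d, ‖ζ‖ ≤ Real.sqrt h * ‖V ω‖ ∧
    inner ℝ r ((1 / 2 : ℝ) • (w (x + a h ω) m + w (x + b h ω) m) - w x m) =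
      h * inner ℝ r (Lw ω (x + ζ) m)
  mean_flat : ∀ h ∈ Ioc (0 : ℝ) 1, ∀ ω r x m y, ∃ ζ : E d, ‖ζ‖ ≤ Real.sqrt h * ‖V ω‖ ∧
    inner ℝ r ((1 / 2 : ℝ) • (flat x m (y + a h ω) + flat x m (y + b h ω)) - flat x m y) =
      h * inner ℝ r (Lm ω x m (y + ζ))
  continuous_Lw : ∀ ω, Continuous fun z : E d × P2 d => Lw ω z.1 z.2
  continuous_Lm : ∀ ω x, Continuous fun z : P2 d × E d => Lm ω x z.1 z.2
  C_nonneg : 0 ≤ C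
  norm_Lw : ∀ ω x m, ‖Lw ω x m‖ ≤ C * (1 + ‖V ω‖) * (1 + ‖x‖ + m.moment) ^ q
  norm_Lm : ∀ ω x m y, ‖Lm ω x m y‖ ≤ C * (1 + ‖V ω‖) * (1 + ‖x‖ + m.moment + ‖y‖) ^ q

/-- Displacements have size at most `√h`; this makes them infinitesimal. -/
theorem tendsto_of_norm_le_sqrt {F : Type*} [NormedAddCommGroup F] {ζ : ℝ → F} {c : ℝ}
    (h : ∀ h ∈ Ioc (0 : ℝ) 1, ‖ζ h‖ ≤ Real.sqrt h * c) : Tendsto ζ (𝓝[>] 0) (𝓝 0) := by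
  refine squeeze_zero_norm' (a := fun h => Real.sqrt h * c) ?_ ?_
  · filter_upwards [Ioc_mem_nhdsGT zero_lt_one] with s hs using h s hs
  · have : Tendsto (fun h : ℝ => Real.sqrt h * c) (𝓝 0) (𝓝 (Real.sqrt 0 * c)) :=
      (Real.continuous_sqrt.mul continuous_const).tendsto 0
    rw [Real.sqrt_zero, zero_mul] at this
    exact this.mono_left nhdsWithin_le_nhds

theorem sqrt_mul_le_of_mem_Ioc {h c : ℝ} (hh : h ∈ Ioc (0 : ℝ) 1) (hc : 0 ≤ c) :
    Real.sqrt h * c ≤ c :=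
  mul_le_of_le_one_left hc (Real.sqrt_le_one.2 hh.2)

section

variable {Ω : Type*} [MeasurableSpace Ω] {P : Measure Ω} [IsProbabilityMeasure P] {d : ℕ}
  {w : E d → P2 d → E d} {flat : E d → P2 d → E d → E d} {X V R : Ω → E d}
  {a b : ℝ → Ω → E d} {Lw : Ω → E d → P2 d → E d} {Lm : Ω → E d → P2 d → E d → E d}
  {C : ℝ} {q : ℕ}

/-- The weight `1/2` of an even mixture. -/
abbrev halfI : Icc (0 : ℝ) 1 := ⟨1 / 2, by norm_num, by norm_num⟩

/-- The law of the position after a step: the balanced mixture of both displaced laws. -/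
abbrev stepLaw {a b : ℝ → Ω → E d} (hXa : ∀ h, MemLp (fun ω => X ω + a h ω) 2 P)
    (hXb : ∀ h, MemLp (fun ω => X ω + b h ω) 2 P) (h : ℝ) : P2 d :=
  P2.mix (law (hXa h)) (law (hXb h)) halfI

theorem integrable_weight_pow {p : ℕ} (hp : p ≠ 0) (hX : MemLp X p P) (hV : MemLp V p P)
    (hR : MemLp R p P) (c : ℝ) :
    Integrable (fun ω => (1 + ‖X ω‖ + ‖V ω‖ + ‖R ω‖ + ‖c‖) ^ p) P := by
  have h1 : MemLp (fun ω => 1 + ‖X ω‖ + ‖V ω‖ + ‖R ω‖ + ‖c‖) p P :=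
    ((((memLp_const (1 : ℝ)).add hX.norm).add hV.norm).add hR.norm).add (memLp_const ‖c‖)
  refine (h1.integrable_norm_pow hp).congr (Eventually.of_forall fun ω => ?_)
  simp only
  rw [Real.norm_of_nonneg (by positivity)]

theorem costLE_stepLaw (hG : IsGenerator w flat V a b Lw Lm C q) (hX : MemLp X 2 P)
    (hV : MemLp V 2 P) (hXa : ∀ h, MemLp (fun ω => X ω + a h ω) 2 P)
    (hXb : ∀ h, MemLp (fun ω => X ω + b h ω) 2 P) {h : ℝ} (hh : h ∈ Ioc (0 : ℝ) 1) :
    P2.CostLE (law hX) (stepLaw hXa hXb h) (ENNReal.ofReal (h * ∫ ω, ‖V ω‖ ^ 2 ∂P)) := by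
  have hV2 := (memLp_two_iff_integrable_sq_norm hV.1).1 hV
  have main : ∀ a : Ω → E d, (hXa : MemLp (fun ω => X ω + a ω) 2 P) →
      (∀ ω, ‖a ω‖ ≤ Real.sqrt h * ‖V ω‖) →
      P2.CostLE (law hX) (law hXa) (ENNReal.ofReal (h * ∫ ω, ‖V ω‖ ^ 2 ∂P)) := by
    intro a hXa ha
    obtain ⟨γ, hγ, hle⟩ := costLE_law' hX hXa
    refine ⟨γ, hγ, hle.trans (ENNReal.ofReal_le_ofReal ?_)⟩
    rw [← integral_const_mul]
    refine integral_mono_of_nonneg (Eventually.of_forall fun _ => by positivity)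
      (hV2.const_mul _) (Eventually.of_forall fun ω => ?_)
    simp only [sub_add_cancel_left, norm_neg]
    calc ‖a ω‖ ^ 2 ≤ (Real.sqrt h * ‖V ω‖) ^ 2 := by gcongr; exact ha ω
      _ = h * ‖V ω‖ ^ 2 := by rw [mul_pow, Real.sq_sqrt hh.1.le]
  exact (main _ (hXa h) (hG.norm_a h hh)).mix (main _ (hXb h) (hG.norm_b h hh)) _

/-- The square root of the second moment of `‖X‖ + ‖V‖`. -/
def momentBound (P : Measure Ω) (X V : Ω → E d) : ℝ :=
  Real.sqrt (∫ ω, (‖X ω‖ + ‖V ω‖) ^ 2 ∂P)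

theorem moment_law_le_momentBound (hX : MemLp X 2 P) (hV : MemLp V 2 P) {Y : Ω → E d}
    (hY : MemLp Y 2 P) (h : ∀ ω, ‖Y ω‖ ≤ ‖X ω‖ + ‖V ω‖) : (law hY).moment ≤ momentBound P X V := by
  refine Real.le_sqrt_of_sq_le ?_
  rw [moment_law_sq]
  refine integral_mono_of_nonneg (Eventually.of_forall fun _ => by positivity) ?_
    (Eventually.of_forall fun ω => ?_)
  · have : MemLp (fun ω => ‖X ω‖ + ‖V ω‖) 2 P := hX.norm.add hV.norm
    exact (memLp_two_iff_integrable_sq this.1).1 this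
  · have := h ω
    simp only
    gcongr

theorem moment_mix_stepLaw_le (hG : IsGenerator w flat V a b Lw Lm C q) (hX : MemLp X 2 P)
    (hV : MemLp V 2 P) (hXa : ∀ h, MemLp (fun ω => X ω + a h ω) 2 P)
    (hXb : ∀ h, MemLp (fun ω => X ω + b h ω) 2 P) {h : ℝ} (hh : h ∈ Ioc (0 : ℝ) 1)
    (l : Icc (0 : ℝ) 1) :
    (P2.mix (law hX) (stepLaw hXa hXb h) l).moment ≤ momentBound P X V := by
  have h1 := moment_law_le_momentBound hX hV hX fun ω => le_add_of_nonneg_right (norm_nonneg _)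
  have h2 := moment_law_le_momentBound hX hV (hXa h) fun ω => (norm_add_le _ _).trans
    (add_le_add_right ((hG.norm_a h hh ω).trans (sqrt_mul_le_of_mem_Ioc hh (norm_nonneg _))) _)
  have h3 := moment_law_le_momentBound hX hV (hXb h) fun ω => (norm_add_le _ _).trans
    (add_le_add_right ((hG.norm_b h hh ω).trans (sqrt_mul_le_of_mem_Ioc hh (norm_nonneg _))) _)
  exact P2.moment_mix_le h1 (P2.moment_mix_le h2 h3 _) _

theorem one_add_add_pow_le {x c : ℝ} (hx : 0 ≤ x) (hc : 0 ≤ c) (q : ℕ) :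
    (1 + x + c) ^ q ≤ (1 + x) ^ q * (1 + c) ^ q := by
  rw [← mul_pow]
  gcongr
  nlinarith

/-- The constant in the growth bound of the measure part of the generator. -/
def growthConst (P : Measure Ω) (X V : Ω → E d) (q : ℕ) : ℝ :=
  ∫ ω, (1 + ‖V ω‖) * (1 + (momentBound P X V + ‖X ω‖ + ‖V ω‖)) ^ q ∂P

theorem momentBound_nonneg {P : Measure Ω} : 0 ≤ momentBound P X V := Real.sqrt_nonneg _

theorem growthConst_nonneg {P : Measure Ω} : 0 ≤ growthConst P X V q :=
  integral_nonneg fun ω => by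
    have := momentBound_nonneg (P := P) (X := X) (V := V)
    simp only [Pi.zero_apply]
    positivity

theorem integrable_growth (hX : MemLp X (q + 2 : ℕ) P) (hV : MemLp V (q + 2 : ℕ) P) :
    Integrable (fun ω => (1 + ‖V ω‖) * (1 + (momentBound P X V + ‖X ω‖ + ‖V ω‖)) ^ q) P := by
  have hB := momentBound_nonneg (P := P) (X := X) (V := V)
  refine (integrable_weight_pow (by omega) hX hV hV (momentBound P X V)).mono' ?_ ?_
  · have h1 := hX.1.norm
    have h2 := hV.1.norm
    exact (h2.const_add 1).mul (((((h1.const_add _).add h2).const_add 1)).pow q)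
  · refine Eventually.of_forall fun ω => ?_
    rw [Real.norm_of_nonneg (by positivity), Real.norm_of_nonneg hB]
    calc _ ≤ (1 + ‖X ω‖ + ‖V ω‖ + ‖V ω‖ + momentBound P X V) ^ 1 *
          (1 + ‖X ω‖ + ‖V ω‖ + ‖V ω‖ + momentBound P X V) ^ q := by
          rw [pow_one]
          have := norm_nonneg (X ω)
          have := norm_nonneg (V ω)
          gcongr ?_ * ?_ ^ _ <;> linarith
      _ ≤ _ := by
          rw [← pow_add]
          have := norm_nonneg (X ω)
          have := norm_nonneg (V ω)
          exact pow_le_pow_right₀ (by linarith) (by omega)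

/-- The change of `w(x, ·)` along a step of the measure, as an average over the sample space. -/
theorem exists_inner_stepLaw_sub_eq (hG : IsGenerator w flat V a b Lw Lm C q) (hX : MemLp X 2 P)
    (hXa : ∀ h, MemLp (fun ω => X ω + a h ω) 2 P) (hXb : ∀ h, MemLp (fun ω => X ω + b h ω) 2 P)
    (h : ℝ) (x r : E d) : ∃ l : Icc (0 : ℝ) 1,
      inner ℝ r (w x (stepLaw hXa hXb h) - w x (law hX)) =
      ∫ ω, inner ℝ r ((1 / 2 : ℝ) • (flat x (P2.mix (law hX) (stepLaw hXa hXb h) l) (X ω + a h ω) +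
        flat x (P2.mix (law hX) (stepLaw hXa hXb h) l) (X ω + b h ω)) -
        flat x (P2.mix (law hX) (stepLaw hXa hXb h) l) (X ω)) ∂P := by
  obtain ⟨l, hl⟩ := exists_inner_sub_eq_flat (hG.hasFlatDeriv x) r (law hX) (stepLaw hXa hXb h)
  refine ⟨l, ?_⟩
  set m := P2.mix (law hX) (stepLaw hXa hXb h) l
  have hf := hG.hasFlatDeriv x m
  have i0 := (integrable_law_iff hX hf.continuous).1 (hf.integrable _)
  have i1 := (integrable_law_iff (hXa h) hf.continuous).1 (hf.integrable _)
  have i2 := (integrable_law_iff (hXb h) hf.continuous).1 (hf.integrable _)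
  rw [hl, P2.integral_mix (hf.integrable _) (hf.integrable _), integral_law hX hf.continuous,
    integral_law (hXa h) hf.continuous, integral_law (hXb h) hf.continuous, integral_inner,
    integral_sub, integral_smul, integral_add i1 i2]
  · congr 2
    norm_num
  · exact (i1.add i2).fun_smul (1 / 2 : ℝ)
  · exact i0
  · exact ((i1.add i2).fun_smul (1 / 2 : ℝ)).sub i0

theorem abs_mean_flat_le {P : Measure Ω} (hG : IsGenerator w flat V a b Lw Lm C q) {h : ℝ}
    (hh : h ∈ Ioc (0 : ℝ) 1) {m : P2 d} (hm : m.moment ≤ momentBound P X V) (x r : E d) (ω : Ω) :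
    ‖h⁻¹ * inner ℝ r ((1 / 2 : ℝ) • (flat x m (X ω + a h ω) + flat x m (X ω + b h ω)) -
        flat x m (X ω))‖ ≤ ‖r‖ * (C * (1 + ‖x‖) ^ q) *
          ((1 + ‖V ω‖) * (1 + (momentBound P X V + ‖X ω‖ + ‖V ω‖)) ^ q) := by
  obtain ⟨ζ, hζ, e⟩ := hG.mean_flat h hh ω r x m (X ω)
  have hC := hG.C_nonneg
  have hm0 := m.moment_nonneg
  have hζ' := hζ.trans (sqrt_mul_le_of_mem_Ioc hh (norm_nonneg _))
  rw [e, inv_mul_cancel_left₀ hh.1.ne']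
  calc ‖inner ℝ r (Lm ω x m (X ω + ζ))‖ ≤ ‖r‖ * ‖Lm ω x m (X ω + ζ)‖ := norm_inner_le_norm _ _
    _ ≤ ‖r‖ * (C * (1 + ‖V ω‖) * (1 + ‖x‖ + m.moment + ‖X ω + ζ‖) ^ q) := by
      gcongr; exact hG.norm_Lm _ _ _ _
    _ ≤ ‖r‖ * (C * (1 + ‖V ω‖) * (1 + ‖x‖ + (momentBound P X V + ‖X ω‖ + ‖V ω‖)) ^ q) := by
      gcongr ‖r‖ * (C * (1 + ‖V ω‖) * ?_ ^ q)
      linarith [norm_add_le (X ω) ζ]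
    _ ≤ ‖r‖ * (C * (1 + ‖V ω‖) * ((1 + ‖x‖) ^ q *
        (1 + (momentBound P X V + ‖X ω‖ + ‖V ω‖)) ^ q)) := by
      gcongr
      exact one_add_add_pow_le (norm_nonneg _)
        (by linarith [norm_nonneg (X ω), norm_nonneg (V ω)]) q
    _ = _ := by ring

theorem abs_inner_stepLaw_le (hG : IsGenerator w flat V a b Lw Lm C q) (hX : MemLp X (q + 2 : ℕ) P)
    (hV : MemLp V (q + 2 : ℕ) P) (hX2 : MemLp X 2 P) (hV2 : MemLp V 2 P)
    (hXa : ∀ h, MemLp (fun ω => X ω + a h ω) 2 P)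
    (hXb : ∀ h, MemLp (fun ω => X ω + b h ω) 2 P) {h : ℝ} (hh : h ∈ Ioc (0 : ℝ) 1) (x r : E d) :
    |h⁻¹ * inner ℝ r (w x (stepLaw hXa hXb h) - w x (law hX2))| ≤
      ‖r‖ * (C * (1 + ‖x‖) ^ q) * growthConst P X V q := by
  obtain ⟨l, hl⟩ := exists_inner_stepLaw_sub_eq hG hX2 hXa hXb h x r
  have hm := moment_mix_stepLaw_le hG hX2 hV2 hXa hXb hh l
  rw [hl, ← integral_const_mul, growthConst, ← integral_const_mul, ← Real.norm_eq_abs]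
  exact norm_integral_le_of_norm_le ((integrable_growth hX hV).const_mul _)
    (Eventually.of_forall fun ω => abs_mean_flat_le hG hh hm x r ω)

/-- The convex combinations of the initial and the displaced law tend to the initial one. -/
theorem tendsto_mix_stepLaw (hG : IsGenerator w flat V a b Lw Lm C q) (hX2 : MemLp X 2 P)
    (hV2 : MemLp V 2 P) (hXa : ∀ h, MemLp (fun ω => X ω + a h ω) 2 P)
    (hXb : ∀ h, MemLp (fun ω => X ω + b h ω) 2 P) (l : ℝ → Icc (0 : ℝ) 1) :
    Tendsto (fun h => P2.mix (law hX2) (stepLaw hXa hXb h) (l h)) (𝓝[>] 0) (𝓝 (law hX2)) := by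
  refine P2.tendsto_nhds_of_costLE (c := fun h => h * ∫ ω, ‖V ω‖ ^ 2 ∂P) ?_ ?_
  · have : Tendsto (fun h : ℝ => h * ∫ ω, ‖V ω‖ ^ 2 ∂P) (𝓝 0) (𝓝 (0 * ∫ ω, ‖V ω‖ ^ 2 ∂P)) :=
      (continuous_id.mul continuous_const).tendsto 0
    rw [zero_mul] at this
    exact this.mono_left nhdsWithin_le_nhds
  · filter_upwards [Ioc_mem_nhdsGT zero_lt_one] with h hh
    exact (P2.costLE_self _ _).mix (costLE_stepLaw hG hX2 hV2 hXa hXb hh) _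

/-- The displaced laws tend to the initial one in `𝒲₂`. -/
theorem tendsto_stepLaw (hG : IsGenerator w flat V a b Lw Lm C q) (hX2 : MemLp X 2 P)
    (hV2 : MemLp V 2 P) (hXa : ∀ h, MemLp (fun ω => X ω + a h ω) 2 P)
    (hXb : ∀ h, MemLp (fun ω => X ω + b h ω) 2 P) :
    Tendsto (stepLaw hXa hXb) (𝓝[>] 0) (𝓝 (law hX2)) :=
  (tendsto_mix_stepLaw hG hX2 hV2 hXa hXb fun _ => ⟨1, zero_le_one, le_rfl⟩).congr fun _ =>
    P2.mix_one _ _ _ rfl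

/-- The derivative of `w(x, ·)` along the displacement of the measure. -/
theorem tendsto_inner_stepLaw (hG : IsGenerator w flat V a b Lw Lm C q)
    (hX : MemLp X (q + 2 : ℕ) P) (hV : MemLp V (q + 2 : ℕ) P) (hX2 : MemLp X 2 P)
    (hV2 : MemLp V 2 P) (hXa : ∀ h, MemLp (fun ω => X ω + a h ω) 2 P)
    (hXb : ∀ h, MemLp (fun ω => X ω + b h ω) 2 P) (x r : E d)
    (hLm : AEStronglyMeasurable (fun ω => Lm ω x (law hX2) (X ω)) P) :
    Tendsto (fun h => h⁻¹ * inner ℝ r (w x (stepLaw hXa hXb h) - w x (law hX2))) (𝓝[>] 0)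
      (𝓝 (inner ℝ r (∫ ω, Lm ω x (law hX2) (X ω) ∂P))) := by
  have hC := hG.C_nonneg
  have hLmi : Integrable (fun ω => Lm ω x (law hX2) (X ω)) P := by
    refine ((integrable_growth hX hV).const_mul (C * (1 + ‖x‖) ^ q)).mono' hLm
      (Eventually.of_forall fun ω => ?_)
    have hm := moment_law_le_momentBound hX2 hV2 hX2 fun ω =>
      le_add_of_nonneg_right (norm_nonneg _)
    have hm0 := (law hX2).moment_nonneg
    have hB := momentBound_nonneg (P := P) (X := X) (V := V)
    calc _ ≤ C * (1 + ‖V ω‖) * (1 + ‖x‖ + (law hX2).moment + ‖X ω‖) ^ q := hG.norm_Lm _ _ _ _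
      _ ≤ C * (1 + ‖V ω‖) * (1 + ‖x‖ + (momentBound P X V + ‖X ω‖ + ‖V ω‖)) ^ q := by
        gcongr C * (1 + ‖V ω‖) * ?_ ^ q
        linarith [norm_nonneg (V ω)]
      _ ≤ C * (1 + ‖V ω‖) * ((1 + ‖x‖) ^ q *
          (1 + (momentBound P X V + ‖X ω‖ + ‖V ω‖)) ^ q) := by
        gcongr
        exact one_add_add_pow_le (norm_nonneg _) (by positivity) q
      _ = _ := by ring
  choose l hl using fun h => exists_inner_stepLaw_sub_eq hG hX2 hXa hXb h x r
  rw [← integral_inner hLmi]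
  have e : ∀ h : ℝ, h⁻¹ * inner ℝ r (w x (stepLaw hXa hXb h) - w x (law hX2)) = _ := fun h => by
    rw [hl h, ← integral_const_mul]
  simp only [e]
  refine tendsto_integral_filter_of_dominated_convergence _ ?_ ?_
    ((integrable_growth hX hV).const_mul (‖r‖ * (C * (1 + ‖x‖) ^ q))) ?_
  · refine Eventually.of_forall fun h => ?_
    have hc := (hG.hasFlatDeriv x (P2.mix (law hX2) (stepLaw hXa hXb h) (l h))).continuous
    have h1 := hc.comp_aestronglyMeasurable (hXa h).1
    have h2 := hc.comp_aestronglyMeasurable (hXb h).1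
    have h3 := hc.comp_aestronglyMeasurable hX2.1
    exact (aestronglyMeasurable_const.inner
      (((h1.add h2).const_smul (1 / 2 : ℝ)).sub h3)).const_mul _
  · filter_upwards [Ioc_mem_nhdsGT zero_lt_one] with h hh
    exact Eventually.of_forall fun ω => abs_mean_flat_le hG hh
      (moment_mix_stepLaw_le hG hX2 hV2 hXa hXb hh (l h)) x r ω
  · refine Eventually.of_forall fun ω => ?_
    have hz : ∀ h : ℝ, ∃ ζ : E d, h ∈ Ioc (0 : ℝ) 1 → ‖ζ‖ ≤ Real.sqrt h * ‖V ω‖ ∧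
        inner ℝ r ((1 / 2 : ℝ) •
          (flat x (P2.mix (law hX2) (stepLaw hXa hXb h) (l h)) (X ω + a h ω) +
          flat x (P2.mix (law hX2) (stepLaw hXa hXb h) (l h)) (X ω + b h ω)) -
          flat x (P2.mix (law hX2) (stepLaw hXa hXb h) (l h)) (X ω)) =
        h * inner ℝ r (Lm ω x (P2.mix (law hX2) (stepLaw hXa hXb h) (l h)) (X ω + ζ)) := fun h => by
      by_cases hh : h ∈ Ioc (0 : ℝ) 1
      · obtain ⟨ζ, h1, h2⟩ := hG.mean_flat h hh ω r x
          (P2.mix (law hX2) (stepLaw hXa hXb h) (l h)) (X ω)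
        exact ⟨ζ, fun _ => ⟨h1, h2⟩⟩
      · exact ⟨0, fun h => absurd h hh⟩
    choose ζ hζ using hz
    have hζ0 : Tendsto ζ (𝓝[>] 0) (𝓝 0) := tendsto_of_norm_le_sqrt fun h hh => (hζ h hh).1
    have hy : Tendsto (fun h => X ω + ζ h) (𝓝[>] 0) (𝓝 (X ω)) := by
      simpa using hζ0.const_add (X ω)
    have hlim := ((hG.continuous_Lm ω x).tendsto (law hX2, X ω)).comp
      ((tendsto_mix_stepLaw hG hX2 hV2 hXa hXb l).prodMk_nhds hy)
    refine (tendsto_const_nhds.inner hlim).congr' ?_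
    filter_upwards [Ioc_mem_nhdsGT zero_lt_one] with h hh
    rw [(hζ h hh).2, inv_mul_cancel_left₀ hh.1.ne']
    rfl

/-- The derivative along a displacement of the weighted mean of `w(X, ℒ(X))`: both the point at
which `w` is evaluated and the measure move. -/
theorem tendsto_integral_step (hG : IsGenerator w flat V a b Lw Lm C q)
    (hX : MemLp X (q + 2 : ℕ) P) (hV : MemLp V (q + 2 : ℕ) P) (hR : MemLp R (q + 2 : ℕ) P)
    (hX2 : MemLp X 2 P) (hV2 : MemLp V 2 P) (hXa : ∀ h, MemLp (fun ω => X ω + a h ω) 2 P)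
    (hXb : ∀ h, MemLp (fun ω => X ω + b h ω) 2 P)
    (hLm : ∀ x, AEStronglyMeasurable (fun ω => Lm ω x (law hX2) (X ω)) P) :
    Tendsto (fun h => h⁻¹ * ∫ ω, inner ℝ (R ω) ((1 / 2 : ℝ) •
        (w (X ω + a h ω) (stepLaw hXa hXb h) + w (X ω + b h ω) (stepLaw hXa hXb h)) -
        w (X ω) (law hX2)) ∂P) (𝓝[>] 0)
      (𝓝 (∫ ω, inner ℝ (R ω)
        (Lw ω (X ω) (law hX2) + ∫ ω', Lm ω' (X ω) (law hX2) (X ω') ∂P) ∂P)) := by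
  have hC := hG.C_nonneg
  have hB := momentBound_nonneg (P := P) (X := X) (V := V)
  have hK := growthConst_nonneg (P := P) (X := X) (V := V) (q := q)
  simp only [← integral_const_mul]
  -- move the point with the measure frozen after the step, then move the measure
  have split : ∀ h ω, h⁻¹ * inner ℝ (R ω) ((1 / 2 : ℝ) •
        (w (X ω + a h ω) (stepLaw hXa hXb h) + w (X ω + b h ω) (stepLaw hXa hXb h)) -
        w (X ω) (law hX2)) = h⁻¹ * inner ℝ (R ω) ((1 / 2 : ℝ) •
        (w (X ω + a h ω) (stepLaw hXa hXb h) + w (X ω + b h ω) (stepLaw hXa hXb h)) -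
        w (X ω) (stepLaw hXa hXb h)) +
        h⁻¹ * inner ℝ (R ω) (w (X ω) (stepLaw hXa hXb h) - w (X ω) (law hX2)) := fun h ω => by
    rw [← mul_add, ← inner_add_right, sub_add_sub_cancel]
  have hz : ∀ (h : ℝ) (ω : Ω), ∃ ζ : E d, h ∈ Ioc (0 : ℝ) 1 → ‖ζ‖ ≤ Real.sqrt h * ‖V ω‖ ∧
      inner ℝ (R ω) ((1 / 2 : ℝ) •
        (w (X ω + a h ω) (stepLaw hXa hXb h) + w (X ω + b h ω) (stepLaw hXa hXb h)) -
        w (X ω) (stepLaw hXa hXb h)) =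
      h * inner ℝ (R ω) (Lw ω (X ω + ζ) (stepLaw hXa hXb h)) := fun h ω => by
    by_cases hh : h ∈ Ioc (0 : ℝ) 1
    · obtain ⟨ζ, h1, h2⟩ := hG.mean_w h hh ω (R ω) (stepLaw hXa hXb h) (X ω)
      exact ⟨ζ, fun _ => ⟨h1, h2⟩⟩
    · exact ⟨0, fun h => absurd h hh⟩
  choose ζ hζ using hz
  have hmom : ∀ h ∈ Ioc (0 : ℝ) 1, (stepLaw hXa hXb h).moment ≤ momentBound P X V :=
    fun h hh => by
      have := moment_mix_stepLaw_le hG hX2 hV2 hXa hXb hh ⟨1, zero_le_one, le_rfl⟩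
      rwa [P2.mix_one _ _ _ rfl] at this
  refine tendsto_integral_filter_of_dominated_convergence
    (fun ω => C * (1 + growthConst P X V q) *
      (1 + ‖X ω‖ + ‖V ω‖ + ‖R ω‖ + ‖momentBound P X V‖) ^ (q + 2)) ?_ ?_
    ((integrable_weight_pow (by omega) hX hV hR _).const_mul _) ?_
  · refine Eventually.of_forall fun h => ?_
    have hc : ∀ m, Continuous fun x => w x m := fun m =>
      hG.continuous_w.comp (Continuous.prodMk_left m)
    have h1 := (hc (stepLaw hXa hXb h)).comp_aestronglyMeasurable (hXa h).1
    have h2 := (hc (stepLaw hXa hXb h)).comp_aestronglyMeasurable (hXb h).1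
    have h3 := (hc (law hX2)).comp_aestronglyMeasurable hX2.1
    exact (hR.1.inner (((h1.add h2).const_smul (1 / 2 : ℝ)).sub h3)).const_mul _
  · filter_upwards [Ioc_mem_nhdsGT zero_lt_one] with h hh
    refine Eventually.of_forall fun ω => ?_
    rw [split, (hζ h ω hh).2, inv_mul_cancel_left₀ hh.1.ne', Real.norm_of_nonneg hB]
    have hX0 := norm_nonneg (X ω)
    have hV0 := norm_nonneg (V ω)
    have hR0 := norm_nonneg (R ω)
    have hm := hmom h hh
    have hm0 := (stepLaw hXa hXb h).moment_nonneg
    have hζ' := (hζ h ω hh).1.trans (sqrt_mul_le_of_mem_Ioc hh (norm_nonneg _))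
    set N := 1 + ‖X ω‖ + ‖V ω‖ + ‖R ω‖ + momentBound P X V with hN
    have hN1 : 1 ≤ N := by linarith
    refine (norm_add_le _ _).trans ?_
    have t1 : ‖inner ℝ (R ω) (Lw ω (X ω + ζ h ω) (stepLaw hXa hXb h))‖ ≤ C * N ^ (q + 2) := by
      calc _ ≤ ‖R ω‖ * ‖Lw ω (X ω + ζ h ω) (stepLaw hXa hXb h)‖ := norm_inner_le_norm _ _
        _ ≤ ‖R ω‖ * (C * (1 + ‖V ω‖) * (1 + ‖X ω + ζ h ω‖ + (stepLaw hXa hXb h).moment) ^ q) := by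
          gcongr; exact hG.norm_Lw _ _ _
        _ ≤ N * (C * N * N ^ q) := by
          have := norm_add_le (X ω) (ζ h ω)
          gcongr ?_ * (C * ?_ * ?_ ^ q) <;> linarith
        _ = C * N ^ (q + 2) := by ring
    have t2 : ‖h⁻¹ * inner ℝ (R ω) (w (X ω) (stepLaw hXa hXb h) - w (X ω) (law hX2))‖ ≤
        C * growthConst P X V q * N ^ (q + 2) := by
      rw [Real.norm_eq_abs]
      refine (abs_inner_stepLaw_le hG hX hV hX2 hV2 hXa hXb hh _ _).trans ?_
      calc ‖R ω‖ * (C * (1 + ‖X ω‖) ^ q) * growthConst P X V q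
          ≤ N * (C * N ^ q) * growthConst P X V q := by
            gcongr ?_ * (C * ?_ ^ q) * _ <;> linarith
        _ = C * growthConst P X V q * N ^ (q + 1) := by ring
        _ ≤ C * growthConst P X V q * N ^ (q + 2) := by
            exact mul_le_mul_of_nonneg_left (pow_le_pow_right₀ hN1 (by omega)) (by positivity)
    linarith
  · refine Eventually.of_forall fun ω => ?_
    have hζ0 : Tendsto (fun h => ζ h ω) (𝓝[>] 0) (𝓝 0) :=
      tendsto_of_norm_le_sqrt fun h hh => (hζ h ω hh).1
    have hy : Tendsto (fun h => X ω + ζ h ω) (𝓝[>] 0) (𝓝 (X ω)) := by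
      simpa using hζ0.const_add (X ω)
    have hlim := ((hG.continuous_Lw ω).tendsto (X ω, law hX2)).comp
      (hy.prodMk_nhds (tendsto_stepLaw hG hX2 hV2 hXa hXb))
    have hm := tendsto_inner_stepLaw hG hX hV hX2 hV2 hXa hXb (X ω) (R ω) (hLm (X ω))
    rw [inner_add_right]
    refine ((tendsto_const_nhds.inner hlim).add hm).congr' ?_
    filter_upwards [Ioc_mem_nhdsGT zero_lt_one] with h hh
    rw [split, (hζ h ω hh).2, inv_mul_cancel_left₀ hh.1.ne']
    rfl

end

/-! ### The monotonicity pairing -/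

section

variable {Ω : Type*} [MeasurableSpace Ω] {P : Measure Ω}

theorem eLpNorm_natCast_pow {F : Type*} [NormedAddCommGroup F] (f : Ω → F) {p : ℕ} (hp : p ≠ 0) :
    eLpNorm f p P ^ p = ∫⁻ ω, ‖f ω‖ₑ ^ p ∂P := by
  have := eLpNorm_nnreal_pow_eq_lintegral (f := f) (μ := P) (p := (p : NNReal)) (by simpa using hp)
  simpa using this

theorem tendsto_integral_inner_of_L2 {H : Type*} [NormedAddCommGroup H] [InnerProductSpace ℝ H]
    {f g : ℕ → Ω → H} {f₀ g₀ : Ω → H} (hf : ∀ k, MemLp (f k) 2 P) (hg : ∀ k, MemLp (g k) 2 P)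
    (hf₀ : MemLp f₀ 2 P) (hg₀ : MemLp g₀ 2 P)
    (hfl : Tendsto (fun k => eLpNorm (f k - f₀) 2 P) atTop (𝓝 0))
    (hgl : Tendsto (fun k => eLpNorm (g k - g₀) 2 P) atTop (𝓝 0)) :
    Tendsto (fun k => ∫ ω, inner ℝ (f k ω) (g k ω) ∂P) atTop
      (𝓝 (∫ ω, inner ℝ (f₀ ω) (g₀ ω) ∂P)) := by
  have e : ∀ {u v : Ω → H} (hu : MemLp u 2 P) (hv : MemLp v 2 P),
      inner ℝ hu.toLp hv.toLp = ∫ ω, inner ℝ (u ω) (v ω) ∂P := fun hu hv => by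
    rw [L2.inner_def]
    refine integral_congr_ae ?_
    filter_upwards [hu.coeFn_toLp, hv.coeFn_toLp] with ω h1 h2
    rw [h1, h2]
  have h1 : Tendsto (fun k => (hf k).toLp) atTop (𝓝 hf₀.toLp) :=
    (Lp.tendsto_Lp_iff_tendsto_eLpNorm'' _ hf _ hf₀).2 hfl
  have h2 : Tendsto (fun k => (hg k).toLp) atTop (𝓝 hg₀.toLp) :=
    (Lp.tendsto_Lp_iff_tendsto_eLpNorm'' _ hg _ hg₀).2 hgl
  simpa only [e] using h1.inner (𝕜 := ℝ) h2

variable [IsProbabilityMeasure P] {d : ℕ}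

/-- Convergence in `L²` implies convergence of the laws in `𝒲₂`. -/
theorem tendsto_law {X : ℕ → Ω → E d} {X₀ : Ω → E d} (hX : ∀ k, MemLp (X k) 2 P)
    (hX₀ : MemLp X₀ 2 P) (h : Tendsto (fun k => eLpNorm (X k - X₀) 2 P) atTop (𝓝 0)) :
    Tendsto (fun k => law (hX k)) atTop (𝓝 (law hX₀)) := by
  refine P2.tendsto_nhds_of_costLE (c := fun k => (eLpNorm (X k - X₀) 2 P).toReal ^ 2) ?_ ?_
  · have := ((ENNReal.tendsto_toReal ENNReal.zero_ne_top).comp h).pow 2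
    simpa using this
  · refine Eventually.of_forall fun k => ?_
    have h1 := costLE_law hX₀ (hX k)
    have h2 := eLpNorm_natCast_pow (P := P) (X k - X₀) two_ne_zero
    have h3 := ((hX k).sub hX₀).eLpNorm_ne_top
    rw [← ENNReal.toReal_pow, ENNReal.ofReal_toReal (by finiteness)]
    rw [Nat.cast_ofNat] at h2
    rw [h2]
    simpa [enorm_sub_rev] using h1

theorem moment_law_eq {X : Ω → E d} (hX : MemLp X 2 P) :
    (law hX).moment = (eLpNorm X 2 P).toReal := by
  refine (sq_eq_sq₀ (P2.moment_nonneg _) ENNReal.toReal_nonneg).1 ?_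
  have h2 := eLpNorm_natCast_pow (P := P) X two_ne_zero
  rw [Nat.cast_ofNat, lintegral_enorm_sq_eq hX] at h2
  rw [moment_law_sq, ← ENNReal.toReal_pow, h2,
    ENNReal.toReal_ofReal (integral_nonneg fun _ => by positivity)]

theorem exists_moment_law_le {X : ℕ → Ω → E d} {X₀ : Ω → E d} (hX : ∀ k, MemLp (X k) 2 P)
    (hX₀ : MemLp X₀ 2 P) (h : Tendsto (fun k => eLpNorm (X k - X₀) 2 P) atTop (𝓝 0)) :
    ∃ B : ℝ, 0 ≤ B ∧ ∀ k, (law (hX k)).moment ≤ B := by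
  have h1 := (ENNReal.tendsto_toReal ENNReal.zero_ne_top).comp h
  obtain ⟨b, hb⟩ := h1.bddAbove_range
  refine ⟨b + (law hX₀).moment, add_nonneg (le_trans ENNReal.toReal_nonneg (hb ⟨0, rfl⟩))
    (P2.moment_nonneg _), fun k => ?_⟩
  have h3 : (eLpNorm (X k - X₀) 2 P).toReal ≤ b := hb ⟨k, rfl⟩
  have h4 : eLpNorm (X k) 2 P ≤ eLpNorm (X k - X₀) 2 P + eLpNorm X₀ 2 P := by
    have := eLpNorm_add_le ((hX k).sub hX₀).1 hX₀.1 one_le_two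
    rwa [sub_add_cancel] at this
  rw [moment_law_eq, moment_law_eq]
  have h5 := ENNReal.toReal_mono
    (ENNReal.add_ne_top.2 ⟨((hX k).sub hX₀).eLpNorm_ne_top, hX₀.eLpNorm_ne_top⟩) h4
  rw [ENNReal.toReal_add ((hX k).sub hX₀).eLpNorm_ne_top hX₀.eLpNorm_ne_top] at h5
  linarith

/-- Continuity in `L²` of the superposition operator `X ↦ U(X, ℒ(X))`, for maps `U` of linear
growth, jointly in `U` and `X`. -/
theorem tendsto_superposition {U : ℕ → E d → P2 d → E d} {U₀ : E d → P2 d → E d} {C : ℝ}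
    (hC : 0 ≤ C) (hUg : ∀ k x m, ‖U k x m‖ ≤ C * (1 + ‖x‖ + m.moment))
    (hUc : ∀ k m, Continuous fun x => U k x m)
    {X : ℕ → Ω → E d} {X₀ : Ω → E d} (hX : ∀ k, MemLp (X k) 2 P)
    (hX₀ : MemLp X₀ 2 P) (hXl : Tendsto (fun k => eLpNorm (X k - X₀) 2 P) atTop (𝓝 0))
    (hUl : ∀ (κ : ℕ → ℕ) (x : ℕ → E d) (x₀ : E d), Tendsto κ atTop atTop →
      Tendsto x atTop (𝓝 x₀) →
      Tendsto (fun k => U (κ k) (x k) (law (hX (κ k)))) atTop (𝓝 (U₀ x₀ (law hX₀))))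
    (hU₀ : MemLp (fun ω => U₀ (X₀ ω) (law hX₀)) 2 P) :
    Tendsto (fun k => eLpNorm ((fun ω => U k (X k ω) (law (hX k))) -
      fun ω => U₀ (X₀ ω) (law hX₀)) 2 P) atTop (𝓝 0) := by
  obtain ⟨B, hB0, hB⟩ := exists_moment_law_le hX hX₀ hXl
  have hmeas : ∀ k, AEStronglyMeasurable (fun ω => U k (X k ω) (law (hX k))) P := fun k =>
    (hUc k _).comp_aestronglyMeasurable (hX k).1
  -- uniform integrability, from the dominating sequence `C (1 + ‖X k‖ + B)`
  have hui : UnifIntegrable (fun k ω => U k (X k ω) (law (hX k))) 2 P := by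
    have h1 : UnifIntegrable (fun k ω => ‖X k ω‖) 2 P := by
      have := unifIntegrable_of_tendsto_Lp one_le_two ENNReal.ofNat_ne_top hX hX₀ hXl
      intro ε hε
      obtain ⟨δ, hδ, H⟩ := this hε
      refine ⟨δ, hδ, fun i s hs hμ => (eLpNorm_mono fun ω => ?_).trans (H i s hs hμ)⟩
      by_cases hω : ω ∈ s <;> simp [hω]
    have h2 : UnifIntegrable (fun (_ : ℕ) (_ : Ω) => 1 + B) 2 P :=
      unifIntegrable_const one_le_two ENNReal.ofNat_ne_top (memLp_const _)
    have h3 := h2.add h1 one_le_two (fun _ => aestronglyMeasurable_const) fun k => (hX k).1.norm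
    intro ε hε
    obtain ⟨δ, hδ, H⟩ := h3 (ε := ε / (C + 1)) (by positivity)
    refine ⟨δ, hδ, fun i s hs hμ => ?_⟩
    have hle : ∀ ω, ‖s.indicator (fun ω => U i (X i ω) (law (hX i))) ω‖ ≤
        (C + 1) * ‖s.indicator (((fun (_ : ℕ) (_ : Ω) => 1 + B) + fun k ω => ‖X k ω‖) i) ω‖ := by
      intro ω
      by_cases hω : ω ∈ s
      · have hXn := norm_nonneg (X i ω)
        simp only [indicator_of_mem hω, Pi.add_apply]
        rw [Real.norm_of_nonneg (by linarith)]
        refine (hUg i _ _).trans ?_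
        have h1 := hB i
        have h2 := (law (hX i)).moment_nonneg
        exact mul_le_mul (by linarith) (by linarith) (by linarith) (by linarith)
      · simp [hω]
    refine (eLpNorm_le_mul_eLpNorm_of_ae_le_mul (Eventually.of_forall hle) 2).trans ?_
    calc _ ≤ ENNReal.ofReal (C + 1) * ENNReal.ofReal (ε / (C + 1)) := by gcongr; exact H i s hs hμ
      _ = ENNReal.ofReal ε := by
        rw [← ENNReal.ofReal_mul (by positivity), mul_div_cancel₀ ε (by positivity)]
  refine tendsto_of_subseq_tendsto fun ns hns => ?_
  have hmX := tendstoInMeasure_of_tendsto_eLpNorm two_ne_zero (fun k => (hX k).1) hX₀.1 hXl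
  obtain ⟨ms, hms, hae⟩ := TendstoInMeasure.exists_seq_tendsto_ae
    (fun ε hε => (hmX ε hε).comp hns)
  refine ⟨ms, tendsto_Lp_finite_of_tendsto_ae one_le_two ENNReal.ofNat_ne_top (fun k => hmeas _) hU₀
    (fun ε hε => ?_) ?_⟩
  · obtain ⟨δ, hδ, H⟩ := hui hε
    exact ⟨δ, hδ, fun i s hs hμ => H _ s hs hμ⟩
  · filter_upwards [hae] with ω hω
    exact hUl (fun k => ns (ms k)) _ _ (hns.comp hms.tendsto_atTop) hω

/-- The quantity `𝔼[(U(X, ℒ(X)) - U(Y, ℒ(Y))) · (X - Y)]`. -/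
def monoCorr (U : E d → P2 d → E d) {X Y : Ω → E d} (hX : MemLp X 2 P) (hY : MemLp Y 2 P) : ℝ :=
  ∫ ω, inner ℝ (U (X ω) (law hX) - U (Y ω) (law hY)) (X ω - Y ω) ∂P

theorem memLp_superposition {U : E d → P2 d → E d} {C : ℝ}
    (hUg : ∀ x m, ‖U x m‖ ≤ C * (1 + ‖x‖ + m.moment)) (hUc : ∀ m, Continuous fun x => U x m)
    {p : ℝ≥0∞} {X : Ω → E d} (hX : MemLp X p P) (m : P2 d) : MemLp (fun ω => U (X ω) m) p P := by
  have h1 : MemLp (fun ω => 1 + ‖X ω‖ + m.moment) p P :=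
    ((memLp_const (1 : ℝ)).add hX.norm).add (memLp_const m.moment)
  replace h1 := h1.const_mul C
  refine h1.of_le ((hUc m).comp_aestronglyMeasurable hX.1) (Eventually.of_forall fun ω => ?_)
  exact (hUg _ _).trans (Real.le_norm_self _)

/-- Continuity of the pairing for `L²` convergence of the variables, along functions `U k` of
linear growth converging continuously. The convergence hypothesis lets the index run along
subsequences because convergence in `L²` is reduced to almost sure convergence. -/
theorem tendsto_monoCorr {U : ℕ → E d → P2 d → E d} {U₀ : E d → P2 d → E d} {C : ℝ}
    (hC : 0 ≤ C) (hUg : ∀ k x m, ‖U k x m‖ ≤ C * (1 + ‖x‖ + m.moment))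
    (hUg₀ : ∀ x m, ‖U₀ x m‖ ≤ C * (1 + ‖x‖ + m.moment))
    (hUc : ∀ k m, Continuous fun x => U k x m) (hUc₀ : ∀ m, Continuous fun x => U₀ x m)
    {X Y : ℕ → Ω → E d} {X₀ Y₀ : Ω → E d} (hX : ∀ k, MemLp (X k) 2 P) (hY : ∀ k, MemLp (Y k) 2 P)
    (hX₀ : MemLp X₀ 2 P) (hY₀ : MemLp Y₀ 2 P)
    (hXl : Tendsto (fun k => eLpNorm (X k - X₀) 2 P) atTop (𝓝 0))
    (hYl : Tendsto (fun k => eLpNorm (Y k - Y₀) 2 P) atTop (𝓝 0))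
    (hUl : ∀ (κ : ℕ → ℕ) (x : ℕ → E d) (x₀ : E d) (m : ℕ → P2 d) (m₀ : P2 d),
      Tendsto κ atTop atTop → Tendsto x atTop (𝓝 x₀) → Tendsto m atTop (𝓝 m₀) →
      Tendsto (fun k => U (κ k) (x k) (m k)) atTop (𝓝 (U₀ x₀ m₀))) :
    Tendsto (fun k => monoCorr (U k) (hX k) (hY k)) atTop (𝓝 (monoCorr U₀ hX₀ hY₀)) := by
  have mU := fun k => memLp_superposition (hUg k) (hUc k) (hX k) (law (hX k))
  have mU' := fun k => memLp_superposition (hUg k) (hUc k) (hY k) (law (hY k))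
  have mU₀ := memLp_superposition hUg₀ hUc₀ hX₀ (law hX₀)
  have mU₀' := memLp_superposition hUg₀ hUc₀ hY₀ (law hY₀)
  have l1 := tendsto_superposition hC hUg hUc hX hX₀ hXl (fun κ x x₀ hκ hx =>
    hUl κ x x₀ _ _ hκ hx ((tendsto_law hX hX₀ hXl).comp hκ)) mU₀
  have l2 := tendsto_superposition hC hUg hUc hY hY₀ hYl (fun κ x x₀ hκ hx =>
    hUl κ x x₀ _ _ hκ hx ((tendsto_law hY hY₀ hYl).comp hκ)) mU₀'
  have hsub : ∀ {f g : ℕ → Ω → E d} {f₀ g₀ : Ω → E d}, (∀ k, MemLp (f k) 2 P) →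
      (∀ k, MemLp (g k) 2 P) → MemLp f₀ 2 P → MemLp g₀ 2 P →
      Tendsto (fun k => eLpNorm (f k - f₀) 2 P) atTop (𝓝 0) →
      Tendsto (fun k => eLpNorm (g k - g₀) 2 P) atTop (𝓝 0) →
      Tendsto (fun k => eLpNorm ((f k - g k) - (f₀ - g₀)) 2 P) atTop (𝓝 0) := by
    intro f g f₀ g₀ hf hg hf₀ hg₀ h1 h2
    refine tendsto_of_tendsto_of_tendsto_of_le_of_le tendsto_const_nhds
      (by simpa using h1.add h2) (fun _ => zero_le) fun k => ?_
    simp only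
    rw [sub_sub_sub_comm]
    exact eLpNorm_sub_le ((hf k).sub hf₀).1 ((hg k).sub hg₀).1 one_le_two
  exact tendsto_integral_inner_of_L2 (fun k => (mU k).sub (mU' k)) (fun k => (hX k).sub (hY k))
    (mU₀.sub mU₀') (hX₀.sub hY₀) (hsub mU mU' mU₀ mU₀' l1 l2) (hsub hX hY hX₀ hY₀ hXl hYl)

theorem law_eq_of_map_prod_eq {Ω' : Type*} [MeasurableSpace Ω'] {P' : Measure Ω'}
    [IsProbabilityMeasure P'] {X Y : Ω → E d} {X' Y' : Ω' → E d} (hX : MemLp X 2 P)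
    (hY : MemLp Y 2 P) (hX' : MemLp X' 2 P') (hY' : MemLp Y' 2 P')
    (h : P.map (fun ω => (X ω, Y ω)) = P'.map (fun ω => (X' ω, Y' ω))) :
    law hX = law hX' ∧ law hY = law hY' := by
  have h1 := hX.1.aemeasurable.prodMk hY.1.aemeasurable
  have h2 := hX'.1.aemeasurable.prodMk hY'.1.aemeasurable
  constructor
  · refine P2.ext_toMeasure ?_
    have := congrArg (Measure.map Prod.fst) h
    rwa [AEMeasurable.map_map_of_aemeasurable measurable_fst.aemeasurable h1,
      AEMeasurable.map_map_of_aemeasurable measurable_fst.aemeasurable h2] at this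
  · refine P2.ext_toMeasure ?_
    have := congrArg (Measure.map Prod.snd) h
    rwa [AEMeasurable.map_map_of_aemeasurable measurable_snd.aemeasurable h1,
      AEMeasurable.map_map_of_aemeasurable measurable_snd.aemeasurable h2] at this

theorem integral_eq_of_map_prod_eq {Ω' : Type*} [MeasurableSpace Ω'] {P' : Measure Ω'}
    {P : Measure Ω} {X Y : Ω → E d} {X' Y' : Ω' → E d} (hX : AEMeasurable X P)
    (hY : AEMeasurable Y P) (hX' : AEMeasurable X' P') (hY' : AEMeasurable Y' P')
    (h : P.map (fun ω => (X ω, Y ω)) = P'.map (fun ω => (X' ω, Y' ω))) {φ : E d × E d → ℝ}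
    (hφ : Continuous φ) : ∫ ω, φ (X ω, Y ω) ∂P = ∫ ω, φ (X' ω, Y' ω) ∂P' := by
  rw [← integral_map (hX.prodMk hY) hφ.aestronglyMeasurable, h,
    integral_map (hX'.prodMk hY') hφ.aestronglyMeasurable]

/-- `monoCorr` depends on the joint law of the pair only. -/
theorem monoCorr_eq_of_map_prod_eq {Ω' : Type*} [MeasurableSpace Ω'] {P' : Measure Ω'}
    [IsProbabilityMeasure P'] {U : E d → P2 d → E d} (hUc : ∀ m, Continuous fun x => U x m)
    {X Y : Ω → E d} {X' Y' : Ω' → E d} (hX : MemLp X 2 P)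
    (hY : MemLp Y 2 P) (hX' : MemLp X' 2 P') (hY' : MemLp Y' 2 P')
    (h : P.map (fun ω => (X ω, Y ω)) = P'.map (fun ω => (X' ω, Y' ω))) :
    monoCorr U hX hY = monoCorr U hX' hY' := by
  obtain ⟨h1, h2⟩ := law_eq_of_map_prod_eq hX hY hX' hY' h
  unfold monoCorr
  rw [h1, h2]
  exact integral_eq_of_map_prod_eq (φ := fun z => inner ℝ (U z.1 (law hX') - U z.2 (law hY'))
    (z.1 - z.2)) hX.1.aemeasurable hY.1.aemeasurable hX'.1.aemeasurable hY'.1.aemeasurable h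
    ((((hUc _).comp continuous_fst).sub ((hUc _).comp continuous_snd)).inner
      (continuous_fst.sub continuous_snd))

theorem map_prod_comp {Ω' : Type*} [MeasurableSpace Ω'] {P' : Measure Ω'}
    {P : Measure Ω} {τ : Ω' → Ω} (hτ : MeasurePreserving τ P' P) {X Y : Ω → E d}
    (hX : AEMeasurable X P) (hY : AEMeasurable Y P) :
    P'.map (fun ω => (X (τ ω), Y (τ ω))) = P.map (fun ω => (X ω, Y ω)) := by
  have h := hX.prodMk hY
  change P'.map ((fun ω => (X ω, Y ω)) ∘ τ) = _
  rw [← AEMeasurable.map_map_of_aemeasurable (by rw [hτ.map_eq]; exact h) hτ.aemeasurable,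
    hτ.map_eq]

end

/-! ### Polynomial growth; the generators of drift and noise -/

section growth

variable {d n : ℕ} {V : Type*} [NormedAddCommGroup V]

/-- Polynomial growth of degree `q` in `(x, θ, m, y)`, locally uniformly in `t ∈ (0, T)`. -/
def PolyGrowth (T : ℝ) (q : ℕ) (f : ℝ → E d → E n → P2 d → E d → V) : Prop :=
  ∀ a b : ℝ, 0 < a → b < T → ∃ C : ℝ, 0 ≤ C ∧ ∀ t ∈ Icc a b, ∀ x θ m y,
    ‖f t x θ m y‖ ≤ C * (1 + ‖x‖ + ‖θ‖ + m.moment + ‖y‖) ^ q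

theorem PolyGrowth.mono {T : ℝ} {q q' : ℕ} {f : ℝ → E d → E n → P2 d → E d → V}
    (h : PolyGrowth T q f) (hq : q ≤ q') : PolyGrowth T q' f := by
  intro a b ha hb
  obtain ⟨C, hC, H⟩ := h a b ha hb
  refine ⟨C, hC, fun t ht x θ m y => (H t ht x θ m y).trans ?_⟩
  have := m.moment_nonneg
  exact mul_le_mul_of_nonneg_left (pow_le_pow_right₀
    (by linarith [norm_nonneg x, norm_nonneg θ, norm_nonneg y]) hq) hC

theorem IsAdmissible'.polyGrowth {T : ℝ} {f : ℝ → E d → E n → P2 d → E d → V}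
    (h : IsAdmissible' T f) : ∃ q, PolyGrowth T q f := by
  obtain ⟨q, H⟩ := h.2
  refine ⟨q, fun a b ha hb => ?_⟩
  obtain ⟨C, hC⟩ := H a b ha hb
  refine ⟨|C|, abs_nonneg _, fun t ht x θ m y => (hC t ht x θ m y).trans ?_⟩
  have := m.moment_nonneg
  gcongr
  exact le_abs_self C

theorem IsAdmissible.polyGrowth {T : ℝ} {f : ℝ → E d → E n → P2 d → V}
    (h : IsAdmissible T f) : ∃ q, PolyGrowth T q (fun t x θ m (_ : E d) => f t x θ m) := by
  obtain ⟨q, H⟩ := h.2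
  refine ⟨q, fun a b ha hb => ?_⟩
  obtain ⟨C, hC⟩ := H a b ha hb
  refine ⟨|C|, abs_nonneg _, fun t ht x θ m y => (hC t ht x θ m).trans ?_⟩
  have := m.moment_nonneg
  gcongr ?_ * ?_ ^ q
  · exact le_abs_self C
  · linarith [norm_nonneg y]

theorem PolyGrowth.at_time {T : ℝ} {q : ℕ} {f : ℝ → E d → E n → P2 d → E d → V}
    (h : PolyGrowth T q f) {t : ℝ} (ht : t ∈ Ioo 0 T) (c : ℝ) : ∃ C : ℝ, 0 ≤ C ∧
      ∀ x (θ : E n) m y, ‖θ‖ ≤ c → ‖f t x θ m y‖ ≤ C * (1 + ‖x‖ + m.moment + ‖y‖) ^ q := by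
  obtain ⟨C, hC, H⟩ := h t t ht.1 ht.2
  refine ⟨C * (1 + |c|) ^ q, by positivity, fun x θ m y hθ =>
    (H t ⟨le_rfl, le_rfl⟩ x θ m y).trans ?_⟩
  have hm := m.moment_nonneg
  calc C * (1 + ‖x‖ + ‖θ‖ + m.moment + ‖y‖) ^ q
      ≤ C * (1 + |c| + (‖x‖ + m.moment + ‖y‖)) ^ q := by
        gcongr C * ?_ ^ q
        linarith [le_abs_self c]
    _ ≤ C * ((1 + |c|) ^ q * (1 + (‖x‖ + m.moment + ‖y‖)) ^ q) := by
      gcongr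
      exact one_add_add_pow_le (abs_nonneg c) (by positivity) q
    _ = _ := by ring

/-- A common degree of growth for all the derivatives of `W`. -/
structure HasDegree (T : ℝ) (J : Jet d n) (q : ℕ) : Prop where
  dt : PolyGrowth T q (fun t x θ m (_ : E d) => J.dt t x θ m)
  dx : PolyGrowth T q (fun t x θ m (_ : E d) => J.dx t x θ m)
  dxx : ∀ i, PolyGrowth T q (fun t x θ m (_ : E d) => J.dxx t x θ m i)
  dθ : PolyGrowth T q (fun t x θ m (_ : E d) => J.dθ t x θ m)
  dθθ : ∀ i, PolyGrowth T q (fun t x θ m (_ : E d) => J.dθθ t x θ m i)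
  dm : PolyGrowth T q J.dm
  dmy : ∀ i, PolyGrowth T q (fun t x θ m y => J.dmy t x θ m y i)

theorem HasDegree.mono {T : ℝ} {J : Jet d n} {q q' : ℕ} (h : HasDegree T J q) (hq : q ≤ q') :
    HasDegree T J q' :=
  ⟨h.dt.mono hq, h.dx.mono hq, fun i => (h.dxx i).mono hq, h.dθ.mono hq,
    fun i => (h.dθθ i).mono hq, h.dm.mono hq, fun i => (h.dmy i).mono hq⟩

theorem IsSmooth.exists_hasDegree {T : ℝ} {W : ℝ → E d → E n → P2 d → E d} {J : Jet d n}
    (hS : IsSmooth T W J) : ∃ q, HasDegree T J q := by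
  obtain ⟨q1, h1⟩ := hS.admissible_dt.polyGrowth
  obtain ⟨q2, h2⟩ := hS.admissible_dx.polyGrowth
  choose q3 h3 using fun i => (hS.admissible_dxx i).polyGrowth
  obtain ⟨q4, h4⟩ := hS.admissible_dθ.polyGrowth
  choose q5 h5 using fun i => (hS.admissible_dθθ i).polyGrowth
  obtain ⟨q6, h6⟩ := hS.admissible_dm.polyGrowth
  choose q7 h7 using fun i => (hS.admissible_dmy i).polyGrowth
  have l3 : ∀ i, q3 i ≤ ∑ i, q3 i := fun i => Finset.single_le_sum (fun _ _ => Nat.zero_le _)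
    (Finset.mem_univ i)
  have l5 : ∀ i, q5 i ≤ ∑ i, q5 i := fun i => Finset.single_le_sum (fun _ _ => Nat.zero_le _)
    (Finset.mem_univ i)
  have l7 : ∀ i, q7 i ≤ ∑ i, q7 i := fun i => Finset.single_le_sum (fun _ _ => Nat.zero_le _)
    (Finset.mem_univ i)
  refine ⟨q1 + q2 + (∑ i, q3 i) + q4 + (∑ i, q5 i) + q6 + ∑ i, q7 i, h1.mono (by omega),
    h2.mono (by omega), fun i => (h3 i).mono ((l3 i).trans (by omega)), h4.mono (by omega),
    fun i => (h5 i).mono ((l5 i).trans (by omega)), h6.mono (by omega),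
    fun i => (h7 i).mono ((l7 i).trans (by omega))⟩

end growth

section slices

variable {d n : ℕ} {V : Type*} [NormedAddCommGroup V] {T t : ℝ}

theorem IsAdmissible.continuous_slice {f : ℝ → E d → E n → P2 d → V} (h : IsAdmissible T f)
    (ht : t ∈ Ioo 0 T) : Continuous fun z : E d × E n × P2 d => f t z.1 z.2.1 z.2.2 :=
  h.1.comp_continuous (f := fun z : E d × E n × P2 d => (t, z.1, z.2.1, z.2.2)) (by fun_prop)
    fun _ => ⟨ht, mem_univ _⟩

theorem IsAdmissible'.continuous_slice {f : ℝ → E d → E n → P2 d → E d → V}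
    (h : IsAdmissible' T f) (ht : t ∈ Ioo 0 T) :
    Continuous fun z : E d × E n × P2 d × E d => f t z.1 z.2.1 z.2.2.1 z.2.2.2 :=
  h.1.comp_continuous (f := fun z : E d × E n × P2 d × E d => (t, z.1, z.2.1, z.2.2.1, z.2.2.2))
    (by fun_prop) fun _ => ⟨ht, mem_univ _⟩

theorem IsSmooth.continuous_slice {W : ℝ → E d → E n → P2 d → E d} {J : Jet d n}
    (hS : IsSmooth T W J) (ht : t ∈ Ico 0 T) :
    Continuous fun z : E d × E n × P2 d => W t z.1 z.2.1 z.2.2 :=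
  hS.continuousOn.comp_continuous (f := fun z : E d × E n × P2 d => (t, z.1, z.2.1, z.2.2))
    (by fun_prop) fun _ => ⟨ht, mem_univ _⟩

theorem IsSmooth.continuous_x {W : ℝ → E d → E n → P2 d → E d} {J : Jet d n}
    (hS : IsSmooth T W J) (ht : t ∈ Ico 0 T) (θ : E n) (m : P2 d) :
    Continuous fun x => W t x θ m :=
  (hS.continuous_slice ht).comp (f := fun x => (x, θ, m)) (by fun_prop)

end slices

section generators

variable {Ω : Type*} {d n : ℕ} {T t : ℝ} {W : ℝ → E d → E n → P2 d → E d} {J : Jet d n} {q : ℕ}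

theorem le_sqrt_of_mem_Ioc {h : ℝ} (hh : h ∈ Ioc (0 : ℝ) 1) : h ≤ Real.sqrt h :=
  Real.le_sqrt_of_sq_le (by nlinarith [hh.1, hh.2])

/-- The generator of the displacement with velocity `V`. -/
theorem IsSmooth.isGenerator_drift (hS : IsSmooth T W J) (hq : HasDegree T J q)
    (ht : t ∈ Ioo 0 T) (θ : E n) (V : Ω → E d) :
    ∃ C, IsGenerator (fun x m => W t x θ m) (fun x m => J.flat t x θ m) V
      (fun h ω => h • V ω) (fun h ω => h • V ω) (fun ω x m => J.dx t x θ m (V ω))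
      (fun ω x m y => J.dm t x θ m y (V ω)) C q := by
  obtain ⟨C1, hC1, H1⟩ := hq.dx.at_time ht ‖θ‖
  obtain ⟨C2, hC2, H2⟩ := hq.dm.at_time ht ‖θ‖
  have half : ∀ u v : E d, (1 / 2 : ℝ) • (u + u) - v = u - v := fun u v => by module
  have hn : ∀ h ∈ Ioc (0 : ℝ) 1, ∀ ω, ‖h • V ω‖ ≤ Real.sqrt h * ‖V ω‖ := fun h hh ω => by
    rw [norm_smul, Real.norm_of_nonneg hh.1.le]
    gcongr
    exact le_sqrt_of_mem_Ioc hh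
  refine ⟨C1 + C2, ?_, ?_, hn, hn, ?_, ?_, ?_, ?_, by positivity, ?_, ?_⟩
  · exact fun x m => hS.hasDeriv_m t ht x θ m
  · exact (hS.continuous_slice ⟨ht.1.le, ht.2⟩).comp (f := fun z : E d × P2 d => (z.1, θ, z.2))
      (by fun_prop)
  · intro h hh ω r m x
    obtain ⟨ζ, h1, h2⟩ := exists_inner_sub_eq (fun y => hS.hasDeriv_x t ht y θ m) r x (V ω) hh.1
    refine ⟨ζ, h1.trans ?_, by rw [half]; exact h2⟩
    gcongr
    exact le_sqrt_of_mem_Ioc hh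
  · intro h hh ω r x m y
    obtain ⟨ζ, h1, h2⟩ := exists_inner_sub_eq (fun y => hS.hasDeriv_my t ht x θ m y) r y (V ω) hh.1
    refine ⟨ζ, h1.trans ?_, by rw [half]; exact h2⟩
    gcongr
    exact le_sqrt_of_mem_Ioc hh
  · intro ω
    exact ((hS.admissible_dx.continuous_slice ht).comp
      (f := fun z : E d × P2 d => (z.1, θ, z.2)) (by fun_prop)).clm_apply continuous_const
  · intro ω x
    exact ((hS.admissible_dm.continuous_slice ht).comp
      (f := fun z : P2 d × E d => (x, θ, z.1, z.2)) (by fun_prop)).clm_apply continuous_const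
  · intro ω x m
    have h1 := H1 x θ m 0 le_rfl
    have hm := m.moment_nonneg
    simp only [norm_zero, add_zero] at h1
    calc _ ≤ ‖J.dx t x θ m‖ * ‖V ω‖ := ContinuousLinearMap.le_opNorm _ _
      _ ≤ (C1 + C2) * (1 + ‖x‖ + m.moment) ^ q * (1 + ‖V ω‖) := by
        gcongr
        · refine h1.trans ?_
          gcongr
          linarith
        · linarith
      _ = _ := by ring
  · intro ω x m y
    have h1 := H2 x θ m y le_rfl
    have hm := m.moment_nonneg
    calc _ ≤ ‖J.dm t x θ m y‖ * ‖V ω‖ := ContinuousLinearMap.le_opNorm _ _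
      _ ≤ (C1 + C2) * (1 + ‖x‖ + m.moment + ‖y‖) ^ q * (1 + ‖V ω‖) := by
        gcongr
        · refine h1.trans ?_
          gcongr
          linarith
        · linarith
      _ = _ := by ring

/-- The generator of the symmetric displacement of size `√h` along the `i`-th coordinate axis. -/
theorem IsSmooth.isGenerator_noise (hS : IsSmooth T W J) (hq : HasDegree T J q)
    (ht : t ∈ Ioo 0 T) (θ : E n) (i : Fin d) :
    ∃ C, IsGenerator (Ω := Ω) (fun x m => W t x θ m) (fun x m => J.flat t x θ m)
      (fun _ => basisVec i) (fun h _ => Real.sqrt h • basisVec i)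
      (fun h _ => (-Real.sqrt h) • basisVec i)
      (fun _ x m => (1 / 2 : ℝ) • J.dxx t x θ m i (basisVec i))
      (fun _ x m y => (1 / 2 : ℝ) • J.dmy t x θ m y i (basisVec i)) C q := by
  obtain ⟨C1, hC1, H1⟩ := (hq.dxx i).at_time ht ‖θ‖
  obtain ⟨C2, hC2, H2⟩ := (hq.dmy i).at_time ht ‖θ‖
  have he : ‖(basisVec i : E d)‖ = 1 := by simp
  refine ⟨C1 + C2, ?_, ?_, ?_, ?_, ?_, ?_, ?_, ?_, by positivity, ?_, ?_⟩
  · exact fun x m => hS.hasDeriv_m t ht x θ m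
  · exact (hS.continuous_slice ⟨ht.1.le, ht.2⟩).comp (f := fun z : E d × P2 d => (z.1, θ, z.2))
      (by fun_prop)
  · intro h hh ω
    rw [norm_smul, Real.norm_of_nonneg (Real.sqrt_nonneg _)]
  · intro h hh ω
    rw [norm_smul, norm_neg, Real.norm_of_nonneg (Real.sqrt_nonneg _)]
  · intro h hh ω r m x
    obtain ⟨ζ, h1, h2⟩ := exists_inner_symm_eq (fun y => hS.hasDeriv_x t ht y θ m)
      (fun y => hS.hasDeriv_xx t ht y θ m i) r x (Real.sqrt_pos.2 hh.1)
    rw [Real.sq_sqrt hh.1.le] at h2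
    exact ⟨ζ, h1, h2⟩
  · intro h hh ω r x m y
    obtain ⟨ζ, h1, h2⟩ := exists_inner_symm_eq (fun y => hS.hasDeriv_my t ht x θ m y)
      (fun y => hS.hasDeriv_myy t ht x θ m y i) r y (Real.sqrt_pos.2 hh.1)
    rw [Real.sq_sqrt hh.1.le] at h2
    exact ⟨ζ, h1, h2⟩
  · intro ω
    have h1 : Continuous fun z : E d × P2 d => J.dxx t z.1 θ z.2 i (basisVec i) :=
      (((hS.admissible_dxx i).continuous_slice ht).comp
        (f := fun z : E d × P2 d => (z.1, θ, z.2)) (by fun_prop)).clm_apply continuous_const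
    exact h1.const_smul (1 / 2 : ℝ)
  · intro ω x
    have h1 : Continuous fun z : P2 d × E d => J.dmy t x θ z.1 z.2 i (basisVec i) :=
      (((hS.admissible_dmy i).continuous_slice ht).comp
        (f := fun z : P2 d × E d => (x, θ, z.1, z.2)) (by fun_prop)).clm_apply continuous_const
    exact h1.const_smul (1 / 2 : ℝ)
  · intro ω x m
    have h1 := H1 x θ m 0 le_rfl
    have hm := m.moment_nonneg
    have h2 := ContinuousLinearMap.le_opNorm (J.dxx t x θ m i) (basisVec i)
    simp only [norm_zero, add_zero] at h1
    rw [norm_smul]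
    rw [he] at h2 ⊢
    have h3 : 0 ≤ (1 + ‖x‖ + m.moment) ^ q := by positivity
    norm_num
    nlinarith [norm_nonneg (J.dxx t x θ m i (basisVec i)), mul_nonneg hC1 h3, mul_nonneg hC2 h3]
  · intro ω x m y
    have h1 := H2 x θ m y le_rfl
    have hm := m.moment_nonneg
    have h2 := ContinuousLinearMap.le_opNorm (J.dmy t x θ m y i) (basisVec i)
    rw [norm_smul]
    rw [he] at h2 ⊢
    have h3 : 0 ≤ (1 + ‖x‖ + m.moment + ‖y‖) ^ q := by positivity
    norm_num
    nlinarith [norm_nonneg (J.dmy t x θ m y i (basisVec i)), mul_nonneg hC1 h3, mul_nonneg hC2 h3]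

end generators

/-! ### Displacing the variable: drift and noise -/

section

variable {Ω : Type*} [MeasurableSpace Ω] {P : Measure Ω} [IsProbabilityMeasure P] {d n : ℕ}
  {X V R : Ω → E d} {q : ℕ}

theorem MemLp.two_of_natCast {p : ℕ} (hp : 2 ≤ p) {F : Type*} [NormedAddCommGroup F] {f : Ω → F}
    (hf : MemLp f p P) : MemLp f 2 P :=
  hf.mono_exponent (by exact_mod_cast hp)

theorem norm_inner_growth_le {Ω : Type*} {X V R : Ω → E d} {C c : ℝ} (hC : 0 ≤ C) (hc : 0 ≤ c)
    {g : Ω → E d} {ω : Ω}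
    (hb : ‖g ω‖ ≤ C * (1 + ‖V ω‖) * (1 + ‖X ω‖ + c) ^ q) :
    ‖inner ℝ (R ω) (g ω)‖ ≤ C * (1 + ‖X ω‖ + ‖V ω‖ + ‖R ω‖ + ‖c‖) ^ (q + 2) := by
  have hX0 := norm_nonneg (X ω)
  have hV0 := norm_nonneg (V ω)
  have hR0 := norm_nonneg (R ω)
  rw [Real.norm_of_nonneg hc]
  set N := 1 + ‖X ω‖ + ‖V ω‖ + ‖R ω‖ + c with hN
  calc _ ≤ ‖R ω‖ * ‖g ω‖ := norm_inner_le_norm _ _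
    _ ≤ ‖R ω‖ * (C * (1 + ‖V ω‖) * (1 + ‖X ω‖ + c) ^ q) := by gcongr
    _ ≤ N * (C * N * N ^ q) := by gcongr ?_ * (C * ?_ * ?_ ^ q) <;> linarith
    _ = C * N ^ (q + 2) := by ring

theorem integrable_inner_growth (hX : MemLp X (q + 2 : ℕ) P) (hV : MemLp V (q + 2 : ℕ) P)
    (hR : MemLp R (q + 2 : ℕ) P) {C c : ℝ} (hC : 0 ≤ C) (hc : 0 ≤ c) {g : Ω → E d}
    (hg : AEStronglyMeasurable g P)
    (hb : ∀ ω, ‖g ω‖ ≤ C * (1 + ‖V ω‖) * (1 + ‖X ω‖ + c) ^ q) :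
    Integrable (fun ω => inner ℝ (R ω) (g ω)) P :=
  ((integrable_weight_pow (by omega) hX hV hR c).const_mul C).mono' (hR.1.inner hg)
    (Eventually.of_forall fun ω => norm_inner_growth_le hC hc (hb ω))

/-- Dominated convergence for weighted means of difference quotients. -/
theorem tendsto_integral_quotient (hX : MemLp X (q + 2 : ℕ) P) (hR : MemLp R (q + 2 : ℕ) P)
    {δ C c : ℝ} (hδ : 0 < δ) (hC : 0 ≤ C) (hc : 0 ≤ c) {u : ℝ → Ω → E d} {g : Ω → E d}
    (hu : ∀ h ∈ Ioc (0 : ℝ) δ, AEStronglyMeasurable (u h) P)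
    (hk : ∀ ω, ∃ k : ℝ → E d, Tendsto k (𝓝[>] 0) (𝓝 (g ω)) ∧ ∀ h ∈ Ioc (0 : ℝ) δ,
      ‖k h‖ ≤ C * (1 + ‖X ω‖ + c) ^ q ∧ inner ℝ (R ω) (u h ω) = h * inner ℝ (R ω) (k h)) :
    Tendsto (fun h => h⁻¹ * ∫ ω, inner ℝ (R ω) (u h ω) ∂P) (𝓝[>] 0)
      (𝓝 (∫ ω, inner ℝ (R ω) (g ω) ∂P)) := by
  simp only [← integral_const_mul]
  have hb : ∀ h ∈ Ioc (0 : ℝ) δ, ∀ ω, ‖h⁻¹ * inner ℝ (R ω) (u h ω)‖ ≤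
      C * (1 + ‖X ω‖ + ‖X ω‖ + ‖R ω‖ + ‖c‖) ^ (q + 2) := fun h hh ω => by
    obtain ⟨k, -, hk⟩ := hk ω
    obtain ⟨h1, h2⟩ := hk h hh
    rw [h2, inv_mul_cancel_left₀ hh.1.ne']
    refine norm_inner_growth_le (g := fun _ => k h) hC hc (h1.trans ?_)
    have : 0 ≤ (1 + ‖X ω‖ + c) ^ q := by positivity
    rw [mul_assoc]
    refine mul_le_mul_of_nonneg_left ?_ hC
    nlinarith [norm_nonneg (X ω)]
  refine tendsto_integral_filter_of_dominated_convergence _ ?_ ?_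
    ((integrable_weight_pow (by omega) hX hX hR c).const_mul C) ?_
  · filter_upwards [Ioc_mem_nhdsGT hδ] with h hh
    exact (hR.1.inner (hu h hh)).const_mul _
  · filter_upwards [Ioc_mem_nhdsGT hδ] with h hh
    exact Eventually.of_forall (hb h hh)
  · refine Eventually.of_forall fun ω => ?_
    obtain ⟨k, hkt, hk⟩ := hk ω
    refine (tendsto_const_nhds.inner hkt).congr' ?_
    filter_upwards [Ioc_mem_nhdsGT hδ] with h hh
    rw [(hk h hh).2, inv_mul_cancel_left₀ hh.1.ne']

theorem integrable_inner_generator {w : E d → P2 d → E d} {flat : E d → P2 d → E d → E d}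
    {a b : ℝ → Ω → E d} {Lw : Ω → E d → P2 d → E d} {Lm : Ω → E d → P2 d → E d → E d} {C : ℝ}
    (hG : IsGenerator w flat V a b Lw Lm C q) (hX : MemLp X (q + 2 : ℕ) P)
    (hV : MemLp V (q + 2 : ℕ) P) (hR : MemLp R (q + 2 : ℕ) P) (hX2 : MemLp X 2 P)
    (hLw : AEStronglyMeasurable (fun ω => Lw ω (X ω) (law hX2)) P)
    (hLm : AEStronglyMeasurable (fun z : Ω × Ω => Lm z.2 (X z.1) (law hX2) (X z.2)) (P.prod P)) :
    Integrable (fun ω => inner ℝ (R ω)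
      (Lw ω (X ω) (law hX2) + ∫ ω', Lm ω' (X ω) (law hX2) (X ω') ∂P)) P := by
  have hC := hG.C_nonneg
  have hV2 := MemLp.two_of_natCast (by omega) hV
  have hB := momentBound_nonneg (P := P) (X := X) (V := V)
  have hK := growthConst_nonneg (P := P) (X := X) (V := V) (q := q)
  have hm := moment_law_le_momentBound hX2 hV2 hX2 fun ω => le_add_of_nonneg_right (norm_nonneg _)
  have hm0 := (law hX2).moment_nonneg
  refine integrable_inner_growth hX hV hR (C := C * (1 + growthConst P X V q)) (by positivity) hB
    (hLw.add hLm.integral_prod_right') fun ω => ?_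
  have h1 : ‖Lw ω (X ω) (law hX2)‖ ≤
      C * (1 + ‖V ω‖) * (1 + ‖X ω‖ + momentBound P X V) ^ q := by
    refine (hG.norm_Lw _ _ _).trans ?_
    gcongr
  have h2 : ‖∫ ω', Lm ω' (X ω) (law hX2) (X ω') ∂P‖ ≤
      C * (1 + ‖X ω‖) ^ q * growthConst P X V q := by
    rw [growthConst, ← integral_const_mul]
    refine norm_integral_le_of_norm_le ((integrable_growth hX hV).const_mul _)
      (Eventually.of_forall fun ω' => ?_)
    calc _ ≤ C * (1 + ‖V ω'‖) * (1 + ‖X ω‖ + (law hX2).moment + ‖X ω'‖) ^ q := hG.norm_Lm _ _ _ _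
      _ ≤ C * (1 + ‖V ω'‖) * (1 + ‖X ω‖ + (momentBound P X V + ‖X ω'‖ + ‖V ω'‖)) ^ q := by
        gcongr C * (1 + ‖V ω'‖) * ?_ ^ q
        linarith [norm_nonneg (V ω')]
      _ ≤ C * (1 + ‖V ω'‖) * ((1 + ‖X ω‖) ^ q *
          (1 + (momentBound P X V + ‖X ω'‖ + ‖V ω'‖)) ^ q) := by
        gcongr
        exact one_add_add_pow_le (norm_nonneg _) (by positivity) q
      _ = _ := by ring
  have h3 : C * (1 + ‖X ω‖) ^ q * growthConst P X V q ≤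
      C * growthConst P X V q * ((1 + ‖V ω‖) * (1 + ‖X ω‖ + momentBound P X V) ^ q) := by
    have e : (1 + ‖X ω‖) ^ q ≤ (1 + ‖X ω‖ + momentBound P X V) ^ q := by
      exact pow_le_pow_left₀ (by positivity) (by linarith) q
    have e2 : 0 ≤ (1 + ‖X ω‖ + momentBound P X V) ^ q := by positivity
    calc _ = C * growthConst P X V q * (1 * (1 + ‖X ω‖) ^ q) := by ring
      _ ≤ _ := by
        gcongr
        linarith [norm_nonneg (V ω)]
  refine (norm_add_le _ _).trans ((add_le_add h1 (h2.trans h3)).trans (le_of_eq ?_))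
  ring

variable {T t : ℝ} {W : ℝ → E d → E n → P2 d → E d} {J : Jet d n}

/-- The generator of the displacement with velocity `V`, applied to `W(t, ·, θ, ·)` at `X`. -/
def driftGen (J : Jet d n) (t : ℝ) (θ : E n) (V : Ω → E d) (hX : MemLp X 2 P) (ω : Ω) : E d :=
  J.dx t (X ω) θ (law hX) (V ω) + ∫ ω', J.dm t (X ω) θ (law hX) (X ω') (V ω') ∂P

/-- The generator of the noise along the `i`-th axis, applied to `W(t, ·, θ, ·)` at `X`. -/
def noiseGen (J : Jet d n) (t : ℝ) (θ : E n) (i : Fin d) (hX : MemLp X 2 P) (ω : Ω) : E d :=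
  (1 / 2 : ℝ) • J.dxx t (X ω) θ (law hX) i (basisVec i) +
    ∫ ω', (1 / 2 : ℝ) • J.dmy t (X ω) θ (law hX) (X ω') i (basisVec i) ∂P

theorem aestronglyMeasurable_clm_apply {α : Type*} [MeasurableSpace α] {μ : Measure α}
    {F G : Type*} [NormedAddCommGroup F] [NormedSpace ℝ F] [NormedAddCommGroup G] [NormedSpace ℝ G]
    {A : α → F →L[ℝ] G} {v : α → F} (hA : AEStronglyMeasurable A μ)
    (hv : AEStronglyMeasurable v μ) : AEStronglyMeasurable (fun x => A x (v x)) μ :=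
  isBoundedBilinearMap_apply.continuous.comp_aestronglyMeasurable (hA.prodMk hv)

theorem IsSmooth.aestronglyMeasurable_dx {P : Measure Ω} (hS : IsSmooth T W J) (ht : t ∈ Ioo 0 T)
    (θ : E n) (m : P2 d) (hX : AEStronglyMeasurable X P) :
    AEStronglyMeasurable (fun ω => J.dx t (X ω) θ m) P :=
  ((hS.admissible_dx.continuous_slice ht).comp
    (f := fun x : E d => (x, θ, m)) (by fun_prop)).comp_aestronglyMeasurable hX

theorem IsSmooth.aestronglyMeasurable_dxx {P : Measure Ω} (hS : IsSmooth T W J) (ht : t ∈ Ioo 0 T)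
    (θ : E n) (m : P2 d) (i : Fin d) (hX : AEStronglyMeasurable X P) :
    AEStronglyMeasurable (fun ω => J.dxx t (X ω) θ m i) P :=
  (((hS.admissible_dxx i).continuous_slice ht).comp
    (f := fun x : E d => (x, θ, m)) (by fun_prop)).comp_aestronglyMeasurable hX

theorem IsSmooth.aestronglyMeasurable_dm {α : Type*} [MeasurableSpace α] {μ : Measure α}
    (hS : IsSmooth T W J) (ht : t ∈ Ioo 0 T) (θ : E n) (m : P2 d) {X Y : α → E d}
    (hX : AEStronglyMeasurable X μ) (hY : AEStronglyMeasurable Y μ) :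
    AEStronglyMeasurable (fun ω => J.dm t (X ω) θ m (Y ω)) μ :=
  ((hS.admissible_dm.continuous_slice ht).comp
    (f := fun x : E d × E d => (x.1, θ, m, x.2)) (by fun_prop)).comp_aestronglyMeasurable
      (hX.prodMk hY)

theorem IsSmooth.aestronglyMeasurable_dmy {α : Type*} [MeasurableSpace α] {μ : Measure α}
    (hS : IsSmooth T W J) (ht : t ∈ Ioo 0 T) (θ : E n) (m : P2 d) (i : Fin d) {X Y : α → E d}
    (hX : AEStronglyMeasurable X μ) (hY : AEStronglyMeasurable Y μ) :
    AEStronglyMeasurable (fun ω => J.dmy t (X ω) θ m (Y ω) i) μ :=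
  (((hS.admissible_dmy i).continuous_slice ht).comp
    (f := fun x : E d × E d => (x.1, θ, m, x.2)) (by fun_prop)).comp_aestronglyMeasurable
      (hX.prodMk hY)

theorem IsSmooth.integrable_driftGen (hS : IsSmooth T W J) (hq : HasDegree T J q)
    (ht : t ∈ Ioo 0 T) (θ : E n) (hX : MemLp X (q + 2 : ℕ) P) (hV : MemLp V (q + 2 : ℕ) P)
    (hR : MemLp R (q + 2 : ℕ) P) (hX2 : MemLp X 2 P) :
    Integrable (fun ω => inner ℝ (R ω) (driftGen J t θ V hX2 ω)) P := by
  obtain ⟨C, hG⟩ := hS.isGenerator_drift hq ht θ V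
  exact integrable_inner_generator hG hX hV hR hX2
    (aestronglyMeasurable_clm_apply (hS.aestronglyMeasurable_dx ht θ _ hX.1) hV.1)
    (aestronglyMeasurable_clm_apply (hS.aestronglyMeasurable_dm ht θ _ hX.1.comp_fst hX.1.comp_snd)
      hV.1.comp_snd)

theorem IsSmooth.integrable_noiseGen (hS : IsSmooth T W J) (hq : HasDegree T J q)
    (ht : t ∈ Ioo 0 T) (θ : E n) (i : Fin d) (hX : MemLp X (q + 2 : ℕ) P)
    (hR : MemLp R (q + 2 : ℕ) P) (hX2 : MemLp X 2 P) :
    Integrable (fun ω => inner ℝ (R ω) (noiseGen J t θ i hX2 ω)) P := by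
  obtain ⟨C, hG⟩ := hS.isGenerator_noise (Ω := Ω) hq ht θ i
  exact integrable_inner_generator hG hX (memLp_const _) hR hX2
    ((aestronglyMeasurable_clm_apply (hS.aestronglyMeasurable_dxx ht θ _ i hX.1)
      aestronglyMeasurable_const).const_smul (1 / 2 : ℝ))
    ((aestronglyMeasurable_clm_apply (hS.aestronglyMeasurable_dmy ht θ _ i hX.1.comp_fst
      hX.1.comp_snd) aestronglyMeasurable_const).const_smul (1 / 2 : ℝ))

theorem P2.mix_self (m : P2 d) (e : Icc (0 : ℝ) 1) : P2.mix m m e = m := by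
  refine P2.ext_toMeasure ?_
  rw [P2.mix_toMeasure, ← add_smul, P2.ofReal_one_sub_add, one_smul]

/-- Derivative of `W` when the variable `X`, and with it the law, moves along `V`. -/
theorem IsSmooth.tendsto_drift (hS : IsSmooth T W J) (hq : HasDegree T J q)
    (ht : t ∈ Ioo 0 T) (θ : E n) (hX : MemLp X (q + 2 : ℕ) P) (hV : MemLp V (q + 2 : ℕ) P)
    (hR : MemLp R (q + 2 : ℕ) P) (hX2 : MemLp X 2 P)
    (hXV : ∀ h : ℝ, MemLp (fun ω => X ω + h • V ω) 2 P) :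
    Tendsto (fun h => h⁻¹ * ∫ ω, inner ℝ (R ω) (W t (X ω + h • V ω) θ (law (hXV h)) -
      W t (X ω) θ (law hX2)) ∂P) (𝓝[>] 0)
      (𝓝 (∫ ω, inner ℝ (R ω) (driftGen J t θ V hX2 ω) ∂P)) := by
  obtain ⟨C, hG⟩ := hS.isGenerator_drift hq ht θ V
  have := tendsto_integral_step hG hX hV hR hX2 (MemLp.two_of_natCast (by omega) hV) hXV hXV
    fun x => aestronglyMeasurable_clm_apply
      (hS.aestronglyMeasurable_dm ht θ _ aestronglyMeasurable_const hX.1) hV.1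
  have half : ∀ u v : E d, (1 / 2 : ℝ) • (u + u) - v = u - v := fun u v => by module
  simp only [half, stepLaw, P2.mix_self] at this
  exact this

/-- Generator of a noise of size `√h` in the direction `i`, felt by the variable and by its law.
The law of the displaced variable is the even mixture `stepLaw` of the two translates. -/
theorem IsSmooth.tendsto_noise (hS : IsSmooth T W J) (hq : HasDegree T J q)
    (ht : t ∈ Ioo 0 T) (θ : E n) (i : Fin d) (hX : MemLp X (q + 2 : ℕ) P)
    (hR : MemLp R (q + 2 : ℕ) P) (hX2 : MemLp X 2 P)
    (hXa : ∀ h : ℝ, MemLp (fun ω => X ω + Real.sqrt h • basisVec i) 2 P)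
    (hXb : ∀ h : ℝ, MemLp (fun ω => X ω + (-Real.sqrt h) • basisVec i) 2 P) :
    Tendsto (fun h => h⁻¹ * ∫ ω, inner ℝ (R ω) ((1 / 2 : ℝ) •
      (W t (X ω + Real.sqrt h • basisVec i) θ (stepLaw hXa hXb h) +
      W t (X ω + (-Real.sqrt h) • basisVec i) θ (stepLaw hXa hXb h)) -
      W t (X ω) θ (law hX2)) ∂P) (𝓝[>] 0)
      (𝓝 (∫ ω, inner ℝ (R ω) (noiseGen J t θ i hX2 ω) ∂P)) := by
  obtain ⟨C, hG⟩ := hS.isGenerator_noise (Ω := Ω) hq ht θ i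
  exact tendsto_integral_step hG hX (memLp_const _) hR hX2 (memLp_const _) hXa hXb
    fun x => ((aestronglyMeasurable_clm_apply (hS.aestronglyMeasurable_dmy ht θ _ i
      aestronglyMeasurable_const hX.1) aestronglyMeasurable_const).const_smul (1 / 2 : ℝ))

end

/-! ### Varying time and parameter -/

section

variable {Ω : Type*} [MeasurableSpace Ω] {P : Measure Ω} [IsProbabilityMeasure P] {d n : ℕ}
  {X V R : Ω → E d} {q : ℕ} {T t : ℝ} {W : ℝ → E d → E n → P2 d → E d} {J : Jet d n}

theorem Ioo_subset_Ico_of_mem (ht : t ∈ Ioo 0 T) : t ∈ Ico 0 T := ⟨ht.1.le, ht.2⟩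

/-- Backward time derivative of `W`, integrated along a random vector. -/
theorem IsSmooth.tendsto_time (hS : IsSmooth T W J) (hq : HasDegree T J q)
    (ht : t ∈ Ioo 0 T) (θ : E n) (m : P2 d) (hX : MemLp X (q + 2 : ℕ) P)
    (hR : MemLp R (q + 2 : ℕ) P) :
    Tendsto (fun h => h⁻¹ * ∫ ω, inner ℝ (R ω) (W (t - h) (X ω) θ m - W t (X ω) θ m) ∂P) (𝓝[>] 0)
      (𝓝 (∫ ω, inner ℝ (R ω) (-J.dt t (X ω) θ m) ∂P)) := by
  have ht0 := ht.1
  obtain ⟨C, hC, H⟩ := hq.dt (t / 2) t (by linarith) ht.2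
  have hm := m.moment_nonneg
  have hδ : ∀ h ∈ Ioc (0 : ℝ) (t / 2), ∀ s ∈ Icc (t - h) t, s ∈ Ioo 0 T := fun h hh s hs =>
    ⟨by linarith [hh.2, hs.1], hs.2.trans_lt ht.2⟩
  refine tendsto_integral_quotient (δ := t / 2) (c := ‖θ‖ + m.moment) hX hR (by linarith) hC
    (by positivity) (fun h hh => ?_) fun ω => ?_
  · have h1 := hS.continuous_x
      (Ioo_subset_Ico_of_mem (hδ h hh (t - h) ⟨le_rfl, by linarith [hh.1]⟩))
      θ m
    exact (h1.comp_aestronglyMeasurable hX.1).sub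
      ((hS.continuous_x (Ioo_subset_Ico_of_mem ht) θ m).comp_aestronglyMeasurable hX.1)
  · have hz : ∀ h : ℝ, ∃ s, h ∈ Ioc (0 : ℝ) (t / 2) → s ∈ Ioo (t - h) t ∧
        inner ℝ (R ω) (W (t - h) (X ω) θ m - W t (X ω) θ m) =
          h * inner ℝ (R ω) (-J.dt s (X ω) θ m) := fun h => by
      by_cases hh : h ∈ Ioc (0 : ℝ) (t / 2)
      · have hd : ∀ s ∈ Icc (t - h) t, HasDerivAt (fun s => inner ℝ (R ω) (W s (X ω) θ m))
            (inner ℝ (R ω) (J.dt s (X ω) θ m)) s := fun s hs =>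
          (innerSL ℝ (R ω)).hasFDerivAt.comp_hasDerivAt s
            (hS.hasDeriv_t s (hδ h hh s hs) (X ω) θ m)
        obtain ⟨s, hs, e⟩ := exists_hasDerivAt_eq_slope _ _ (by linarith [hh.1] : t - h < t)
          (fun s hs => (hd s hs).continuousAt.continuousWithinAt)
          (fun s hs => hd s (Ioo_subset_Icc_self hs))
        refine ⟨s, fun _ => ⟨hs, ?_⟩⟩
        rw [inner_neg_right, e, sub_sub_cancel, inner_sub_right]
        have := hh.1.ne'
        field_simp
        ring
      · exact ⟨0, fun h => absurd h hh⟩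
    choose s hs using hz
    refine ⟨fun h => -J.dt (s h) (X ω) θ m, ?_, fun h hh => ⟨?_, (hs h hh).2⟩⟩
    · have hc : ContinuousAt (fun s => J.dt s (X ω) θ m) t := by
        have h1 : ContinuousOn (fun s => J.dt s (X ω) θ m) (Ioo 0 T) :=
          hS.admissible_dt.1.comp (f := fun s => (s, X ω, θ, m)) (by fun_prop)
            fun s hs => ⟨hs, mem_univ _⟩
        exact h1.continuousAt (Ioo_mem_nhds ht.1 ht.2)
      refine (hc.tendsto.comp ?_).neg
      have h0 : Tendsto (fun h : ℝ => t - h) (𝓝[>] 0) (𝓝 t) := by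
        have : Tendsto (fun h : ℝ => t - h) (𝓝 0) (𝓝 (t - 0)) :=
          (continuous_const.sub continuous_id).tendsto 0
        rw [sub_zero] at this
        exact this.mono_left nhdsWithin_le_nhds
      refine tendsto_of_tendsto_of_tendsto_of_le_of_le' h0 tendsto_const_nhds ?_ ?_
      · filter_upwards [Ioc_mem_nhdsGT (by linarith : 0 < t / 2)] with h hh
        exact (hs h hh).1.1.le
      · filter_upwards [Ioc_mem_nhdsGT (by linarith : 0 < t / 2)] with h hh
        exact (hs h hh).1.2.le
    · rw [norm_neg]
      have h1 := (hs h hh).1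
      refine (H (s h) ⟨by linarith [h1.1, hh.2], h1.2.le⟩ (X ω) θ m 0).trans (le_of_eq ?_)
      simp only [norm_zero]
      ring

theorem IsSmooth.continuous_θ (hS : IsSmooth T W J) (ht : t ∈ Ioo 0 T) (x : E d) (m : P2 d) :
    Continuous fun θ => J.dθ t x θ m :=
  (hS.admissible_dθ.continuous_slice ht).comp (f := fun θ => (x, θ, m)) (by fun_prop)

/-- Derivative of `W` in the parameter, integrated along a random vector. -/
theorem IsSmooth.tendsto_param (hS : IsSmooth T W J) (hq : HasDegree T J q)
    (ht : t ∈ Ioo 0 T) (θ v : E n) (m : P2 d) (hX : MemLp X (q + 2 : ℕ) P)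
    (hR : MemLp R (q + 2 : ℕ) P) :
    Tendsto (fun h => h⁻¹ * ∫ ω, inner ℝ (R ω) (W t (X ω) (θ + h • v) m - W t (X ω) θ m) ∂P)
      (𝓝[>] 0) (𝓝 (∫ ω, inner ℝ (R ω) (J.dθ t (X ω) θ m v) ∂P)) := by
  obtain ⟨C, hC, H⟩ := hq.dθ.at_time ht (‖θ‖ + ‖v‖)
  refine tendsto_integral_quotient (δ := 1) (C := C * ‖v‖) hX hR one_pos (by positivity)
    m.moment_nonneg (fun h hh => ?_) fun ω => ?_
  · exact ((hS.continuous_x (Ioo_subset_Ico_of_mem ht) _ m).comp_aestronglyMeasurable hX.1).sub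
      ((hS.continuous_x (Ioo_subset_Ico_of_mem ht) θ m).comp_aestronglyMeasurable hX.1)
  · have hz : ∀ h : ℝ, ∃ ζ : E n, h ∈ Ioc (0 : ℝ) 1 → ‖ζ‖ ≤ h * ‖v‖ ∧
        inner ℝ (R ω) (W t (X ω) (θ + h • v) m - W t (X ω) θ m) =
          h * inner ℝ (R ω) (J.dθ t (X ω) (θ + ζ) m v) := fun h => by
      by_cases hh : h ∈ Ioc (0 : ℝ) 1
      · obtain ⟨ζ, hζ⟩ := exists_inner_sub_eq (fun θ => hS.hasDeriv_θ t ht (X ω) θ m) (R ω) θ v hh.1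
        exact ⟨ζ, fun _ => hζ⟩
      · exact ⟨0, fun h => absurd h hh⟩
    choose ζ hζ using hz
    have hζ0 : Tendsto ζ (𝓝[>] 0) (𝓝 0) := tendsto_of_norm_le_sqrt fun h hh =>
      ((hζ h hh).1.trans (mul_le_mul_of_nonneg_right (le_sqrt_of_mem_Ioc hh) (norm_nonneg v)))
    refine ⟨fun h => J.dθ t (X ω) (θ + ζ h) m v, ?_, fun h hh => ⟨?_, (hζ h hh).2⟩⟩
    · have hy : Tendsto (fun h => θ + ζ h) (𝓝[>] 0) (𝓝 θ) := by simpa using hζ0.const_add θ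
      exact (((hS.continuous_θ ht (X ω) m).clm_apply continuous_const).tendsto θ).comp hy
    · have h1 := H (X ω) (θ + ζ h) m 0 ((norm_add_le _ _).trans (add_le_add_right
        ((hζ h hh).1.trans (mul_le_of_le_one_left (norm_nonneg v) hh.2)) _))
      rw [norm_zero, add_zero] at h1
      calc _ ≤ ‖J.dθ t (X ω) (θ + ζ h) m‖ * ‖v‖ := ContinuousLinearMap.le_opNorm _ _
        _ ≤ C * (1 + ‖X ω‖ + m.moment) ^ q * ‖v‖ := by gcongr
        _ = _ := by ring

/-- Second symmetric difference quotient of `W` in the parameter, integrated along a random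
vector. -/
theorem IsSmooth.tendsto_param_noise (hS : IsSmooth T W J) (hq : HasDegree T J q)
    (ht : t ∈ Ioo 0 T) (θ : E n) (j : Fin n) (m : P2 d) (hX : MemLp X (q + 2 : ℕ) P)
    (hR : MemLp R (q + 2 : ℕ) P) :
    Tendsto (fun h => h⁻¹ * ∫ ω, inner ℝ (R ω) ((1 / 2 : ℝ) •
        (W t (X ω) (θ + Real.sqrt h • basisVec j) m +
          W t (X ω) (θ + (-Real.sqrt h) • basisVec j) m) - W t (X ω) θ m) ∂P)
      (𝓝[>] 0) (𝓝 (∫ ω, inner ℝ (R ω) ((1 / 2 : ℝ) • J.dθθ t (X ω) θ m j (basisVec j)) ∂P)) := by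
  obtain ⟨C, hC, H⟩ := (hq.dθθ j).at_time ht (‖θ‖ + 1)
  have he : ‖(basisVec j : E n)‖ = 1 := by simp
  refine tendsto_integral_quotient (δ := 1) (C := C) hX hR one_pos (by positivity)
    m.moment_nonneg (fun h hh => ?_) fun ω => ?_
  · exact ((((hS.continuous_x (Ioo_subset_Ico_of_mem ht) _ m).comp_aestronglyMeasurable hX.1).add
      ((hS.continuous_x (Ioo_subset_Ico_of_mem ht) _ m).comp_aestronglyMeasurable hX.1)).const_smul
      (1 / 2 : ℝ)).sub
      ((hS.continuous_x (Ioo_subset_Ico_of_mem ht) θ m).comp_aestronglyMeasurable hX.1)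
  · have hz : ∀ h : ℝ, ∃ ζ : E n, h ∈ Ioc (0 : ℝ) 1 → ‖ζ‖ ≤ Real.sqrt h * ‖(basisVec j : E n)‖ ∧
        inner ℝ (R ω) ((1 / 2 : ℝ) • (W t (X ω) (θ + Real.sqrt h • basisVec j) m +
          W t (X ω) (θ + (-Real.sqrt h) • basisVec j) m) - W t (X ω) θ m) =
          h * inner ℝ (R ω) ((1 / 2 : ℝ) • J.dθθ t (X ω) (θ + ζ) m j (basisVec j)) := fun h => by
      by_cases hh : h ∈ Ioc (0 : ℝ) 1
      · obtain ⟨ζ, h1, h2⟩ := exists_inner_symm_eq (fun θ => hS.hasDeriv_θ t ht (X ω) θ m)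
          (fun θ => hS.hasDeriv_θθ t ht (X ω) θ m j) (R ω) θ (Real.sqrt_pos.2 hh.1)
        rw [Real.sq_sqrt hh.1.le] at h2
        exact ⟨ζ, fun _ => ⟨h1, h2⟩⟩
      · exact ⟨0, fun h => absurd h hh⟩
    choose ζ hζ using hz
    have hζ0 : Tendsto ζ (𝓝[>] 0) (𝓝 0) := tendsto_of_norm_le_sqrt fun h hh => (hζ h hh).1
    refine ⟨fun h => (1 / 2 : ℝ) • J.dθθ t (X ω) (θ + ζ h) m j (basisVec j), ?_,
      fun h hh => ⟨?_, (hζ h hh).2⟩⟩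
    · have hy : Tendsto (fun h => θ + ζ h) (𝓝[>] 0) (𝓝 θ) := by simpa using hζ0.const_add θ
      have hc : Continuous fun θ => J.dθθ t (X ω) θ m j :=
        ((hS.admissible_dθθ j).continuous_slice ht).comp (f := fun θ => (X ω, θ, m)) (by fun_prop)
      exact (((hc.clm_apply continuous_const).tendsto θ).comp hy).const_smul _
    · have h1 := H (X ω) (θ + ζ h) m 0 ((norm_add_le _ _).trans (add_le_add_right
        ((hζ h hh).1.trans (by
          rw [he, mul_one]; exact Real.sqrt_le_one.2 hh.2)) _))
      rw [norm_zero, add_zero] at h1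
      have h2 := ContinuousLinearMap.le_opNorm (J.dθθ t (X ω) (θ + ζ h) m j) (basisVec j)
      rw [he, mul_one] at h2
      rw [norm_smul]
      norm_num
      linarith [norm_nonneg (J.dθθ t (X ω) (θ + ζ h) m j (basisVec j))]

theorem IsSmooth.integrable_dt (hS : IsSmooth T W J) (hq : HasDegree T J q)
    (ht : t ∈ Ioo 0 T) (θ : E n) (m : P2 d) (hX : MemLp X (q + 2 : ℕ) P)
    (hR : MemLp R (q + 2 : ℕ) P) :
    Integrable (fun ω => inner ℝ (R ω) (J.dt t (X ω) θ m)) P := by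
  obtain ⟨C, hC, H⟩ := hq.dt.at_time ht ‖θ‖
  have hV : MemLp (fun _ : Ω => (0 : E d)) (q + 2 : ℕ) P := memLp_const _
  refine integrable_inner_growth hX hV hR hC m.moment_nonneg
    (((hS.admissible_dt.continuous_slice ht).comp
    (f := fun x : E d => (x, θ, m)) (by fun_prop)).comp_aestronglyMeasurable hX.1) fun ω => ?_
  simpa using H (X ω) θ m 0 le_rfl

theorem IsSmooth.integrable_dθ (hS : IsSmooth T W J) (hq : HasDegree T J q)
    (ht : t ∈ Ioo 0 T) (θ v : E n) (m : P2 d) (hX : MemLp X (q + 2 : ℕ) P)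
    (hR : MemLp R (q + 2 : ℕ) P) :
    Integrable (fun ω => inner ℝ (R ω) (J.dθ t (X ω) θ m v)) P := by
  obtain ⟨C, hC, H⟩ := hq.dθ.at_time ht ‖θ‖
  have hV : MemLp (fun _ : Ω => (0 : E d)) (q + 2 : ℕ) P := memLp_const _
  have hc : Continuous fun x => J.dθ t x θ m := (hS.admissible_dθ.continuous_slice ht).comp
    (f := fun x : E d => (x, θ, m)) (by fun_prop)
  refine integrable_inner_growth (C := C * ‖v‖) hX hV hR (by positivity) m.moment_nonneg
    ((hc.clm_apply continuous_const).comp_aestronglyMeasurable hX.1) fun ω => ?_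
  have h1 := H (X ω) θ m 0 le_rfl
  simp only [norm_zero, add_zero, mul_one] at h1 ⊢
  have hm := m.moment_nonneg
  calc _ ≤ ‖J.dθ t (X ω) θ m‖ * ‖v‖ := ContinuousLinearMap.le_opNorm _ _
    _ ≤ C * (1 + ‖X ω‖ + m.moment) ^ q * ‖v‖ := by gcongr
    _ = _ := by ring

theorem IsSmooth.integrable_dθθ (hS : IsSmooth T W J) (hq : HasDegree T J q)
    (ht : t ∈ Ioo 0 T) (θ : E n) (j : Fin n) (m : P2 d) (hX : MemLp X (q + 2 : ℕ) P)
    (hR : MemLp R (q + 2 : ℕ) P) :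
    Integrable (fun ω => inner ℝ (R ω) ((1 / 2 : ℝ) • J.dθθ t (X ω) θ m j (basisVec j))) P := by
  obtain ⟨C, hC, H⟩ := (hq.dθθ j).at_time ht ‖θ‖
  have he : ‖(basisVec j : E n)‖ = 1 := by simp
  have hV : MemLp (fun _ : Ω => (0 : E d)) (q + 2 : ℕ) P := memLp_const _
  have hc : Continuous fun x => J.dθθ t x θ m j := ((hS.admissible_dθθ j).continuous_slice ht).comp
    (f := fun x : E d => (x, θ, m)) (by fun_prop)
  refine integrable_inner_growth (C := C) hX hV hR hC m.moment_nonneg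
    (((hc.clm_apply continuous_const).comp_aestronglyMeasurable hX.1).const_smul (1 / 2 : ℝ))
    fun ω => ?_
  have h1 := H (X ω) θ m 0 le_rfl
  simp only [norm_zero, add_zero, mul_one] at h1 ⊢
  have h2 := ContinuousLinearMap.le_opNorm (J.dθθ t (X ω) θ m j) (basisVec j)
  rw [he, mul_one] at h2
  rw [norm_smul]
  norm_num
  linarith [norm_nonneg (J.dθθ t (X ω) θ m j (basisVec j))]

end

/-! ### The coefficients, change of sample space, and the integrated equation -/

section coefficients

variable {d n : ℕ}

theorem P2.W2_self_le (m : P2 d) : P2.W2 m m ≤ 0 :=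
  P2.CostLE.W2_le le_rfl (P2.costLE_self m _)

theorem P2.W2_nonneg (m ν : P2 d) : 0 ≤ P2.W2 m ν := Real.sqrt_nonneg _

theorem P2.W2_self (m : P2 d) : P2.W2 m m = 0 := le_antisymm m.W2_self_le (P2.W2_nonneg _ _)

/-- The Dirac mass at the origin. -/
def P2.diracZero (d : ℕ) : P2 d where
  toMeasure := Measure.dirac 0
  isProb := inferInstance
  memLp_id := by
    refine (memLp_two_iff_integrable_sq_norm aestronglyMeasurable_id).2 ?_
    exact integrable_dirac (by simp)

theorem P2.W2_diracZero_le (m : P2 d) : P2.W2 m (P2.diracZero d) ≤ m.moment := by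
  have := m.isProb
  have h0 : MemLp (fun _ : E d => (0 : E d)) 2 m.toMeasure := memLp_const _
  have e1 : law m.memLp_id = m := P2.ext_toMeasure Measure.map_id
  have e2 : law h0 = P2.diracZero d := P2.ext_toMeasure (by
    change m.toMeasure.map (fun _ => (0 : E d)) = _
    rw [Measure.map_const, measure_univ, one_smul]; rfl)
  have := W2_law_le m.memLp_id h0
  rw [e1, e2] at this
  simpa [P2.moment] using this

theorem IsLipschitzCoeff.continuous {F : E d → E n → P2 d → E d → E d} (hF : IsLipschitzCoeff F)
    (θ : E n) (m : P2 d) : Continuous fun z : E d × E d => F z.1 θ m z.2 := by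
  obtain ⟨C, hC⟩ := hF
  refine continuous_iff_continuousAt.2 fun z => ?_
  refine tendsto_iff_norm_sub_tendsto_zero.2 ?_
  refine squeeze_zero (fun _ => norm_nonneg _) (fun y => hC y.1 z.1 θ θ m m y.2 z.2) ?_
  have : Tendsto (fun y : E d × E d => C * (‖y.1 - z.1‖ + ‖θ - θ‖ + P2.W2 m m + ‖y.2 - z.2‖))
      (𝓝 z) (𝓝 (C * (‖z.1 - z.1‖ + ‖θ - θ‖ + P2.W2 m m + ‖z.2 - z.2‖))) :=
    Continuous.tendsto (by fun_prop) z
  simpa [P2.W2_self] using this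

theorem IsLipschitzCoeff.exists_growth {F : E d → E n → P2 d → E d → E d}
    (hF : IsLipschitzCoeff F) : ∃ C : ℝ, 0 ≤ C ∧ ∀ x θ m p,
      ‖F x θ m p‖ ≤ C * (1 + ‖x‖ + ‖θ‖ + m.moment + ‖p‖) := by
  obtain ⟨C, hC⟩ := hF
  refine ⟨|C| + ‖F 0 0 (P2.diracZero d) 0‖, by positivity, fun x θ m p => ?_⟩
  have h1 := hC x 0 θ 0 m (P2.diracZero d) p 0
  simp only [sub_zero] at h1
  have h2 := m.W2_diracZero_le
  have h3 := P2.W2_nonneg m (P2.diracZero d)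
  have h4 : ‖F x θ m p‖ ≤ ‖F x θ m p - F 0 0 (P2.diracZero d) 0‖ + ‖F 0 0 (P2.diracZero d) 0‖ := by
    simpa using norm_add_le (F x θ m p - F 0 0 (P2.diracZero d) 0) (F 0 0 (P2.diracZero d) 0)
  have h5 : C * (‖x‖ + ‖θ‖ + P2.W2 m (P2.diracZero d) + ‖p‖) ≤
      |C| * (1 + ‖x‖ + ‖θ‖ + m.moment + ‖p‖) := by
    refine mul_le_mul (le_abs_self C) (by linarith) (by positivity) (abs_nonneg C)
  have h6 : ‖F 0 0 (P2.diracZero d) 0‖ * 1 ≤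
      ‖F 0 0 (P2.diracZero d) 0‖ * (1 + ‖x‖ + ‖θ‖ + m.moment + ‖p‖) := by
    refine mul_le_mul_of_nonneg_left ?_ (norm_nonneg _)
    linarith [norm_nonneg x, norm_nonneg θ, norm_nonneg p, m.moment_nonneg]
  linarith

end coefficients

section transfer

variable {Ω : Type*} [MeasurableSpace Ω] {P : Measure Ω} {d n : ℕ}

/-- A probability space carrying a uniform variable carries pairs of any given joint law. -/
theorem exists_map_prod_eq
    (hΩ : ∃ ξ : Ω → ℝ, Measurable ξ ∧ P.map ξ = volume.restrict (Icc (0 : ℝ) 1))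
    {Ω' : Type*} [MeasurableSpace Ω'] {P' : Measure Ω'} [IsProbabilityMeasure P']
    {X Y : Ω' → E d} (hX : AEMeasurable X P') (hY : AEMeasurable Y P') :
    ∃ X' Y' : Ω → E d, Measurable X' ∧ Measurable Y' ∧
      P.map (fun ω => (X' ω, Y' ω)) = P'.map (fun ω => (X ω, Y ω)) := by
  obtain ⟨ξ, hξ, hξm⟩ := hΩ
  have := Measure.isProbabilityMeasure_map (hX.prodMk hY)
  obtain ⟨f, hf, hfm⟩ := (P'.map (fun ω => (X ω, Y ω))).exists_measurable_map_eq
  have hpr : Measurable (projIcc (0 : ℝ) 1 zero_le_one) := continuous_projIcc.measurable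
  have hu : P.map (fun ω => projIcc (0 : ℝ) 1 zero_le_one (ξ ω)) = volume := by
    have e1 : P.map (projIcc (0 : ℝ) 1 zero_le_one ∘ ξ) =
      (P.map ξ).map (projIcc (0 : ℝ) 1 zero_le_one) := (Measure.map_map hpr hξ).symm
    have e2 := unitInterval.measurePreserving_coe.map_eq
    refine e1.trans ?_
    rw [hξm, ← e2, Measure.map_map hpr measurable_subtype_coe]
    have : projIcc (0 : ℝ) 1 zero_le_one ∘ (Subtype.val : unitInterval → ℝ) = id := by
      ext x; simp
    rw [this, Measure.map_id]
  refine ⟨fun ω => (f (projIcc (0 : ℝ) 1 zero_le_one (ξ ω))).1,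
    fun ω => (f (projIcc (0 : ℝ) 1 zero_le_one (ξ ω))).2, by fun_prop, by fun_prop, ?_⟩
  rw [← hfm, ← hu]
  exact (Measure.map_map hf (hpr.comp hξ)).symm

variable [IsProbabilityMeasure P]

/-- Square integrability depends on the joint law only. -/
theorem memLp_of_map_prod_eq {Ω' : Type*} [MeasurableSpace Ω'] {P' : Measure Ω'}
    {P : Measure Ω} {X Y : Ω → E d} {X' Y' : Ω' → E d} (hX : AEMeasurable X P)
    (hY : AEMeasurable Y P)
    (hX' : AEMeasurable X' P') (hY' : AEMeasurable Y' P')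
    (h : P.map (fun ω => (X ω, Y ω)) = P'.map (fun ω => (X' ω, Y' ω))) {p : ℝ≥0∞}
    (h1 : MemLp X p P) (h2 : MemLp Y p P) : MemLp X' p P' ∧ MemLp Y' p P' := by
  have a1 := hX.prodMk hY
  have a2 := hX'.prodMk hY'
  constructor
  · have e := memLp_map_measure_iff (p := p) (g := Prod.fst) continuous_fst.aestronglyMeasurable a1
    have e' := memLp_map_measure_iff (p := p) (g := Prod.fst) continuous_fst.aestronglyMeasurable a2
    rw [← h] at e'
    exact e'.1 (e.2 h1)
  · have e := memLp_map_measure_iff (p := p) (g := Prod.snd) continuous_snd.aestronglyMeasurable a1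
    have e' := memLp_map_measure_iff (p := p) (g := Prod.snd) continuous_snd.aestronglyMeasurable a2
    rw [← h] at e'
    exact e'.1 (e.2 h2)

/-- Joint monotonicity of `(F, G)` along a feedback `(U, U)`, on an arbitrary sample space. -/
theorem IsJointlyL2Monotone.transfer
    (hΩ : ∃ ξ : Ω → ℝ, Measurable ξ ∧ P.map ξ = volume.restrict (Icc (0 : ℝ) 1))
    {F G : E d → E n → P2 d → E d → E d} (hF : IsLipschitzCoeff F) (hG : IsLipschitzCoeff G)
    (hFG : IsJointlyL2Monotone P F G) {U : E d → P2 d → E d} {C : ℝ}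
    (hUg : ∀ x m, ‖U x m‖ ≤ C * (1 + ‖x‖ + m.moment)) (hUc : ∀ m, Continuous fun x => U x m)
    (θ : E n) {Ω' : Type*} [MeasurableSpace Ω'] {P' : Measure Ω'} [IsProbabilityMeasure P']
    {X Y : Ω' → E d} (hX : MemLp X 2 P') (hY : MemLp Y 2 P') :
    0 ≤ ∫ ω, (inner ℝ (F (X ω) θ (law hX) (U (X ω) (law hX)) -
        F (Y ω) θ (law hY) (U (Y ω) (law hY))) (U (X ω) (law hX) - U (Y ω) (law hY)) +
      inner ℝ (G (X ω) θ (law hX) (U (X ω) (law hX)) -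
        G (Y ω) θ (law hY) (U (Y ω) (law hY))) (X ω - Y ω)) ∂P' := by
  obtain ⟨X', Y', mX, mY, h⟩ := exists_map_prod_eq hΩ hX.1.aemeasurable hY.1.aemeasurable
  obtain ⟨hX', hY'⟩ := memLp_of_map_prod_eq hX.1.aemeasurable hY.1.aemeasurable
    mX.aemeasurable mY.aemeasurable h.symm hX hY
  obtain ⟨e1, e2⟩ := law_eq_of_map_prod_eq hX' hY' hX hY h
  have key := hFG θ X' Y' (fun ω => U (X' ω) (law hX')) (fun ω => U (Y' ω) (law hY')) hX' hY'
    (memLp_superposition hUg hUc hX' _) (memLp_superposition hUg hUc hY' _)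
  rw [e1, e2] at key
  refine key.trans_eq (integral_eq_of_map_prod_eq (φ := fun z =>
    inner ℝ (F z.1 θ (law hX) (U z.1 (law hX)) -
        F z.2 θ (law hY) (U z.2 (law hY))) (U z.1 (law hX) - U z.2 (law hY)) +
      inner ℝ (G z.1 θ (law hX) (U z.1 (law hX)) -
        G z.2 θ (law hY) (U z.2 (law hY))) (z.1 - z.2))
    mX.aemeasurable mY.aemeasurable hX.1.aemeasurable hY.1.aemeasurable h ?_)
  have c1 : ∀ {K : E d → E n → P2 d → E d → E d}, IsLipschitzCoeff K → ∀ m,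
      Continuous fun x => K x θ m (U x m) := fun hK m =>
    (hK.continuous θ m).comp (continuous_id.prodMk (hUc m))
  exact ((((c1 hF _).comp continuous_fst).sub ((c1 hF _).comp continuous_snd)).inner
    (((hUc _).comp continuous_fst).sub ((hUc _).comp continuous_snd))).add
    ((((c1 hG _).comp continuous_fst).sub ((c1 hG _).comp continuous_snd)).inner
    (continuous_fst.sub continuous_snd))

/-- Monotonicity on a space carrying a uniform variable implies monotonicity on every space. -/
theorem IsL2Monotone.transfer
    (hΩ : ∃ ξ : Ω → ℝ, Measurable ξ ∧ P.map ξ = volume.restrict (Icc (0 : ℝ) 1))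
    {U : E d → P2 d → E d} (hU : IsL2Monotone P U) (hUc : ∀ m, Continuous fun x => U x m)
    {Ω' : Type*} [MeasurableSpace Ω'] {P' : Measure Ω'} [IsProbabilityMeasure P']
    {X Y : Ω' → E d} (hX : MemLp X 2 P') (hY : MemLp Y 2 P') : 0 ≤ monoCorr U hX hY := by
  obtain ⟨X', Y', mX, mY, h⟩ := exists_map_prod_eq hΩ hX.1.aemeasurable hY.1.aemeasurable
  obtain ⟨hX', hY'⟩ := memLp_of_map_prod_eq hX.1.aemeasurable hY.1.aemeasurable
    mX.aemeasurable mY.aemeasurable h.symm hX hY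
  rw [← monoCorr_eq_of_map_prod_eq hUc hX' hY' hX hY h]
  exact hU X' Y' hX' hY'

end transfer

section equation

variable {Ω : Type*} [MeasurableSpace Ω] {P : Measure Ω} [IsProbabilityMeasure P] {d n : ℕ}
  {X R : Ω → E d} {q : ℕ} {T t : ℝ} {W : ℝ → E d → E n → P2 d → E d} {J : Jet d n}

/-- The velocity `-F(X, θ, ℒ(X), W(t, X, θ, ℒ(X)))`. -/
def velocity (F : E d → E n → P2 d → E d → E d) (W : ℝ → E d → E n → P2 d → E d) (t : ℝ) (θ : E n)
    (hX : MemLp X 2 P) (ω : Ω) : E d :=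
  -F (X ω) θ (law hX) (W t (X ω) θ (law hX))

/-- The equation, in terms of the generators of the drift and of the noise. The latter carry a
factor `1/2`, whence the coefficients `2 σx` and `2 σθ`. -/
theorem equation_generators (hS : IsSmooth T W J) (hq : HasDegree T J q) (ht : t ∈ Ioo 0 T)
    (θ : E n) {σx σθ : ℝ} {b : E n → E n} {F G : E d → E n → P2 d → E d → E d}
    (hF : IsLipschitzCoeff F) (hX : MemLp X (q + 2 : ℕ) P)
    (hX2 : MemLp X 2 P)
    (heq : ∀ x m,
      Integrable (fun y => J.dm t x θ m y (F y θ m (W t y θ m))) m.toMeasure ∧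
      Integrable (fun y => trace₂ (J.dmy t x θ m y)) m.toMeasure ∧
      J.dt t x θ m + J.dx t x θ m (F x θ m (W t x θ m)) + J.dθ t x θ m (b θ)
        - σx • trace₂ (J.dxx t x θ m) - σθ • trace₂ (J.dθθ t x θ m)
        + (∫ y, J.dm t x θ m y (F y θ m (W t y θ m)) ∂m.toMeasure)
        - σx • (∫ y, trace₂ (J.dmy t x θ m y) ∂m.toMeasure)
      = G x θ m (W t x θ m)) (ω : Ω) :
    J.dt t (X ω) θ (law hX2) - driftGen J t θ (velocity F W t θ hX2) hX2 ω
      - J.dθ t (X ω) θ (law hX2) (-b θ)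
      - (2 * σx) • ∑ i, noiseGen J t θ i hX2 ω
      - (2 * σθ) • ∑ j, (1 / 2 : ℝ) • J.dθθ t (X ω) θ (law hX2) j (basisVec j) =
    G (X ω) θ (law hX2) (W t (X ω) θ (law hX2)) := by
  have hWc := hS.continuous_x (Ioo_subset_Ico_of_mem ht) θ (law hX2)
  have hdm : Continuous fun y => J.dm t (X ω) θ (law hX2) y :=
    (hS.admissible_dm.continuous_slice ht).comp (f := fun y => (X ω, θ, law hX2, y)) (by fun_prop)
  have hdmy : ∀ i, Continuous fun y => J.dmy t (X ω) θ (law hX2) y i := fun i =>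
    ((hS.admissible_dmy i).continuous_slice ht).comp (f := fun y => (X ω, θ, law hX2, y))
      (by fun_prop)
  have hFc : Continuous fun y => F y θ (law hX2) (W t y θ (law hX2)) :=
    (hF.continuous θ (law hX2)).comp (continuous_id.prodMk hWc)
  have hdmyi : ∀ i, Integrable (fun ω' => J.dmy t (X ω) θ (law hX2) (X ω') i (basisVec i)) P := by
    intro i
    obtain ⟨C, hC, H⟩ := (hq.dmy i).at_time ht ‖θ‖
    have he : ‖(basisVec i : E d)‖ = 1 := by simp
    have hm := (law hX2).moment_nonneg
    refine ((integrable_weight_pow (p := q + 2) (by omega) hX hX hX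
      (‖X ω‖ + (law hX2).moment)).const_mul C).mono'
      (((hdmy i).clm_apply continuous_const).comp_aestronglyMeasurable hX2.1)
      (Eventually.of_forall fun ω' => ?_)
    have h2 := ContinuousLinearMap.le_opNorm (J.dmy t (X ω) θ (law hX2) (X ω') i) (basisVec i)
    rw [he, mul_one] at h2
    refine h2.trans ((H _ _ _ _ le_rfl).trans ?_)
    rw [Real.norm_of_nonneg (by positivity)]
    have h3 := norm_nonneg (X ω')
    have h4 := norm_nonneg (X ω)
    gcongr C * ?_
    calc (1 + ‖X ω‖ + (law hX2).moment + ‖X ω'‖) ^ q ≤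
        (1 + ‖X ω'‖ + ‖X ω'‖ + ‖X ω'‖ + (‖X ω‖ + (law hX2).moment)) ^ q := by
          gcongr ?_ ^ q
          linarith
      _ ≤ _ := pow_le_pow_right₀ (by linarith) (by omega)
  obtain ⟨-, -, e⟩ := heq (X ω) (law hX2)
  rw [← e, integral_law hX2 (hdm.clm_apply hFc), integral_law hX2 (φ := fun y =>
    trace₂ (J.dmy t (X ω) θ (law hX2) y))
    (continuous_finsetSum _ fun i _ => (hdmy i).clm_apply continuous_const)]
  have e1 : ∫ ω', trace₂ (J.dmy t (X ω) θ (law hX2) (X ω')) ∂P =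
      ∑ i, ∫ ω', J.dmy t (X ω) θ (law hX2) (X ω') i (basisVec i) ∂P := by
    simp only [trace₂]
    exact integral_finsetSum _ fun i _ => hdmyi i
  have e2 : ∫ ω', J.dm t (X ω) θ (law hX2) (X ω') (velocity F W t θ hX2 ω') ∂P =
      -∫ ω', J.dm t (X ω) θ (law hX2) (X ω')
        (F (X ω') θ (law hX2) (W t (X ω') θ (law hX2))) ∂P := by
    rw [← integral_neg]
    simp only [velocity, map_neg]
  have e3 : ∀ i, noiseGen J t θ i hX2 ω = (1 / 2 : ℝ) • (J.dxx t (X ω) θ (law hX2) i (basisVec i) +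
      ∫ ω', J.dmy t (X ω) θ (law hX2) (X ω') i (basisVec i) ∂P) := fun i => by
    rw [noiseGen, integral_smul, smul_add]
  rw [e1, driftGen, e2, ← Finset.smul_sum]
  simp only [e3]
  rw [← Finset.smul_sum, Finset.sum_add_distrib]
  simp only [trace₂, velocity, map_neg]
  module

/-- The equation, tested against `R`. -/
theorem integral_equation (hS : IsSmooth T W J) (hq : HasDegree T J q) (ht : t ∈ Ioo 0 T)
    (θ : E n) {σx σθ : ℝ} {b : E n → E n} {F G : E d → E n → P2 d → E d → E d}
    (hF : IsLipschitzCoeff F) (hX : MemLp X (q + 2 : ℕ) P) (hR : MemLp R (q + 2 : ℕ) P)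
    (hX2 : MemLp X 2 P) (hV : MemLp (velocity F W t θ hX2) (q + 2 : ℕ) P)
    (heq : ∀ x m,
      Integrable (fun y => J.dm t x θ m y (F y θ m (W t y θ m))) m.toMeasure ∧
      Integrable (fun y => trace₂ (J.dmy t x θ m y)) m.toMeasure ∧
      J.dt t x θ m + J.dx t x θ m (F x θ m (W t x θ m)) + J.dθ t x θ m (b θ)
        - σx • trace₂ (J.dxx t x θ m) - σθ • trace₂ (J.dθθ t x θ m)
        + (∫ y, J.dm t x θ m y (F y θ m (W t y θ m)) ∂m.toMeasure)
        - σx • (∫ y, trace₂ (J.dmy t x θ m y) ∂m.toMeasure)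
      = G x θ m (W t x θ m)) :
    (∫ ω, inner ℝ (R ω) (J.dt t (X ω) θ (law hX2)) ∂P)
      - (∫ ω, inner ℝ (R ω) (driftGen J t θ (velocity F W t θ hX2) hX2 ω) ∂P)
      - (∫ ω, inner ℝ (R ω) (J.dθ t (X ω) θ (law hX2) (-b θ)) ∂P)
      - (2 * σx) * ∑ i, ∫ ω, inner ℝ (R ω) (noiseGen J t θ i hX2 ω) ∂P
      - (2 * σθ) * ∑ j, ∫ ω, inner ℝ (R ω)
          ((1 / 2 : ℝ) • J.dθθ t (X ω) θ (law hX2) j (basisVec j)) ∂P =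
    ∫ ω, inner ℝ (R ω) (G (X ω) θ (law hX2) (W t (X ω) θ (law hX2))) ∂P := by
  have i1 := hS.integrable_dt hq ht θ (law hX2) hX hR
  have i2 := hS.integrable_driftGen hq ht θ hX hV hR hX2
  have i3 := hS.integrable_dθ hq ht θ (-b θ) (law hX2) hX hR
  have i4 := fun i => hS.integrable_noiseGen hq ht θ i hX hR hX2
  have i5 := fun j => hS.integrable_dθθ hq ht θ j (law hX2) hX hR
  have i4' := (integrable_finsetSum Finset.univ fun i _ => i4 i).const_mul (2 * σx)
  have i5' := (integrable_finsetSum Finset.univ fun j _ => i5 j).const_mul (2 * σθ)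
  have e : ∀ ω, inner ℝ (R ω) (G (X ω) θ (law hX2) (W t (X ω) θ (law hX2))) =
      inner ℝ (R ω) (J.dt t (X ω) θ (law hX2))
      - inner ℝ (R ω) (driftGen J t θ (velocity F W t θ hX2) hX2 ω)
      - inner ℝ (R ω) (J.dθ t (X ω) θ (law hX2) (-b θ))
      - (2 * σx) * ∑ i, inner ℝ (R ω) (noiseGen J t θ i hX2 ω)
      - (2 * σθ) * ∑ j, inner ℝ (R ω)
          ((1 / 2 : ℝ) • J.dθθ t (X ω) θ (law hX2) j (basisVec j)) := fun ω => by
    rw [← equation_generators hS hq ht θ hF hX hX2 heq ω, inner_sub_right, inner_sub_right,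
      inner_sub_right, inner_sub_right, inner_smul_right, inner_smul_right, inner_sum, inner_sum]
  simp only [e]
  rw [integral_sub, integral_sub, integral_sub, integral_sub i1 i2, integral_const_mul,
    integral_const_mul, integral_finsetSum _ fun i _ => i4 i, integral_finsetSum _ fun j _ => i5 j]
  exacts [i1.sub i2, i3, (i1.sub i2).sub i3, i4', ((i1.sub i2).sub i3).sub i4', i5']

end equation

/-! ### Configurations: parameter and pair of random variables -/

theorem integral_norm_pow_eq {Ω F : Type*} [MeasurableSpace Ω] {P : Measure Ω}
    [NormedAddCommGroup F] {f : Ω → F} (hf : AEStronglyMeasurable f P) {p : ℕ} (hp : p ≠ 0) :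
    ∫ ω, ‖f ω‖ ^ p ∂P = (eLpNorm f p P).toReal ^ p := by
  have hm : AEStronglyMeasurable (fun ω => ‖f ω‖ ^ p) P := hf.norm.pow p
  rw [← ENNReal.toReal_pow, eLpNorm_natCast_pow f hp,
    integral_eq_lintegral_of_nonneg_ae (Eventually.of_forall fun _ => by positivity) hm]
  congr 1
  refine lintegral_congr fun ω => ?_
  rw [ENNReal.ofReal_pow (norm_nonneg _), ofReal_norm]

/-- A parameter together with a pair of random vectors with finite moments of order `q + 2`. -/
structure Config (n d q : ℕ) where
  θ : E n
  X : UnifSeq → E d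
  Y : UnifSeq → E d
  hX : MemLp X (q + 2 : ℕ) unifSeq
  hY : MemLp Y (q + 2 : ℕ) unifSeq

namespace Config

variable {n d q : ℕ}

/-- The sum of the `(q + 2)`-th powers of the distances between the components of two
configurations. -/
def gap (c z : Config n d q) : ℝ :=
  ‖z.θ - c.θ‖ ^ (q + 2) + ∫ ω, ‖z.X ω - c.X ω‖ ^ (q + 2) ∂unifSeq +
    ∫ ω, ‖z.Y ω - c.Y ω‖ ^ (q + 2) ∂unifSeq

/-- The zero configuration. -/
def origin (n d q : ℕ) : Config n d q :=
  ⟨0, fun _ => 0, fun _ => 0, memLp_const _, memLp_const _⟩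

/-- The weight `1 + |θ|^p + 𝔼|X|^p + 𝔼|Y|^p` with `p = q + 2`. -/
def size (z : Config n d q) : ℝ := 1 + gap (origin n d q) z

theorem size_eq (z : Config n d q) : z.size = 1 + (‖z.θ‖ ^ (q + 2) +
    ∫ ω, ‖z.X ω‖ ^ (q + 2) ∂unifSeq + ∫ ω, ‖z.Y ω‖ ^ (q + 2) ∂unifSeq) := by
  simp [size, gap, origin]

theorem gap_nonneg (c z : Config n d q) : 0 ≤ gap c z := by
  unfold gap
  have h1 : 0 ≤ ∫ ω, ‖z.X ω - c.X ω‖ ^ (q + 2) ∂unifSeq :=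
    integral_nonneg fun _ => by positivity
  have h2 : 0 ≤ ∫ ω, ‖z.Y ω - c.Y ω‖ ^ (q + 2) ∂unifSeq :=
    integral_nonneg fun _ => by positivity
  positivity

theorem one_le_size (z : Config n d q) : 1 ≤ z.size :=
  le_add_of_nonneg_right (gap_nonneg _ _)

theorem integrable_norm_pow {Ω F : Type*} [MeasurableSpace Ω] {P : Measure Ω}
    [NormedAddCommGroup F] {f : Ω → F} (hf : MemLp f (q + 2 : ℕ) P) :
    Integrable (fun ω => ‖f ω‖ ^ (q + 2)) P :=
  hf.integrable_norm_pow (by omega)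

theorem integral_norm_sub_pow_le {Ω F : Type*} [MeasurableSpace Ω] {P : Measure Ω}
    [NormedAddCommGroup F] {f g k : Ω → F} (hf : MemLp f (q + 2 : ℕ) P)
    (hg : MemLp g (q + 2 : ℕ) P) (hk : MemLp k (q + 2 : ℕ) P) :
    ∫ ω, ‖k ω - f ω‖ ^ (q + 2) ∂P ≤
      2 ^ (q + 2) * (∫ ω, ‖g ω - f ω‖ ^ (q + 2) ∂P + ∫ ω, ‖k ω - g ω‖ ^ (q + 2) ∂P) := by
  have h1 := integrable_norm_pow (hg.sub hf)
  have h2 := integrable_norm_pow (hk.sub hg)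
  simp only [Pi.sub_apply] at h1 h2
  rw [← integral_add h1 h2, ← integral_const_mul]
  refine integral_mono (integrable_norm_pow (hk.sub hf)) ((h1.add h2).const_mul _) fun ω => ?_
  have := norm_add_pow_le (g ω - f ω) (k ω - g ω) (q + 2)
  rwa [sub_add_sub_cancel'] at this

/-- A quasi-triangle inequality. -/
theorem gap_le (c z z' : Config n d q) :
    gap c z' ≤ 2 ^ (q + 2) * (gap c z + gap z z') := by
  have h1 := integral_norm_sub_pow_le c.hX z.hX z'.hX
  have h2 := integral_norm_sub_pow_le c.hY z.hY z'.hY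
  have h3 := norm_add_pow_le (z.θ - c.θ) (z'.θ - z.θ) (q + 2)
  rw [sub_add_sub_cancel'] at h3
  unfold gap
  linarith

instance : Fact ((1 : ℝ≥0∞) ≤ (q + 2 : ℕ)) := ⟨by exact_mod_cast Nat.le_add_left 1 (q + 1)⟩

/-- The complete metric space of times in `[0, a]` and configurations up to null sets. -/
abbrev Space (n d q : ℕ) (a : ℝ) : Type :=
  Icc (0 : ℝ) a × E n × Lp (E d) (q + 2 : ℕ) unifSeq × Lp (E d) (q + 2 : ℕ) unifSeq

/-- The configuration given by representatives. -/
def ofSpace {a : ℝ} (m : Space n d q a) : Config n d q :=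
  ⟨m.2.1, m.2.2.1, m.2.2.2, Lp.memLp _, Lp.memLp _⟩

/-- The point of `Space` given by a time and a configuration. -/
def toSpace {a t : ℝ} (ht : t ∈ Icc 0 a) (z : Config n d q) : Space n d q a :=
  (⟨t, ht⟩, z.θ, z.hX.toLp, z.hY.toLp)

theorem integral_Lp_sub (f g : Lp (E d) (q + 2 : ℕ) unifSeq) :
    ∫ ω, ‖f ω - g ω‖ ^ (q + 2) ∂unifSeq = ‖f - g‖ ^ (q + 2) := by
  rw [Lp.norm_def, ← integral_norm_pow_eq (Lp.aestronglyMeasurable _) (by omega)]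
  refine integral_congr_ae ?_
  filter_upwards [Lp.coeFn_sub f g] with ω h
  rw [h, Pi.sub_apply]

/-- The gap of two configurations is the sum of the `p`-th powers of the distances in `Space`. -/
theorem gap_ofSpace {a : ℝ} (m m' : Space n d q a) : gap (ofSpace m') (ofSpace m) =
    ‖m.2.1 - m'.2.1‖ ^ (q + 2) + ‖m.2.2.1 - m'.2.2.1‖ ^ (q + 2) +
      ‖m.2.2.2 - m'.2.2.2‖ ^ (q + 2) := by
  rw [← integral_Lp_sub, ← integral_Lp_sub]; rfl

theorem gap_toSpace {a t : ℝ} (ht : t ∈ Icc 0 a) (c z : Config n d q) :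
    gap c (ofSpace (toSpace ht z)) = gap c z := by
  have e1 : ∫ ω, ‖(z.hX.toLp : UnifSeq → E d) ω - c.X ω‖ ^ (q + 2) ∂unifSeq =
      ∫ ω, ‖z.X ω - c.X ω‖ ^ (q + 2) ∂unifSeq := integral_congr_ae (by
    filter_upwards [z.hX.coeFn_toLp] with ω h
    rw [h])
  have e2 : ∫ ω, ‖(z.hY.toLp : UnifSeq → E d) ω - c.Y ω‖ ^ (q + 2) ∂unifSeq =
      ∫ ω, ‖z.Y ω - c.Y ω‖ ^ (q + 2) ∂unifSeq := integral_congr_ae (by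
    filter_upwards [z.hY.coeFn_toLp] with ω h
    rw [h])
  change _ + ∫ ω, ‖(z.hX.toLp : UnifSeq → E d) ω - c.X ω‖ ^ (q + 2) ∂unifSeq +
    ∫ ω, ‖(z.hY.toLp : UnifSeq → E d) ω - c.Y ω‖ ^ (q + 2) ∂unifSeq = _
  rw [e1, e2]
  rfl

/-- The gauge on `Space`. -/
def gauge {a : ℝ} (m m' : Space n d q a) : ℝ :=
  ((m.1 : ℝ) - m'.1) ^ 2 + gap (ofSpace m') (ofSpace m)

theorem gap_self (z : Config n d q) : gap z z = 0 := by simp [gap]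

theorem continuous_gauge {a : ℝ} (m' : Space n d q a) : Continuous fun m => gauge m m' := by
  simp only [gauge, gap_ofSpace]
  fun_prop

/-- The gauge controls the distance uniformly, as the variational principle requires. -/
theorem dist_le_of_gauge_le {a ε : ℝ} (hε : 0 < ε) {m m' : Space n d q a}
    (h : gauge m m' ≤ min (ε ^ 2) (ε ^ (q + 2))) : dist m m' ≤ ε := by
  have h2 := h.trans (min_le_left _ _)
  have hp := h.trans (min_le_right _ _)
  rw [gauge, gap_ofSpace] at h2 hp
  have a0 : 0 ≤ ((m.1 : ℝ) - m'.1) ^ 2 := by positivity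
  have a1 : 0 ≤ ‖m.2.1 - m'.2.1‖ ^ (q + 2) := by positivity
  have a2 : 0 ≤ ‖m.2.2.1 - m'.2.2.1‖ ^ (q + 2) := by positivity
  have a3 : 0 ≤ ‖m.2.2.2 - m'.2.2.2‖ ^ (q + 2) := by positivity
  have root : ∀ {u : ℝ}, 0 ≤ u → u ^ (q + 2) ≤ ε ^ (q + 2) → u ≤ ε := fun hu h =>
    (pow_le_pow_iff_left₀ hu hε.le (by omega)).1 h
  simp only [Prod.dist_eq, sup_le_iff]
  refine ⟨?_, ?_, ?_, ?_⟩
  · rw [Subtype.dist_eq, Real.dist_eq]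
    exact abs_le_of_sq_le_sq (by linarith) hε.le
  · rw [dist_eq_norm]; exact root (norm_nonneg _) (by linarith)
  · rw [dist_eq_norm]; exact root (norm_nonneg _) (by linarith)
  · rw [dist_eq_norm]; exact root (norm_nonneg _) (by linarith)

/-- Continuity along sequences of times in `[0, a]` and of configurations. -/
def IsSeqContinuous (a : ℝ) (Φ : ℝ → Config n d q → ℝ) : Prop :=
  ∀ (s : ℕ → ℝ) (z : ℕ → Config n d q) (s₀ : ℝ) (z₀ : Config n d q), (∀ k, s k ∈ Icc 0 a) →
    Tendsto s atTop (𝓝 s₀) → Tendsto (fun k => gap z₀ (z k)) atTop (𝓝 0) →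
    Tendsto (fun k => Φ (s k) (z k)) atTop (𝓝 (Φ s₀ z₀))

/-- A sequentially continuous function of configurations is insensitive to null sets. -/
theorem IsSeqContinuous.toSpace {a : ℝ} {Φ : ℝ → Config n d q → ℝ} (hΦ : IsSeqContinuous a Φ)
    {t : ℝ} (ht : t ∈ Icc 0 a) (z : Config n d q) : Φ t (ofSpace (toSpace ht z)) = Φ t z := by
  refine tendsto_nhds_unique tendsto_const_nhds (hΦ (fun _ => t)
    (fun _ => ofSpace (Config.toSpace ht z)) t z (fun _ => ht) tendsto_const_nhds ?_)
  rw [gap_toSpace, gap_self]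
  exact tendsto_const_nhds

theorem IsSeqContinuous.continuous {a : ℝ} {Φ : ℝ → Config n d q → ℝ} (hΦ : IsSeqContinuous a Φ) :
    Continuous fun m : Space n d q a => Φ m.1 (ofSpace m) := by
  refine continuous_iff_seqContinuous.2 fun x m hx => ?_
  refine hΦ _ _ _ _ (fun k => (x k).1.2) ?_ ?_
  · exact ((continuous_subtype_val.comp continuous_fst).tendsto m).comp hx
  · have h1 := ((continuous_gauge m).tendsto m).comp hx
    have h0 : gauge m m = 0 := by simp [gauge, gap_self]
    rw [h0] at h1
    refine squeeze_zero (fun k => gap_nonneg _ _) (fun k => ?_) h1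
    exact le_add_of_nonneg_left (by positivity)

theorem continuous_size {a : ℝ} : Continuous fun m : Space n d q a => (ofSpace m).size := by
  have h : ∀ m : Space n d q a, (ofSpace m).size = 1 + (‖m.2.1‖ ^ (q + 2) + ‖m.2.2.1‖ ^ (q + 2) +
      ‖m.2.2.2‖ ^ (q + 2)) := fun m => by
    rw [size_eq]
    congr 3
    · rw [Lp.norm_def, ← integral_norm_pow_eq (Lp.aestronglyMeasurable _) (by omega)]
      rfl
    · rw [Lp.norm_def, ← integral_norm_pow_eq (Lp.aestronglyMeasurable _) (by omega)]
      rfl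
  simp only [h]
  fun_prop

theorem size_toSpace {a t : ℝ} (ht : t ∈ Icc 0 a) (z : Config n d q) :
    (ofSpace (toSpace ht z)).size = z.size := by
  rw [size, gap_toSpace, size]

end Config

/-! ### The perturbed minimum principle -/

theorem tsum_geometric_mul_le {g g' : ℕ → ℝ} {κ : ℝ} (hg : ∀ i, g i ∈ Icc (0 : ℝ) 1)
    (h0 : ∀ i, 0 ≤ g' i) (h : ∀ i, g' i ≤ g i + κ) :
    Summable (fun i => (1 / 2 : ℝ) ^ i * g' i) ∧
      ∑' i, (1 / 2 : ℝ) ^ i * g' i ≤ ∑' i, (1 / 2 : ℝ) ^ i * g i + 2 * κ := by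
  have hs : Summable fun i : ℕ => (1 / 2 : ℝ) ^ i := summable_geometric_two
  have s1 : Summable fun i => (1 / 2 : ℝ) ^ i * g i :=
    hs.of_nonneg_of_le (fun i => mul_nonneg (by positivity) (hg i).1)
      fun i => mul_le_of_le_one_right (by positivity) (hg i).2
  have s2 := hs.mul_right κ
  have le : ∀ i, (1 / 2 : ℝ) ^ i * g' i ≤ (1 / 2 : ℝ) ^ i * g i + (1 / 2 : ℝ) ^ i * κ := fun i => by
    rw [← mul_add]
    exact mul_le_mul_of_nonneg_left (h i) (by positivity)
  have s3 : Summable (fun i => (1 / 2 : ℝ) ^ i * g' i) :=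
    (s1.add s2).of_nonneg_of_le (fun i => mul_nonneg (by positivity) (h0 i)) le
  refine ⟨s3, (s3.tsum_le_tsum le (s1.add s2)).trans_eq ?_⟩
  rw [s1.tsum_add s2, tsum_mul_right, tsum_geometric_two]

namespace Config

variable {n d q : ℕ}

/-- A perturbed minimum of `Φ`: if `Φ` takes a negative value, then at some `(t, z)` it is negative
and decreases slowly, both backwards in time and along any step of length `h` which increases the
gaps to all configurations by `O(h)` on average. -/
theorem exists_test {a l : ℝ} (hl : 0 ≤ l) {Φ : ℝ → Config n d q → ℝ}
    (hc : IsSeqContinuous a Φ)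
    (hb : ∀ η > 0, ∃ K, ∀ t ∈ Icc 0 a, ∀ z, -(η * size z + K) ≤ Φ t z)
    (hneg : ∃ t ∈ Icc 0 a, ∃ z, Φ t z < 0) :
    ∃ ε > 0, ∃ t ∈ Icc 0 a, ∃ z, Φ t z < 0 ∧
      (∀ h ∈ Ioc (0 : ℝ) 1, h ≤ t → Φ t z - Φ (t - h) z ≤
        ε * (Real.exp (l * (t - h)) - Real.exp (l * t)) * size z + 6 * ε * h) ∧
      ∀ (z₁ z₂ : ℕ → Config n d q) (L₁ L₂ : Config n d q → ℝ) (Φ₁ Φ₂ h D : ℝ),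
        0 ≤ h → 0 ≤ D → (∀ c, Tendsto (fun j => gap c (z₁ j)) atTop (𝓝 (L₁ c))) →
        (∀ c, Tendsto (fun j => gap c (z₂ j)) atTop (𝓝 (L₂ c))) →
        (∀ c, (L₁ c + L₂ c) / 2 ≤ gap c z + h * (2 ^ (q + 2) * (gap c z + D))) →
        Tendsto (fun j => Φ t (z₁ j)) atTop (𝓝 Φ₁) → Tendsto (fun j => Φ t (z₂ j)) atTop (𝓝 Φ₂) →
        Φ t z - (Φ₁ + Φ₂) / 2 ≤ 3 * ε * Real.exp (l * t) * 2 ^ (q + 2) * (size z + D) * h := by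
  obtain ⟨t₁, ht₁, z₁, hz₁⟩ := hneg
  have hsz := one_le_size z₁
  have hex := Real.exp_pos (l * t₁)
  -- the weight of the barrier is small enough to keep the value at `(t₁, z₁)` negative
  obtain ⟨ε, hε, hε'⟩ : ∃ ε > 0, Φ t₁ z₁ + ε * Real.exp (l * t₁) * z₁.size < 0 := by
    have hpos : 0 < Real.exp (l * t₁) * z₁.size := by positivity
    refine ⟨-Φ t₁ z₁ / (2 * (Real.exp (l * t₁) * z₁.size)), by
      apply div_pos <;> linarith, ?_⟩
    have : -Φ t₁ z₁ / (2 * (Real.exp (l * t₁) * z₁.size)) * Real.exp (l * t₁) * z₁.size =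
        -Φ t₁ z₁ / 2 := by field_simp
    linarith
  obtain ⟨K, hK⟩ := hb ε hε
  have hexp : Continuous fun m : Space n d q a => Real.exp (l * m.1) := by fun_prop
  obtain ⟨m, x, hm, hgm, -, hmin⟩ := exists_min_add_gauge
    (f := fun m : Space n d q a => Φ m.1 (ofSpace m) +
      ε * Real.exp (l * m.1) * (ofSpace m).size)
    (hc.continuous.add ((continuous_const.mul hexp).mul continuous_size))
    ⟨-K, by
      rintro _ ⟨m, rfl⟩
      have h1 := hK m.1 m.1.2 (ofSpace m)
      have h2 : 1 ≤ Real.exp (l * m.1) := Real.one_le_exp (mul_nonneg hl m.1.2.1)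
      have h3 := one_le_size (ofSpace m)
      have h4 : ε * (ofSpace m).size * 1 ≤ ε * (ofSpace m).size * Real.exp (l * m.1) := by gcongr
      simp only
      linarith⟩
    (ρ := gauge) continuous_gauge
    (fun m m' => add_nonneg (by positivity) (gap_nonneg _ _))
    (fun m => by simp [gauge, gap_self])
    (fun η hη => ⟨min (η ^ 2) (η ^ (q + 2)), by positivity, fun m m' h => dist_le_of_gauge_le hη h⟩)
    (c := 0) ⟨toSpace ht₁ z₁, by
      change Φ t₁ (ofSpace (toSpace ht₁ z₁)) +
        ε * Real.exp (l * t₁) * (ofSpace (toSpace ht₁ z₁)).size < 0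
      rw [hc.toSpace, size_toSpace]
      exact hε'⟩ hε
  have ht := m.1.2
  set t : ℝ := Subtype.val m.1 with ht_def
  set z := ofSpace m with hz_def
  have hzs := one_le_size z
  have hg : ∀ i, gauge m (x i) ∈ Icc (0 : ℝ) 1 := fun i =>
    ⟨add_nonneg (by positivity) (gap_nonneg _ _), hgm i⟩
  have hgap : ∀ i, gap (ofSpace (x i)) z ≤ 1 := fun i =>
    le_trans (le_add_of_nonneg_left (by positivity)) (hgm i)
  have key : ∀ s ∈ Icc 0 a, ∀ z' : Config n d q,
      Summable (fun i => (1 / 2 : ℝ) ^ i * ((s - (x i).1) ^ 2 + gap (ofSpace (x i)) z')) →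
      Φ t z + ε * Real.exp (l * t) * z.size + ε * ∑' i, (1 / 2 : ℝ) ^ i * gauge m (x i) ≤
        Φ s z' + ε * Real.exp (l * s) * z'.size +
          ε * ∑' i, (1 / 2 : ℝ) ^ i * ((s - (x i).1) ^ 2 + gap (ofSpace (x i)) z') := by
    intro s hs z' hsum
    have h1 := hmin (toSpace hs z')
    have e : ∀ i, gauge (toSpace hs z') (x i) = (s - (x i).1) ^ 2 + gap (ofSpace (x i)) z' :=
      fun i => by rw [gauge, gap_toSpace]; rfl
    simp only [e] at h1
    have h2 := h1 hsum
    rw [size_toSpace hs] at h2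
    rw [← hc.toSpace hs z']
    exact h2
  refine ⟨ε, hε, t, ht, z, ?_, ?_, ?_⟩
  · have : 0 < ε * Real.exp (l * t) * z.size := by positivity
    linarith
  · intro h hh hht
    have hτ : ∀ i, |t - (x i).1| ≤ 1 := fun i => by
      have h1 := (le_add_of_nonneg_right (gap_nonneg (ofSpace (x i)) z)).trans (hgm i)
      exact abs_le_one_iff_mul_self_le_one.2 (by rw [← sq]; exact h1)
    obtain ⟨s1, s2⟩ := tsum_geometric_mul_le (g' := fun i => (t - h - (x i).1) ^ 2 +
      gap (ofSpace (x i)) z) (κ := 3 * h) hg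
      (fun i => add_nonneg (by positivity) (gap_nonneg _ _)) fun i => by
        have h1 := (abs_le.1 (hτ i)).1
        have : (t - h - (x i).1) ^ 2 ≤ (t - (x i).1) ^ 2 + 3 * h := by nlinarith [hh.1, hh.2]
        simp only [gauge]
        linarith
    have h3 := key (t - h) ⟨by linarith, by linarith [ht.2, hh.1]⟩ z s1
    have h4 := mul_le_mul_of_nonneg_left s2 hε.le
    linarith
  · intro z₁ z₂ L₁ L₂ Φ₁ Φ₂ h D hh hD hL₁ hL₂ hL hΦ₁ hΦ₂
    -- the inequality at the minimum passes to the limit along each sequence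
    have lim : ∀ {z₁ : ℕ → Config n d q} {L₁ : Config n d q → ℝ} {Φ₁ : ℝ},
        (∀ c, Tendsto (fun j => gap c (z₁ j)) atTop (𝓝 (L₁ c))) →
        Tendsto (fun j => Φ t (z₁ j)) atTop (𝓝 Φ₁) →
        Summable (fun i => (1 / 2 : ℝ) ^ i * ((t - (x i).1) ^ 2 + L₁ (ofSpace (x i)))) ∧
        Φ t z + ε * Real.exp (l * t) * z.size + ε * ∑' i, (1 / 2 : ℝ) ^ i * gauge m (x i) ≤
        Φ₁ + ε * Real.exp (l * t) * (1 + L₁ (origin n d q)) +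
          ε * ∑' i, (1 / 2 : ℝ) ^ i * ((t - (x i).1) ^ 2 + L₁ (ofSpace (x i))) := by
      intro z₁ L₁ Φ₁ hL hΦ
      obtain ⟨B, hB⟩ := (hL z).bddAbove_range
      have hB0 : 0 ≤ B := (gap_nonneg z (z₁ 0)).trans (hB ⟨0, rfl⟩)
      have bd : ∀ j i, (t - (x i).1) ^ 2 + gap (ofSpace (x i)) (z₁ j) ≤
          gauge m (x i) + 2 ^ (q + 2) * (1 + B) := fun j i => by
        have h1 := gap_le (ofSpace (x i)) z (z₁ j)
        have h2 : gap z (z₁ j) ≤ B := hB ⟨j, rfl⟩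
        have h3 : (2 : ℝ) ^ (q + 2) * (gap (ofSpace (x i)) z + gap z (z₁ j)) ≤
          2 ^ (q + 2) * (1 + B) := by gcongr; exact hgap i
        have h4 := gap_nonneg (ofSpace (x i)) z
        simp only [gauge]
        linarith
      have hs : ∀ j, Summable (fun i => (1 / 2 : ℝ) ^ i *
          ((t - (x i).1) ^ 2 + gap (ofSpace (x i)) (z₁ j))) := fun j =>
        (tsum_geometric_mul_le hg (fun i => add_nonneg (by positivity) (gap_nonneg _ _)) (bd j)).1
      have hlim : ∀ i, Tendsto (fun j => (t - (x i).1) ^ 2 + gap (ofSpace (x i)) (z₁ j)) atTop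
          (𝓝 ((t - (x i).1) ^ 2 + L₁ (ofSpace (x i)))) := fun i => (hL _).const_add _
      have bd' : ∀ i, (t - (x i).1) ^ 2 + L₁ (ofSpace (x i)) ≤
          gauge m (x i) + 2 ^ (q + 2) * (1 + B) := fun i =>
        le_of_tendsto (hlim i) (Eventually.of_forall fun j => bd j i)
      refine ⟨(tsum_geometric_mul_le hg (fun i => ge_of_tendsto' (hlim i) fun j =>
        add_nonneg (by positivity) (gap_nonneg _ _)) bd').1, ?_⟩
      have hsum : Tendsto (fun j => ∑' i, (1 / 2 : ℝ) ^ i *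
          ((t - (x i).1) ^ 2 + gap (ofSpace (x i)) (z₁ j))) atTop
          (𝓝 (∑' i, (1 / 2 : ℝ) ^ i * ((t - (x i).1) ^ 2 + L₁ (ofSpace (x i))))) := by
        refine tendsto_tsum_of_dominated_convergence
          (bound := fun i => (1 / 2 : ℝ) ^ i * (1 + 2 ^ (q + 2) * (1 + B)))
          (summable_geometric_two.mul_right _) (fun i => (hlim i).const_mul _)
          (Eventually.of_forall fun j i => ?_)
        have h0 : 0 ≤ (t - (x i).1) ^ 2 + gap (ofSpace (x i)) (z₁ j) :=
          add_nonneg (by positivity) (gap_nonneg _ _)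
        rw [Real.norm_of_nonneg (mul_nonneg (by positivity) h0)]
        exact mul_le_mul_of_nonneg_left ((bd j i).trans (by linarith [hgm i])) (by positivity)
      refine ge_of_tendsto' ((hΦ.add (((hL (origin n d q)).const_add 1).const_mul _)).add
        (hsum.const_mul ε)) fun j => key t ht (z₁ j) (hs j)
    obtain ⟨s1, i1⟩ := lim hL₁ hΦ₁
    obtain ⟨s2, i2⟩ := lim hL₂ hΦ₂
    have nn : ∀ i, 0 ≤ (L₁ (ofSpace (x i)) + L₂ (ofSpace (x i))) / 2 := fun i =>
      div_nonneg (add_nonneg (ge_of_tendsto' (hL₁ _) fun j => gap_nonneg _ _)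
        (ge_of_tendsto' (hL₂ _) fun j => gap_nonneg _ _)) zero_le_two
    have h3 := (tsum_geometric_mul_le (g' := fun i => (t - (x i).1) ^ 2 +
      (L₁ (ofSpace (x i)) + L₂ (ofSpace (x i))) / 2) (κ := h * (2 ^ (q + 2) * (1 + D))) hg
      (fun i => add_nonneg (by positivity) (nn i)) fun i => by
        have h1 := hL (ofSpace (x i))
        have h2 : h * (2 ^ (q + 2) * (gap (ofSpace (x i)) z + D)) ≤
          h * (2 ^ (q + 2) * (1 + D)) := by gcongr; exact hgap i
        simp only [gauge]
        linarith).2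
    have e : ∑' i, (1 / 2 : ℝ) ^ i * ((t - (x i).1) ^ 2 +
        (L₁ (ofSpace (x i)) + L₂ (ofSpace (x i))) / 2) =
        (∑' i, (1 / 2 : ℝ) ^ i * ((t - (x i).1) ^ 2 + L₁ (ofSpace (x i))) +
          ∑' i, (1 / 2 : ℝ) ^ i * ((t - (x i).1) ^ 2 + L₂ (ofSpace (x i)))) / 2 := by
      rw [← s1.tsum_add s2, ← tsum_div_const]
      exact tsum_congr fun i => by ring
    rw [e] at h3
    have h4 := mul_le_mul_of_nonneg_left h3 hε.le
    have hexp1 : 1 ≤ Real.exp (l * t) := Real.one_le_exp (mul_nonneg hl ht.1)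
    have h5 := mul_le_mul_of_nonneg_left (hL (origin n d q))
      (by positivity : 0 ≤ ε * Real.exp (l * t))
    have e2 : gap (origin n d q) z = z.size - 1 := by rw [size]; ring
    rw [e2] at h5
    have h6 : ε * Real.exp (l * t) * (h * (2 ^ (q + 2) * (z.size - 1 + D))) ≤
        ε * Real.exp (l * t) * (h * (2 ^ (q + 2) * (z.size + D))) := by
      gcongr
      linarith
    have h7 : ε * 1 * (h * (2 ^ (q + 2) * (1 + D))) ≤
        ε * Real.exp (l * t) * (h * (2 ^ (q + 2) * (z.size + D))) := by gcongr
    have e3 : 3 * ε * Real.exp (l * t) * 2 ^ (q + 2) * (z.size + D) * h =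
      3 * (ε * Real.exp (l * t) * (h * (2 ^ (q + 2) * (z.size + D)))) := by ring
    rw [e3]
    have e4 : z.size = 1 + gap (origin n d q) z := rfl
    linarith

end Config

/-! ### The pairing on configurations -/

theorem tendsto_eLpNorm_two {Ω F : Type*} [MeasurableSpace Ω] {P : Measure Ω}
    [IsProbabilityMeasure P] [NormedAddCommGroup F] {p : ℕ} (hp : 2 ≤ p) {f : ℕ → Ω → F}
    (hf : ∀ k, AEStronglyMeasurable (f k) P)
    (h : Tendsto (fun k => eLpNorm (f k) p P) atTop (𝓝 0)) :
    Tendsto (fun k => eLpNorm (f k) 2 P) atTop (𝓝 0) :=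
  tendsto_of_tendsto_of_tendsto_of_le_of_le tendsto_const_nhds h (fun _ => zero_le)
    fun k => eLpNorm_le_eLpNorm_of_exponent_le (by exact_mod_cast hp) (hf k)

theorem tendsto_zero_of_pow {ι : Type*} {l : Filter ι} {u : ι → ℝ} (hu : ∀ i, 0 ≤ u i) {p : ℕ}
    (hp : p ≠ 0) (h : Tendsto (fun i => u i ^ p) l (𝓝 0)) : Tendsto u l (𝓝 0) := by
  have h1 :=
    (Real.continuousAt_rpow_const (0 : ℝ) ((p : ℝ)⁻¹) (Or.inr (by positivity))).tendsto.comp h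
  rw [Real.zero_rpow (by positivity)] at h1
  refine h1.congr fun i => ?_
  exact Real.pow_rpow_inv_natCast (hu i) hp

theorem tendsto_eLpNorm_of_integral {Ω F : Type*} [MeasurableSpace Ω] {P : Measure Ω}
    [NormedAddCommGroup F] {p : ℕ} (hp : p ≠ 0) {f : ℕ → Ω → F} (hf : ∀ k, MemLp (f k) p P)
    (h : Tendsto (fun k => ∫ ω, ‖f k ω‖ ^ p ∂P) atTop (𝓝 0)) :
    Tendsto (fun k => eLpNorm (f k) p P) atTop (𝓝 0) := by
  simp only [integral_norm_pow_eq (hf _).1 hp] at h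
  have h1 := tendsto_zero_of_pow (fun _ => ENNReal.toReal_nonneg) hp h
  exact (ENNReal.tendsto_toReal_iff (fun k => (hf k).eLpNorm_ne_top) ENNReal.zero_ne_top).1 h1

theorem moment_law_pow_le {Ω : Type*} [MeasurableSpace Ω] {P : Measure Ω} [IsProbabilityMeasure P]
    {d p : ℕ} (hp : 2 ≤ p) {X : Ω → E d} (hX : MemLp X p P) (hX2 : MemLp X 2 P) :
    (law hX2).moment ^ p ≤ ∫ ω, ‖X ω‖ ^ p ∂P := by
  rw [integral_norm_pow_eq hX.1 (by omega), moment_law_eq]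
  exact pow_le_pow_left₀ ENNReal.toReal_nonneg (ENNReal.toReal_mono hX.eLpNorm_ne_top
    (eLpNorm_le_eLpNorm_of_exponent_le (by exact_mod_cast hp) hX.1)) _

theorem sum_six_pow_le {a b c e f g : ℝ} (ha : 0 ≤ a) (hb : 0 ≤ b) (hc : 0 ≤ c) (he : 0 ≤ e)
    (hf : 0 ≤ f) (hg : 0 ≤ g) (p : ℕ) :
    (a + b + c + e + f + g) ^ (p + 1) ≤
      6 ^ (p + 1) * (a ^ (p + 1) + b ^ (p + 1) + c ^ (p + 1) + e ^ (p + 1) + f ^ (p + 1) +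
        g ^ (p + 1)) := by
  have h := pow_sum_div_card_le_sum_pow (s := Finset.univ) (f := ![a, b, c, e, f, g])
    (by intro i _; fin_cases i <;> simpa) p
  simp only [Finset.card_univ, Fintype.card_fin, Fin.sum_univ_six, div_le_iff₀
    (show (0 : ℝ) < ((6 : ℕ) : ℝ) ^ p by positivity)] at h
  simp at h
  have h0 : 0 ≤ (a ^ (p + 1) + b ^ (p + 1) + c ^ (p + 1) + e ^ (p + 1) + f ^ (p + 1) +
        g ^ (p + 1)) := by positivity
  have h6 : (6 : ℝ) ^ p ≤ 6 ^ (p + 1) := pow_le_pow_right₀ (by norm_num) (by omega)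
  nlinarith [mul_le_mul_of_nonneg_right h6 h0]

namespace Config

variable {n d q : ℕ}

theorem hX2 (z : Config n d q) : MemLp z.X 2 unifSeq := MemLp.two_of_natCast (by omega) z.hX

theorem hY2 (z : Config n d q) : MemLp z.Y 2 unifSeq := MemLp.two_of_natCast (by omega) z.hY

/-- The pairing `𝔼[(W(t, X, θ, ℒ(X)) - W(t, Y, θ, ℒ(Y))) · (X - Y)]`. -/
def corr (W : ℝ → E d → E n → P2 d → E d) (t : ℝ) (z : Config n d q) : ℝ :=
  monoCorr (fun x m => W t x z.θ m) z.hX2 z.hY2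

/-- Convergence in the gap is convergence of the parameters and convergence in `L²` of the
variables. -/
theorem tendsto_of_gap {z : ℕ → Config n d q} {z₀ : Config n d q}
    (h : Tendsto (fun k => gap z₀ (z k)) atTop (𝓝 0)) :
    Tendsto (fun k => (z k).θ) atTop (𝓝 z₀.θ) ∧
      Tendsto (fun k => eLpNorm ((z k).X - z₀.X) 2 unifSeq) atTop (𝓝 0) ∧
      Tendsto (fun k => eLpNorm ((z k).Y - z₀.Y) 2 unifSeq) atTop (𝓝 0) := by
  have n1 : ∀ k, 0 ≤ ‖(z k).θ - z₀.θ‖ ^ (q + 2) := fun k => by positivity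
  have n2 : ∀ k, 0 ≤ ∫ ω, ‖(z k).X ω - z₀.X ω‖ ^ (q + 2) ∂unifSeq := fun k =>
    integral_nonneg fun _ => by positivity
  have n3 : ∀ k, 0 ≤ ∫ ω, ‖(z k).Y ω - z₀.Y ω‖ ^ (q + 2) ∂unifSeq := fun k =>
    integral_nonneg fun _ => by positivity
  have e : ∀ k, gap z₀ (z k) = ‖(z k).θ - z₀.θ‖ ^ (q + 2) +
    ∫ ω, ‖(z k).X ω - z₀.X ω‖ ^ (q + 2) ∂unifSeq +
    ∫ ω, ‖(z k).Y ω - z₀.Y ω‖ ^ (q + 2) ∂unifSeq := fun k => rfl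
  have l1 := squeeze_zero n1 (fun k => by linarith [e k, n2 k, n3 k]) h
  have l2 := squeeze_zero n2 (fun k => by linarith [e k, n1 k, n3 k]) h
  have l3 := squeeze_zero n3 (fun k => by linarith [e k, n1 k, n2 k]) h
  refine ⟨tendsto_iff_norm_sub_tendsto_zero.2
    (tendsto_zero_of_pow (fun _ => norm_nonneg _) (by omega) l1), ?_, ?_⟩
  · exact tendsto_eLpNorm_two (p := q + 2) (by omega) (fun k => ((z k).hX.sub z₀.hX).1)
      (tendsto_eLpNorm_of_integral (by omega) (fun k => (z k).hX.sub z₀.hX) l2)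
  · exact tendsto_eLpNorm_two (p := q + 2) (by omega) (fun k => ((z k).hY.sub z₀.hY).1)
      (tendsto_eLpNorm_of_integral (by omega) (fun k => (z k).hY.sub z₀.hY) l3)

end Config

section

variable {d n : ℕ} {T : ℝ} {W : ℝ → E d → E n → P2 d → E d} {J : Jet d n}

theorem IsSmooth.exists_growth (hS : IsSmooth T W J) {a : ℝ} (ha : a < T) :
    ∃ C : ℝ, 0 ≤ C ∧ ∀ t ∈ Icc 0 a, ∀ x θ m, ‖W t x θ m‖ ≤ C * (1 + ‖x‖ + ‖θ‖ + m.moment) := by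
  obtain ⟨C, hC⟩ := hS.linearGrowth a ha
  refine ⟨|C|, abs_nonneg C, fun t ht x θ m => (hC t ht x θ m).trans ?_⟩
  have := m.moment_nonneg
  gcongr
  exact le_abs_self C

theorem growth_slice {t C c : ℝ} (hC : 0 ≤ C) {θ : E n} (hθ : ‖θ‖ ≤ c)
    (h : ∀ x m, ‖W t x θ m‖ ≤ C * (1 + ‖x‖ + ‖θ‖ + m.moment)) (x : E d) (m : P2 d) :
    ‖W t x θ m‖ ≤ C * (1 + c) * (1 + ‖x‖ + m.moment) := by
  refine (h x m).trans ?_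
  have hm := m.moment_nonneg
  have hx := norm_nonneg x
  have hc := (norm_nonneg θ).trans hθ
  rw [mul_assoc]
  gcongr
  nlinarith [mul_nonneg hc hx, mul_nonneg hc hm]

theorem IsSmooth.isSeqContinuous_corr (hS : IsSmooth T W J) {a : ℝ} (ha : a < T) (q : ℕ) :
    Config.IsSeqContinuous a (Config.corr (q := q) W) := by
  intro s z s₀ z₀ hs hsl hz
  obtain ⟨hθ, hX, hY⟩ := Config.tendsto_of_gap hz
  obtain ⟨C, hC0, hC⟩ := hS.exists_growth ha
  obtain ⟨B, hB⟩ := hθ.norm.bddAbove_range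
  have hs₀ : s₀ ∈ Icc 0 a := isClosed_Icc.mem_of_tendsto hsl (Eventually.of_forall hs)
  have sub : ∀ {t}, t ∈ Icc 0 a → t ∈ Ico 0 T := fun h => ⟨h.1, h.2.trans_lt ha⟩
  have hB₀ : ‖z₀.θ‖ ≤ B := le_of_tendsto' hθ.norm fun k => hB ⟨k, rfl⟩
  refine tendsto_monoCorr (C := C * (1 + B)) (by
      have := (norm_nonneg _).trans hB₀
      positivity)
    (fun k => growth_slice hC0 (hB ⟨k, rfl⟩) fun x m => hC _ (hs k) x _ m)
    (growth_slice hC0 hB₀ fun x m => hC _ hs₀ x _ m)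
    (fun k m => hS.continuous_x (sub (hs k)) _ m) (fun m => hS.continuous_x (sub hs₀) _ m)
    _ _ _ _ hX hY fun κ x x₀ m m₀ hκ hx hm => ?_
  have hcont := hS.continuousOn (s₀, x₀, z₀.θ, m₀) ⟨sub hs₀, mem_univ _⟩
  refine Tendsto.comp hcont (tendsto_nhdsWithin_iff.2 ⟨?_, Eventually.of_forall fun k =>
    ⟨sub (hs _), mem_univ _⟩⟩) (f := fun k => (s (κ k), x k, (z (κ k)).θ, m k))
  exact (hsl.comp hκ).prodMk_nhds (hx.prodMk_nhds ((hθ.comp hκ).prodMk_nhds hm))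

namespace Config

variable {q : ℕ}

/-- A common bound of all the variables of a configuration. -/
def weight (z : Config n d q) (ω : UnifSeq) : ℝ :=
  1 + ‖z.X ω‖ + ‖z.Y ω‖ + ‖z.θ‖ + (law z.hX2).moment + (law z.hY2).moment

theorem one_le_weight (z : Config n d q) (ω : UnifSeq) : 1 ≤ z.weight ω := by
  have h1 := (law z.hX2).moment_nonneg
  have h2 := (law z.hY2).moment_nonneg
  unfold weight
  linarith [norm_nonneg (z.X ω), norm_nonneg (z.Y ω), norm_nonneg z.θ]

theorem memLp_weight (z : Config n d q) : MemLp z.weight (q + 2 : ℕ) unifSeq :=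
  (((((memLp_const (1 : ℝ)).add z.hX.norm).add z.hY.norm).add (memLp_const ‖z.θ‖)).add
    (memLp_const (law z.hX2).moment)).add (memLp_const (law z.hY2).moment)

theorem integrable_weight (z : Config n d q) :
    Integrable (fun ω => z.weight ω ^ (q + 2)) unifSeq := by
  refine (integrable_norm_pow z.memLp_weight).congr (Eventually.of_forall fun ω => ?_)
  simp only
  rw [Real.norm_of_nonneg (zero_le_one.trans (z.one_le_weight ω))]

theorem integral_weight_le (z : Config n d q) :
    ∫ ω, z.weight ω ^ (q + 2) ∂unifSeq ≤ 2 * 6 ^ (q + 2) * z.size := by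
  have h1 := (law z.hX2).moment_nonneg
  have h2 := (law z.hY2).moment_nonneg
  have m1 := moment_law_pow_le (p := q + 2) (by omega) z.hX z.hX2
  have m2 := moment_law_pow_le (p := q + 2) (by omega) z.hY z.hY2
  have iX := integrable_norm_pow z.hX
  have iY := integrable_norm_pow z.hY
  have hle := integral_mono (μ := unifSeq) z.integrable_weight
    (((((((integrable_const 1).add iX).add iY).add (integrable_const (‖z.θ‖ ^ (q + 2)))).add
      (integrable_const ((law z.hX2).moment ^ (q + 2)))).add
      (integrable_const ((law z.hY2).moment ^ (q + 2)))).const_mul (6 ^ (q + 2))) fun ω => by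
        have := sum_six_pow_le zero_le_one (norm_nonneg (z.X ω)) (norm_nonneg (z.Y ω))
          (norm_nonneg z.θ) h1 h2 (q + 1)
        rw [one_pow] at this
        exact this
  refine hle.trans ?_
  rw [integral_const_mul]
  have e : ∫ ω, (((((fun _ => (1 : ℝ)) + (fun ω => ‖z.X ω‖ ^ (q + 2)) +
      (fun ω => ‖z.Y ω‖ ^ (q + 2)) +
      fun _ => ‖z.θ‖ ^ (q + 2)) + fun _ => (law z.hX2).moment ^ (q + 2)) +
      fun _ => (law z.hY2).moment ^ (q + 2)) : UnifSeq → ℝ) ω ∂unifSeq =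
      1 + ∫ ω, ‖z.X ω‖ ^ (q + 2) ∂unifSeq + ∫ ω, ‖z.Y ω‖ ^ (q + 2) ∂unifSeq + ‖z.θ‖ ^ (q + 2) +
      (law z.hX2).moment ^ (q + 2) + (law z.hY2).moment ^ (q + 2) := by
    rw [integral_add' _ (integrable_const _), integral_add' _ (integrable_const _),
      integral_add' _ (integrable_const _), integral_add' ((integrable_const 1).add iX) iY,
      integral_add' (integrable_const 1) iX]
    · simp
    all_goals fun_prop
  rw [e, size_eq]
  have h3 : 0 ≤ ‖z.θ‖ ^ (q + 2) := by positivity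
  have : (0 : ℝ) < 6 ^ (q + 2) := by positivity
  rw [mul_comm 2, mul_assoc]
  gcongr
  linarith

end Config

/-- A quadratic quantity is absorbed in an arbitrarily small multiple of the barrier, since `q + 2
> 2`. -/
theorem sq_le_eta_pow {u η : ℝ} (hη : 0 < η) {q : ℕ} (h1 : 1 ≤ u) (hq : 1 ≤ q) :
    u ^ 2 ≤ η * u ^ (q + 2) + (1 / η) ^ 2 := by
  have h2 : u ≤ u ^ q := le_self_pow₀ h1 (by omega)
  have h0 : 0 ≤ η * u ^ (q + 2) := by positivity
  rcases le_total u (1 / η) with h | h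
  · have : u ^ 2 ≤ (1 / η) ^ 2 := by gcongr
    linarith
  · have h3 : 1 ≤ η * u := by rwa [div_le_iff₀' hη] at h
    have h4 : 1 * u ^ 2 ≤ η * u ^ q * u ^ 2 := by
      gcongr
      exact h3.trans (by gcongr)
    have : 0 ≤ (1 / η) ^ 2 := by positivity
    rw [pow_add]
    linarith

/-- The pairing is negligible compared with the barrier at infinity. -/
theorem IsSmooth.exists_le_corr (hS : IsSmooth T W J) {a : ℝ} (ha : a < T) {q : ℕ} (hq : 1 ≤ q)
    {η : ℝ} (hη : 0 < η) : ∃ K : ℝ, ∀ t ∈ Icc 0 a, ∀ z : Config n d q,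
      -(η * z.size + K) ≤ z.corr W t := by
  obtain ⟨C, hC0, hC⟩ := hS.exists_growth ha
  obtain ⟨δ, hδ, hδ'⟩ : ∃ δ > 0, 2 * (C + 1) * δ * (2 * 6 ^ (q + 2)) = η := by
    refine ⟨η / (2 * (C + 1) * (2 * 6 ^ (q + 2))), by positivity, ?_⟩
    field_simp
  refine ⟨2 * (C + 1) * (1 / δ) ^ 2, fun t ht z => ?_⟩
  have h1 := (law z.hX2).moment_nonneg
  have h2 := (law z.hY2).moment_nonneg
  have hpt : ∀ ω, ‖inner ℝ (W t (z.X ω) z.θ (law z.hX2) - W t (z.Y ω) z.θ (law z.hY2))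
      (z.X ω - z.Y ω)‖ ≤ 2 * (C + 1) * (δ * z.weight ω ^ (q + 2) + (1 / δ) ^ 2) := fun ω => by
    have nX := norm_nonneg (z.X ω)
    have nY := norm_nonneg (z.Y ω)
    have nθ := norm_nonneg z.θ
    have hw := z.one_le_weight ω
    have a1 : ‖W t (z.X ω) z.θ (law z.hX2)‖ ≤ (C + 1) * z.weight ω := by
      refine (hC t ht _ _ _).trans ?_
      gcongr
      · linarith
      · unfold Config.weight; linarith
    have a2 : ‖W t (z.Y ω) z.θ (law z.hY2)‖ ≤ (C + 1) * z.weight ω := by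
      refine (hC t ht _ _ _).trans ?_
      gcongr
      · linarith
      · unfold Config.weight; linarith
    have a3 : ‖z.X ω - z.Y ω‖ ≤ z.weight ω := by
      refine (norm_sub_le _ _).trans ?_
      unfold Config.weight; linarith
    calc _ ≤ _ := norm_inner_le_norm _ _
      _ ≤ ((C + 1) * z.weight ω + (C + 1) * z.weight ω) * z.weight ω := by
        gcongr
        exact (norm_sub_le _ _).trans (add_le_add a1 a2)
      _ = 2 * (C + 1) * z.weight ω ^ 2 := by ring
      _ ≤ _ := by
        gcongr
        exact sq_le_eta_pow hδ hw hq
  have i1 : Integrable (fun ω => 2 * (C + 1) * (δ * z.weight ω ^ (q + 2) + (1 / δ) ^ 2)) unifSeq :=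
    ((z.integrable_weight.const_mul δ).add (integrable_const _)).const_mul _
  have h3 := norm_integral_le_of_norm_le i1 (Eventually.of_forall hpt)
  rw [integral_const_mul, integral_add (z.integrable_weight.const_mul δ) (integrable_const _),
    integral_const_mul, integral_const, probReal_univ, one_smul] at h3
  have h4 := (abs_le.1 (Real.norm_eq_abs _ ▸ h3)).1
  have h5 := z.integral_weight_le
  have h6 : 2 * (C + 1) * (δ * ∫ ω, z.weight ω ^ (q + 2) ∂unifSeq + (1 / δ) ^ 2) ≤
      2 * (C + 1) * (δ * (2 * 6 ^ (q + 2) * z.size) + (1 / δ) ^ 2) := by gcongr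
  have h7 : 2 * (C + 1) * (δ * (2 * 6 ^ (q + 2) * z.size) + (1 / δ) ^ 2) =
      η * z.size + 2 * (C + 1) * (1 / δ) ^ 2 := by rw [← hδ']; ring
  have h8 : -(η * z.size + 2 * (C + 1) * (1 / δ) ^ 2) ≤
    -(2 * (C + 1) * (δ * ∫ ω, z.weight ω ^ (q + 2) ∂unifSeq + (1 / δ) ^ 2)) := by linarith
  exact h8.trans h4

end

/-! ### Competitors of a minimiser -/

section noise

variable {d : ℕ} {p : ℕ} {A : UnifSeq → E d}

theorem memLp_noise {Ω : Type*} [MeasurableSpace Ω] {P : Measure Ω} [IsProbabilityMeasure P]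
    {p : ℝ≥0∞} {A : Ω → E d} (hA : MemLp A p P) {s : Ω → unitInterval} (hs : Measurable s) (r : ℝ)
    (e : E d) : MemLp (fun ω => A ω + (r * fairSign (s ω)) • e) p P := by
  have hm : Measurable fun ω => (r * fairSign (s ω)) • e :=
    ((measurable_fairSign.comp hs).const_mul r).smul_const e
  refine hA.add (MemLp.of_bound hm.aestronglyMeasurable (|r| * ‖e‖)
    (Eventually.of_forall fun ω => ?_))
  rw [norm_smul, norm_mul, Real.norm_eq_abs, Real.norm_eq_abs, abs_fairSign, mul_one]

/-- A sign read off the `j`-th coordinate is asymptotically independent of a fixed variable. -/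
theorem tendsto_eLpNorm_noise {p : ℝ≥0∞} (hp1 : 1 ≤ p) (hp : p ≠ ∞) (hA : MemLp A p unifSeq)
    (r : ℝ) (e : E d) :
    Tendsto (fun j => eLpNorm ((fun z => A (resample j z) + (r * fairSign (resample j z j)) • e) -
      fun z => A z.1 + (r * fairSign z.2) • e) p (unifSeq.prod (volume : Measure unitInterval)))
      atTop (𝓝 0) := by
  refine (tendsto_eLpNorm_resample hp1 hp hA).congr fun j => ?_
  congr 1
  ext1 z
  simp [resample]

/-- The average over both signs. -/
theorem integral_noise {φ : E d → E d → ℝ} {B C : UnifSeq → E d} {r : ℝ} {e : E d}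
    (h : Integrable (fun z : UnifSeq × unitInterval =>
      φ (B z.1 + (r * fairSign z.2) • e) (C z.1 + (r * fairSign z.2) • e)) (unifSeq.prod volume)) :
    ∫ z : UnifSeq × unitInterval, φ (B z.1 + (r * fairSign z.2) • e)
      (C z.1 + (r * fairSign z.2) • e) ∂unifSeq.prod volume =
    ∫ ω, (1 / 2 : ℝ) • (φ (B ω + r • e) (C ω + r • e) +
      φ (B ω + (-r) • e) (C ω + (-r) • e)) ∂unifSeq := by
  rw [integral_prod _ h]
  refine integral_congr_ae (Eventually.of_forall fun ω => ?_)
  have := integral_fairSign (fun σ => φ (B ω + (r * σ) • e) (C ω + (r * σ) • e))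
  simp only [mul_one, mul_neg] at this
  exact this

/-- Reading the sign from a far coordinate makes it asymptotically independent of `A`. -/
theorem tendsto_integral_noise (hp : 1 ≤ p) (hA : MemLp A p unifSeq) (r : ℝ) (e : E d) :
    Tendsto (fun j : ℕ => ∫ ω, ‖A ω + (r * fairSign (ω j)) • e‖ ^ p ∂unifSeq) atTop
      (𝓝 (∫ ω, (1 / 2 : ℝ) • (‖A ω + r • e‖ ^ p + ‖A ω + (-r) • e‖ ^ p) ∂unifSeq)) := by
  have hp1 : (1 : ℝ≥0∞) ≤ p := by exact_mod_cast hp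
  have : Fact ((1 : ℝ≥0∞) ≤ p) := ⟨hp1⟩
  have hj := fun j : ℕ => memLp_noise hA (measurable_pi_apply j) r e
  have hj' := fun j : ℕ => (hj j).comp_measurePreserving (measurePreserving_resample j)
  have hA' : MemLp (fun z : UnifSeq × unitInterval => A z.1) p
    (unifSeq.prod (volume : Measure unitInterval)) :=
    hA.comp_measurePreserving measurePreserving_fst
  have h0 := memLp_noise hA' measurable_snd r e
  have h1 := (Lp.tendsto_Lp_iff_tendsto_eLpNorm'' _ hj' _ h0).2
    (tendsto_eLpNorm_noise hp1 (ENNReal.natCast_ne_top p) hA r e)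
  have h2 := (h1.norm.pow p)
  simp only [Lp.norm_toLp] at h2
  rw [← integral_norm_pow_eq h0.1 (by omega)] at h2
  have h3 := integral_noise (φ := fun x _ => ‖x‖ ^ p) (B := A) (C := A) (r := r) (e := e)
    (h0.integrable_norm_pow (by omega))
  rw [h3] at h2
  refine h2.congr fun j => ?_
  rw [eLpNorm_comp_measurePreserving (hj j).1 (measurePreserving_resample j),
    ← integral_norm_pow_eq (hj j).1 (by omega)]

end noise

namespace Config

variable {n d q : ℕ}

/-- Change of the parameter. -/
def withParam (z : Config n d q) (θ : E n) : Config n d q := ⟨θ, z.X, z.Y, z.hX, z.hY⟩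

theorem gap_withParam (c z : Config n d q) (θ : E n) :
    gap c (z.withParam θ) = gap c z - ‖z.θ - c.θ‖ ^ (q + 2) + ‖θ - c.θ‖ ^ (q + 2) := by
  simp only [gap, withParam]
  ring

theorem norm_pow_le_gap (c z : Config n d q) : ‖z.θ - c.θ‖ ^ (q + 2) ≤ gap c z := by
  have h1 : 0 ≤ ∫ ω, ‖z.X ω - c.X ω‖ ^ (q + 2) ∂unifSeq :=
    integral_nonneg fun _ => by positivity
  have h2 : 0 ≤ ∫ ω, ‖z.Y ω - c.Y ω‖ ^ (q + 2) ∂unifSeq :=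
    integral_nonneg fun _ => by positivity
  unfold gap
  linarith

/-- A drift of the parameter changes the gap by `O(h)`. -/
theorem gap_param_le (c z : Config n d q) (v : E n) {h : ℝ} (h0 : 0 ≤ h) (h1 : h ≤ 1) :
    gap c (z.withParam (z.θ + h • v)) ≤
      gap c z + h * (2 ^ (q + 2) * (gap c z + ‖v‖ ^ (q + 2))) := by
  have h2 := norm_add_smul_pow_le (z.θ - c.θ) v (q + 2) h0 h1
  rw [sub_add_eq_add_sub] at h2
  have h3 : h * (2 ^ (q + 2) * (‖z.θ - c.θ‖ ^ (q + 2) + ‖v‖ ^ (q + 2))) ≤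
      h * (2 ^ (q + 2) * (gap c z + ‖v‖ ^ (q + 2))) := by
    gcongr
    exact norm_pow_le_gap c z
  rw [gap_withParam]
  linarith

/-- A symmetric step of size `√h` of the parameter changes the mean gap by `O(h)`, since the
exponent is even. -/
theorem gap_param_symm_le {k : ℕ} (hk : q + 2 = 2 * k) (c z : Config n d q) (v : E n) {h : ℝ}
    (h0 : 0 ≤ h) (h1 : h ≤ 1) :
    (gap c (z.withParam (z.θ + Real.sqrt h • v)) +
      gap c (z.withParam (z.θ + (-Real.sqrt h) • v))) / 2
      ≤ gap c z + h * (2 ^ (q + 2) * (gap c z + ‖v‖ ^ (q + 2))) := by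
  have h2 := norm_symm_pow_le (z.θ - c.θ) v k (Real.sqrt_nonneg h) (Real.sqrt_le_one.2 h1)
  rw [Real.sq_sqrt h0, ← hk, sub_add_eq_add_sub, sub_sub, add_comm c.θ, ← sub_sub,
    sub_eq_add_neg z.θ (Real.sqrt h • v), ← neg_smul] at h2
  have h3 : h * (2 ^ (q + 2) * (‖z.θ - c.θ‖ ^ (q + 2) + ‖v‖ ^ (q + 2))) ≤
      h * (2 ^ (q + 2) * (gap c z + ‖v‖ ^ (q + 2))) := by
    gcongr
    exact norm_pow_le_gap c z
  rw [gap_withParam, gap_withParam]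
  linarith

/-- Displacement of the random vectors with velocities `V` and `V'`. -/
def move (z : Config n d q) {V V' : UnifSeq → E d} (hV : MemLp V (q + 2 : ℕ) unifSeq)
    (hV' : MemLp V' (q + 2 : ℕ) unifSeq) (h : ℝ) : Config n d q :=
  ⟨z.θ, fun ω => z.X ω + h • V ω, fun ω => z.Y ω + h • V' ω, z.hX.add (hV.const_smul h),
    z.hY.add (hV'.const_smul h)⟩

theorem integral_move_le {A V : UnifSeq → E d} (hA : MemLp A (q + 2 : ℕ) unifSeq)
    (hV : MemLp V (q + 2 : ℕ) unifSeq) {h : ℝ} (h0 : 0 ≤ h) (h1 : h ≤ 1) :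
    ∫ ω, ‖A ω + h • V ω‖ ^ (q + 2) ∂unifSeq ≤ ∫ ω, ‖A ω‖ ^ (q + 2) ∂unifSeq +
      h * (2 ^ (q + 2) * (∫ ω, ‖A ω‖ ^ (q + 2) ∂unifSeq + ∫ ω, ‖V ω‖ ^ (q + 2) ∂unifSeq)) := by
  have iA := integrable_norm_pow hA
  have iV := integrable_norm_pow hV
  have iS := ((iA.add iV).const_mul (2 ^ (q + 2))).const_mul h
  rw [← integral_add iA iV, ← integral_const_mul, ← integral_const_mul]
  refine le_of_le_of_eq (integral_mono (integrable_norm_pow (hA.add (hV.const_smul h)))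
    (iA.add iS) fun ω => ?_) (integral_add iA iS)
  exact norm_add_smul_pow_le (A ω) (V ω) (q + 2) h0 h1

/-- A drift of the variables changes the gap by `O(h)`. -/
theorem gap_move_le (c z : Config n d q) {V V' : UnifSeq → E d} (hV : MemLp V (q + 2 : ℕ) unifSeq)
    (hV' : MemLp V' (q + 2 : ℕ) unifSeq) {h : ℝ} (h0 : 0 ≤ h) (h1 : h ≤ 1) :
    gap c (z.move hV hV' h) ≤ gap c z + h * (2 ^ (q + 2) * (gap c z +
      (∫ ω, ‖V ω‖ ^ (q + 2) ∂unifSeq + ∫ ω, ‖V' ω‖ ^ (q + 2) ∂unifSeq))) := by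
  have h2 := integral_move_le (z.hX.sub c.hX) hV h0 h1
  have h3 := integral_move_le (z.hY.sub c.hY) hV' h0 h1
  simp only [Pi.sub_apply, sub_add_eq_add_sub] at h2 h3
  have h4 : 0 ≤ h * (2 ^ (q + 2) * ‖z.θ - c.θ‖ ^ (q + 2)) := by positivity
  simp only [gap, move]
  linarith

/-- Displacement of the random vectors by `± r e`, according to the `j`-th coordinate. -/
def noisy (z : Config n d q) (r : ℝ) (e : E d) (j : ℕ) : Config n d q :=
  ⟨z.θ, fun ω => z.X ω + (r * fairSign (ω j)) • e, fun ω => z.Y ω + (r * fairSign (ω j)) • e,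
    memLp_noise z.hX (measurable_pi_apply j) r e, memLp_noise z.hY (measurable_pi_apply j) r e⟩

/-- The limit of the gap to `c` when the coordinate which drives the noise tends to infinity. -/
def noisyGap (c z : Config n d q) (r : ℝ) (e : E d) : ℝ :=
  ‖z.θ - c.θ‖ ^ (q + 2) +
    ∫ ω, (1 / 2 : ℝ) • (‖z.X ω - c.X ω + r • e‖ ^ (q + 2) +
      ‖z.X ω - c.X ω + (-r) • e‖ ^ (q + 2)) ∂unifSeq +
    ∫ ω, (1 / 2 : ℝ) • (‖z.Y ω - c.Y ω + r • e‖ ^ (q + 2) +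
      ‖z.Y ω - c.Y ω + (-r) • e‖ ^ (q + 2)) ∂unifSeq

theorem tendsto_gap_noisy (c z : Config n d q) (r : ℝ) (e : E d) :
    Tendsto (fun j => gap c (z.noisy r e j)) atTop (𝓝 (noisyGap c z r e)) := by
  have h2 := tendsto_integral_noise (p := q + 2) (by omega) (z.hX.sub c.hX) r e
  have h3 := tendsto_integral_noise (p := q + 2) (by omega) (z.hY.sub c.hY) r e
  simp only [Pi.sub_apply] at h2 h3
  simp only [gap, noisy, noisyGap, ← sub_add_eq_add_sub]
  exact (h2.const_add _).add h3

/-- A symmetric step of size `√h` changes the moment of even order by `O(h)`. -/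
theorem integral_noisy_le {k : ℕ} (hk : q + 2 = 2 * k) {A : UnifSeq → E d}
    (hA : MemLp A (q + 2 : ℕ) unifSeq) (e : E d) {h : ℝ} (h0 : 0 ≤ h) (h1 : h ≤ 1) :
    ∫ ω, (1 / 2 : ℝ) • (‖A ω + Real.sqrt h • e‖ ^ (q + 2) +
      ‖A ω + (-Real.sqrt h) • e‖ ^ (q + 2)) ∂unifSeq ≤ ∫ ω, ‖A ω‖ ^ (q + 2) ∂unifSeq +
      h * (2 ^ (q + 2) * (∫ ω, ‖A ω‖ ^ (q + 2) ∂unifSeq + ‖e‖ ^ (q + 2))) := by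
  have iA := integrable_norm_pow hA
  have iV : Integrable (fun _ : UnifSeq => ‖e‖ ^ (q + 2)) unifSeq := integrable_const _
  have iS := ((iA.add iV).const_mul (2 ^ (q + 2))).const_mul h
  have ie : ∫ _ : UnifSeq, ‖e‖ ^ (q + 2) ∂unifSeq = ‖e‖ ^ (q + 2) := by simp
  rw [← ie, ← integral_add iA iV, ← integral_const_mul, ← integral_const_mul]
  have i1 := integrable_norm_pow (hA.add (memLp_const (Real.sqrt h • e)))
  have i2 := integrable_norm_pow (hA.add (memLp_const ((-Real.sqrt h) • e)))
  refine le_of_le_of_eq (integral_mono ((i1.add i2).smul (1 / 2 : ℝ))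
    (iA.add iS) fun ω => ?_) (integral_add iA iS)
  have h2 := norm_symm_pow_le (A ω) e k (Real.sqrt_nonneg h) (Real.sqrt_le_one.2 h1)
  rw [Real.sq_sqrt h0, ← hk, sub_eq_add_neg (A ω) (Real.sqrt h • e), ← neg_smul] at h2
  simp only [Pi.add_apply, smul_eq_mul]
  linarith

/-- Noise of size `√h` on the variables changes the gap by `O(h)`. -/
theorem noisyGap_le {k : ℕ} (hk : q + 2 = 2 * k) (c z : Config n d q) (e : E d) {h : ℝ}
    (h0 : 0 ≤ h) (h1 : h ≤ 1) :
    noisyGap c z (Real.sqrt h) e ≤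
      gap c z + h * (2 ^ (q + 2) * (gap c z + 2 * ‖e‖ ^ (q + 2))) := by
  have h2 := integral_noisy_le hk (z.hX.sub c.hX) e h0 h1
  have h3 := integral_noisy_le hk (z.hY.sub c.hY) e h0 h1
  simp only [Pi.sub_apply] at h2 h3
  have h4 : 0 ≤ h * (2 ^ (q + 2) * ‖z.θ - c.θ‖ ^ (q + 2)) := by positivity
  simp only [gap, noisyGap]
  linarith

end Config

/-! ### Derivatives of the pairing along the competitors -/

section

variable {Ω : Type*} [MeasurableSpace Ω] {P : Measure Ω} {H : Type*} [NormedAddCommGroup H]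
  [InnerProductSpace ℝ H]

theorem integrable_inner_of_L2 {f g : Ω → H} (hf : MemLp f 2 P) (hg : MemLp g 2 P) :
    Integrable (fun ω => inner ℝ (f ω) (g ω)) P := by
  refine ((hf.norm.integrable_mul (p := 2) (q := 2) hg.norm)).mono' (hf.1.inner hg.1)
    (Eventually.of_forall fun ω => ?_)
  exact norm_inner_le_norm _ _

/-- The increment of a pairing against a fixed vector is the difference of the increments of its
two terms. -/
theorem integral_inner_sub_sub {a b a' b' r : Ω → H} (ha : MemLp a 2 P) (hb : MemLp b 2 P)
    (ha' : MemLp a' 2 P) (hb' : MemLp b' 2 P) (hr : MemLp r 2 P) :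
    ∫ ω, inner ℝ (a' ω - b' ω) (r ω) ∂P - ∫ ω, inner ℝ (a ω - b ω) (r ω) ∂P =
      ∫ ω, inner ℝ (r ω) (a' ω - a ω) ∂P - ∫ ω, inner ℝ (r ω) (b' ω - b ω) ∂P := by
  have i1 := integrable_inner_of_L2 (ha'.sub hb') hr
  have i2 := integrable_inner_of_L2 (ha.sub hb) hr
  have i3 := integrable_inner_of_L2 hr (ha'.sub ha)
  have i4 := integrable_inner_of_L2 hr (hb'.sub hb)
  simp only [Pi.sub_apply] at i1 i2 i3 i4
  rw [← integral_sub i1 i2, ← integral_sub i3 i4]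
  refine integral_congr_ae (Eventually.of_forall fun ω => ?_)
  simp only [inner_sub_right, real_inner_comm (r ω)]
  ring

end

section

variable {d n : ℕ} {T t : ℝ} {W : ℝ → E d → E n → P2 d → E d} {J : Jet d n}

theorem IsSmooth.exists_growth_slice (hS : IsSmooth T W J) (ht : t ∈ Ico 0 T) (θ : E n) :
    ∃ C : ℝ, 0 ≤ C ∧ ∀ x m, ‖W t x θ m‖ ≤ C * (1 + ‖x‖ + m.moment) := by
  obtain ⟨C, hC0, hC⟩ := hS.exists_growth ht.2
  exact ⟨C * (1 + ‖θ‖), by positivity,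
    growth_slice hC0 le_rfl fun x m => hC t ⟨ht.1, le_rfl⟩ x θ m⟩

theorem IsSmooth.memLp_comp (hS : IsSmooth T W J) (ht : t ∈ Ico 0 T) {Ω : Type*}
    [MeasurableSpace Ω] {P : Measure Ω} [IsProbabilityMeasure P] {p : ℝ≥0∞} {X : Ω → E d}
    (hX : MemLp X p P) (θ : E n) (m : P2 d) : MemLp (fun ω => W t (X ω) θ m) p P := by
  obtain ⟨C, -, hC⟩ := hS.exists_growth_slice ht θ
  exact memLp_superposition hC (hS.continuous_x ht θ) hX m

namespace Config

variable {q : ℕ}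

/-- Backward time derivative of the pairing. -/
theorem tendsto_corr_time (hS : IsSmooth T W J) (hq : HasDegree T J q) (ht : t ∈ Ioo 0 T)
    (z : Config n d q) :
    Tendsto (fun h => h⁻¹ * (corr W (t - h) z - corr W t z)) (𝓝[>] 0)
      (𝓝 (∫ ω, inner ℝ (z.X ω - z.Y ω) (-J.dt t (z.X ω) z.θ (law z.hX2)) ∂unifSeq -
        ∫ ω, inner ℝ (z.X ω - z.Y ω) (-J.dt t (z.Y ω) z.θ (law z.hY2)) ∂unifSeq)) := by
  have hR := z.hX.sub z.hY
  refine ((hS.tendsto_time hq ht z.θ (law z.hX2) z.hX hR).sub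
    (hS.tendsto_time hq ht z.θ (law z.hY2) z.hY hR)).congr' ?_
  filter_upwards [Ioc_mem_nhdsGT ht.1] with h hh
  have hth : t - h ∈ Ico 0 T := ⟨by linarith [hh.2], by linarith [hh.1, ht.2]⟩
  have ht' := Ioo_subset_Ico_of_mem ht
  rw [← mul_sub]
  congr 1
  exact (integral_inner_sub_sub (hS.memLp_comp ht' z.hX2 z.θ _) (hS.memLp_comp ht' z.hY2 z.θ _)
    (hS.memLp_comp hth z.hX2 z.θ _) (hS.memLp_comp hth z.hY2 z.θ _) (z.hX2.sub z.hY2)).symm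

/-- Derivative of the pairing when the parameter moves along `v`. -/
theorem tendsto_corr_param (hS : IsSmooth T W J) (hq : HasDegree T J q) (ht : t ∈ Ioo 0 T)
    (z : Config n d q) (v : E n) :
    Tendsto (fun h : ℝ => h⁻¹ * (corr W t (z.withParam (z.θ + h • v)) - corr W t z)) (𝓝[>] 0)
      (𝓝 (∫ ω, inner ℝ (z.X ω - z.Y ω) (J.dθ t (z.X ω) z.θ (law z.hX2) v) ∂unifSeq -
        ∫ ω, inner ℝ (z.X ω - z.Y ω) (J.dθ t (z.Y ω) z.θ (law z.hY2) v) ∂unifSeq)) := by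
  have hR := z.hX.sub z.hY
  refine ((hS.tendsto_param hq ht z.θ v (law z.hX2) z.hX hR).sub
    (hS.tendsto_param hq ht z.θ v (law z.hY2) z.hY hR)).congr fun h => ?_
  have ht' := Ioo_subset_Ico_of_mem ht
  rw [← mul_sub]
  congr 1
  exact (integral_inner_sub_sub (hS.memLp_comp ht' z.hX2 z.θ _) (hS.memLp_comp ht' z.hY2 z.θ _)
    (hS.memLp_comp ht' z.hX2 _ _) (hS.memLp_comp ht' z.hY2 _ _) (z.hX2.sub z.hY2)).symm

/-- Second derivative of the pairing under a symmetric step of the parameter. -/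
theorem tendsto_corr_param_noise (hS : IsSmooth T W J) (hq : HasDegree T J q) (ht : t ∈ Ioo 0 T)
    (z : Config n d q) (j : Fin n) :
    Tendsto (fun h : ℝ => h⁻¹ * ((corr W t (z.withParam (z.θ + Real.sqrt h • basisVec j)) +
        corr W t (z.withParam (z.θ + (-Real.sqrt h) • basisVec j))) / 2 - corr W t z)) (𝓝[>] 0)
      (𝓝 (∫ ω, inner ℝ (z.X ω - z.Y ω)
          ((1 / 2 : ℝ) • J.dθθ t (z.X ω) z.θ (law z.hX2) j (basisVec j)) ∂unifSeq -
        ∫ ω, inner ℝ (z.X ω - z.Y ω)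
          ((1 / 2 : ℝ) • J.dθθ t (z.Y ω) z.θ (law z.hY2) j (basisVec j)) ∂unifSeq)) := by
  have hR := z.hX.sub z.hY
  refine ((hS.tendsto_param_noise hq ht z.θ j (law z.hX2) z.hX hR).sub
    (hS.tendsto_param_noise hq ht z.θ j (law z.hY2) z.hY hR)).congr fun h => ?_
  have ht' := Ioo_subset_Ico_of_mem ht
  have mX := fun θ => hS.memLp_comp ht' z.hX2 θ (law z.hX2)
  have mY := fun θ => hS.memLp_comp ht' z.hY2 θ (law z.hY2)
  set θ₁ := z.θ + Real.sqrt h • basisVec j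
  set θ₂ := z.θ + (-Real.sqrt h) • basisVec j
  rw [← mul_sub]
  congr 1
  refine (integral_inner_sub_sub (mX z.θ) (mY z.θ) (((mX θ₁).add (mX θ₂)).const_smul (1 / 2 : ℝ))
    (((mY θ₁).add (mY θ₂)).const_smul (1 / 2 : ℝ)) (z.hX2.sub z.hY2)).symm.trans ?_
  congr 1
  have i1 := integrable_inner_of_L2 ((mX θ₁).sub (mY θ₁)) (z.hX2.sub z.hY2)
  have i2 := integrable_inner_of_L2 ((mX θ₂).sub (mY θ₂)) (z.hX2.sub z.hY2)
  refine Eq.trans ?_ (congrArg (· / 2) (integral_add i1 i2))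
  simp only
  rw [← integral_div]
  refine integral_congr_ae (Eventually.of_forall fun ω => ?_)
  simp only [Pi.smul_apply, Pi.add_apply, Pi.sub_apply, ← smul_sub, real_inner_smul_left,
    add_sub_add_comm, inner_add_left, withParam]
  ring

/-- Continuity in `L²` of `W` along a motion of the variable and of its law. -/
theorem tendsto_superposition_move (hS : IsSmooth T W J) (ht : t ∈ Ico 0 T) (θ : E n)
    {X V : UnifSeq → E d} (hX : MemLp X 2 unifSeq) (hV : MemLp V 2 unifSeq)
    (hXV : ∀ h : ℝ, MemLp (fun ω => X ω + h • V ω) 2 unifSeq) {h : ℕ → ℝ}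
    (hh : Tendsto h atTop (𝓝 0)) :
    Tendsto (fun k => eLpNorm ((fun ω => W t (X ω + h k • V ω) θ (law (hXV (h k)))) -
      fun ω => W t (X ω) θ (law hX)) 2 unifSeq) atTop (𝓝 0) := by
  obtain ⟨C, hC0, hC⟩ := hS.exists_growth_slice ht θ
  have hl : Tendsto (fun k => eLpNorm ((fun ω => X ω + h k • V ω) - X) 2 unifSeq) atTop (𝓝 0) := by
    have e : ∀ k, (fun ω => X ω + h k • V ω) - X = h k • V := fun k => by
      ext1 ω
      simp
    simp only [e, eLpNorm_const_smul]
    have h1 : Tendsto (fun k => ‖h k‖ₑ) atTop (𝓝 0) := by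
      have := (continuous_enorm.tendsto (0 : ℝ)).comp hh
      simpa [Function.comp_def] using this
    have h2 := ENNReal.Tendsto.mul_const h1 (Or.inr hV.eLpNorm_ne_top)
    rwa [zero_mul] at h2
  have hlaw := tendsto_law (fun k => hXV (h k)) hX hl
  refine tendsto_superposition (U := fun _ x m => W t x θ m) (U₀ := fun x m => W t x θ m) hC0
    (fun _ => hC) (fun _ => hS.continuous_x ht θ) (fun k => hXV (h k)) hX hl
    (fun κ x x₀ hκ hx => ?_) (hS.memLp_comp ht hX θ _)
  exact ((hS.continuous_slice ht).tendsto (x₀, θ, law hX)).comp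
    (hx.prodMk_nhds (tendsto_const_nhds.prodMk_nhds (hlaw.comp hκ)))

/-- Derivative of the pairing when `X` moves along `V` and `Y` along `V'`. The last term comes
from the motion of `X - Y`. -/
theorem tendsto_corr_move (hS : IsSmooth T W J) (hq : HasDegree T J q) (ht : t ∈ Ioo 0 T)
    (z : Config n d q) {V V' : UnifSeq → E d} (hV : MemLp V (q + 2 : ℕ) unifSeq)
    (hV' : MemLp V' (q + 2 : ℕ) unifSeq) :
    Tendsto (fun h : ℝ => h⁻¹ * (corr W t (z.move hV hV' h) - corr W t z)) (𝓝[>] 0)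
      (𝓝 (∫ ω, inner ℝ (z.X ω - z.Y ω) (driftGen J t z.θ V z.hX2 ω) ∂unifSeq -
        ∫ ω, inner ℝ (z.X ω - z.Y ω) (driftGen J t z.θ V' z.hY2 ω) ∂unifSeq +
        ∫ ω, inner ℝ (W t (z.X ω) z.θ (law z.hX2) - W t (z.Y ω) z.θ (law z.hY2))
          (V ω - V' ω) ∂unifSeq)) := by
  have hR := z.hX.sub z.hY
  have ht' := Ioo_subset_Ico_of_mem ht
  have hV2 := MemLp.two_of_natCast (by omega) hV
  have hV2' := MemLp.two_of_natCast (by omega) hV'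
  have hXV : ∀ h : ℝ, MemLp (fun ω => z.X ω + h • V ω) 2 unifSeq := fun h => (z.move hV hV' h).hX2
  have hYV : ∀ h : ℝ, MemLp (fun ω => z.Y ω + h • V' ω) 2 unifSeq := fun h => (z.move hV hV' h).hY2
  have h3 : Tendsto (fun h : ℝ => ∫ ω, inner ℝ (W t (z.X ω + h • V ω) z.θ (law (hXV h)) -
      W t (z.Y ω + h • V' ω) z.θ (law (hYV h))) (V ω - V' ω) ∂unifSeq) (𝓝[>] 0)
      (𝓝 (∫ ω, inner ℝ (W t (z.X ω) z.θ (law z.hX2) - W t (z.Y ω) z.θ (law z.hY2))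
          (V ω - V' ω) ∂unifSeq)) := by
    refine tendsto_of_seq_tendsto fun h hh => ?_
    have hh0 := hh.mono_right nhdsWithin_le_nhds
    have s1 := tendsto_superposition_move hS ht' z.θ z.hX2 hV2 hXV hh0
    have s2 := tendsto_superposition_move hS ht' z.θ z.hY2 hV2' hYV hh0
    have mX := fun k => hS.memLp_comp ht' (hXV (h k)) z.θ (law (hXV (h k)))
    have mY := fun k => hS.memLp_comp ht' (hYV (h k)) z.θ (law (hYV (h k)))
    have mX₀ := hS.memLp_comp ht' z.hX2 z.θ (law z.hX2)
    have mY₀ := hS.memLp_comp ht' z.hY2 z.θ (law z.hY2)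
    have s3 : Tendsto (fun k => eLpNorm (((fun ω => W t (z.X ω + h k • V ω) z.θ (law (hXV (h k)))) -
        fun ω => W t (z.Y ω + h k • V' ω) z.θ (law (hYV (h k)))) -
        ((fun ω => W t (z.X ω) z.θ (law z.hX2)) - fun ω => W t (z.Y ω) z.θ (law z.hY2))) 2 unifSeq)
        atTop (𝓝 0) := by
      have := s1.add s2
      rw [add_zero] at this
      refine tendsto_of_tendsto_of_tendsto_of_le_of_le tendsto_const_nhds this
        (fun _ => zero_le) fun k => ?_
      rw [sub_sub_sub_comm]
      exact eLpNorm_sub_le ((mX k).sub mX₀).1 ((mY k).sub mY₀).1 one_le_two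
    exact tendsto_integral_inner_of_L2 (fun k => (mX k).sub (mY k)) (fun _ => hV2.sub hV2')
      (mX₀.sub mY₀) (hV2.sub hV2') s3 (by simp)
  refine (((hS.tendsto_drift hq ht z.θ z.hX hV hR z.hX2 hXV).sub
    (hS.tendsto_drift hq ht z.θ z.hY hV' hR z.hY2 hYV)).add h3).congr' ?_
  filter_upwards [self_mem_nhdsWithin] with h hh
  have hh0 : h ≠ 0 := ne_of_gt hh
  have mX := hS.memLp_comp ht' (hXV h) z.θ (law (hXV h))
  have mY := hS.memLp_comp ht' (hYV h) z.θ (law (hYV h))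
  have mX₀ := hS.memLp_comp ht' z.hX2 z.θ (law z.hX2)
  have mY₀ := hS.memLp_comp ht' z.hY2 z.θ (law z.hY2)
  have e1 := integral_inner_sub_sub mX₀ mY₀ mX mY (z.hX2.sub z.hY2)
  simp only [Pi.sub_apply] at e1 ⊢
  have i1 := integrable_inner_of_L2 (mX.sub mY) (z.hX2.sub z.hY2)
  have i2 := (integrable_inner_of_L2 (mX.sub mY) (hV2.sub hV2')).const_mul h
  have e2 : corr W t (z.move hV hV' h) =
      ∫ ω, inner ℝ (W t (z.X ω + h • V ω) z.θ (law (hXV h)) -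
        W t (z.Y ω + h • V' ω) z.θ (law (hYV h))) (z.X ω - z.Y ω) ∂unifSeq +
      h * ∫ ω, inner ℝ (W t (z.X ω + h • V ω) z.θ (law (hXV h)) -
      W t (z.Y ω + h • V' ω) z.θ (law (hYV h))) (V ω - V' ω) ∂unifSeq := by
    rw [← integral_const_mul]
    refine Eq.trans ?_ (integral_add i1 i2)
    refine integral_congr_ae (Eventually.of_forall fun ω => ?_)
    simp only [move, ← inner_smul_right, ← inner_add_right]
    congr 1
    module
  have e3 : corr W t z = ∫ ω, inner ℝ (W t (z.X ω) z.θ (law z.hX2) -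
      W t (z.Y ω) z.θ (law z.hY2)) (z.X ω - z.Y ω) ∂unifSeq := rfl
  rw [e2, e3, add_sub_right_comm, e1]
  field_simp

end Config

end

/-! ### Derivative of the pairing along the noise -/

section

variable {d n : ℕ} {T t : ℝ} {W : ℝ → E d → E n → P2 d → E d} {J : Jet d n}

theorem memLp_add_const {Ω : Type*} [MeasurableSpace Ω] {P : Measure Ω} [IsProbabilityMeasure P]
    {X : Ω → E d} (hX : MemLp X 2 P) (v : E d) : MemLp (fun ω => X ω + v) 2 P :=
  hX.add (memLp_const v)

/-- The law of `X ± r e` with an independent fair sign. -/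
theorem law_noise {X : UnifSeq → E d} (hX : MemLp X 2 unifSeq) (r : ℝ) (e : E d)
    (h : MemLp (fun z : UnifSeq × unitInterval => X z.1 + (r * fairSign z.2) • e) 2
      (unifSeq.prod volume)) :
    law h =
      P2.mix (law (memLp_add_const hX (r • e))) (law (memLp_add_const hX ((-r) • e))) halfI := by
  refine P2.ext_toMeasure ?_
  have := (law h).isProb
  have := (P2.mix (law (memLp_add_const hX (r • e))) (law (memLp_add_const hX ((-r) • e)))
    halfI).isProb
  refine ext_of_forall_integral_eq_of_IsFiniteMeasure fun f => ?_
  have hf := f.continuous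
  have bd : ∀ {Ω : Type} [MeasurableSpace Ω] {P : Measure Ω} [IsProbabilityMeasure P] {Y : Ω → E d},
      AEStronglyMeasurable Y P → Integrable (fun ω => f (Y ω)) P := fun hY =>
    Integrable.of_bound (hf.comp_aestronglyMeasurable hY) ‖f‖
      (Eventually.of_forall fun ω => f.norm_coe_le_norm _)
  have i1 := bd (memLp_add_const hX (r • e)).1
  have i2 := bd (memLp_add_const hX ((-r) • e)).1
  rw [integral_law h hf, P2.integral_mix ((integrable_law_iff _ hf).2 i1)
    ((integrable_law_iff _ hf).2 i2), integral_law _ hf, integral_law _ hf,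
    integral_noise (φ := fun x _ => f x) (B := X) (C := X) (bd h.1), integral_smul,
    integral_add i1 i2, smul_add]
  norm_num

namespace Config

variable {q : ℕ}

/-- The average of the pairing over the displacements `± r e` of the random vectors, at the laws
after the displacement. -/
def noisyCorr (W : ℝ → E d → E n → P2 d → E d) (t : ℝ) (z : Config n d q) (r : ℝ) (e : E d) : ℝ :=
  ∫ ω, inner ℝ ((1 / 2 : ℝ) • (W t (z.X ω + r • e) z.θ
        (P2.mix (law (memLp_add_const z.hX2 (r • e)))
          (law (memLp_add_const z.hX2 ((-r) • e))) halfI) +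
      W t (z.X ω + (-r) • e) z.θ
        (P2.mix (law (memLp_add_const z.hX2 (r • e)))
          (law (memLp_add_const z.hX2 ((-r) • e))) halfI)) -
      (1 / 2 : ℝ) • (W t (z.Y ω + r • e) z.θ
        (P2.mix (law (memLp_add_const z.hY2 (r • e)))
          (law (memLp_add_const z.hY2 ((-r) • e))) halfI) +
      W t (z.Y ω + (-r) • e) z.θ
        (P2.mix (law (memLp_add_const z.hY2 (r • e)))
          (law (memLp_add_const z.hY2 ((-r) • e))) halfI)))
    (z.X ω - z.Y ω) ∂unifSeq

/-- When the sign of the noise is read from ever farther coordinates, the pairing tends to its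
value under a noise independent of the configuration. -/
theorem tendsto_corr_noisy (hS : IsSmooth T W J) (ht : t ∈ Ico 0 T) (z : Config n d q) (r : ℝ)
    (e : E d) : Tendsto (fun j => corr W t (z.noisy r e j)) atTop (𝓝 (noisyCorr W t z r e)) := by
  obtain ⟨C, hC0, hC⟩ := hS.exists_growth_slice ht z.θ
  have hc := hS.continuous_x ht z.θ
  have hXj := fun j => (z.noisy r e j).hX2
  have hYj := fun j => (z.noisy r e j).hY2
  have mτ := fun j => measurePreserving_resample j
  have hX' : MemLp (fun y : UnifSeq × unitInterval => z.X y.1) 2 (unifSeq.prod volume) :=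
    z.hX2.comp_measurePreserving measurePreserving_fst
  have hY' : MemLp (fun y : UnifSeq × unitInterval => z.Y y.1) 2 (unifSeq.prod volume) :=
    z.hY2.comp_measurePreserving measurePreserving_fst
  have hX₀ := memLp_noise hX' measurable_snd r e
  have hY₀ := memLp_noise hY' measurable_snd r e
  have hlim := tendsto_monoCorr (U := fun _ x m => W t x z.θ m) (U₀ := fun x m => W t x z.θ m) hC0
    (fun _ => hC) hC (fun _ => hc) hc (fun j => (hXj j).comp_measurePreserving (mτ j))
    (fun j => (hYj j).comp_measurePreserving (mτ j)) hX₀ hY₀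
    (tendsto_eLpNorm_noise one_le_two ENNReal.ofNat_ne_top z.hX2 r e)
    (tendsto_eLpNorm_noise one_le_two ENNReal.ofNat_ne_top z.hY2 r e)
    fun κ x x₀ m m₀ _ hx hm => ((hS.continuous_slice ht).tendsto (x₀, z.θ, m₀)).comp
      (hx.prodMk_nhds (tendsto_const_nhds.prodMk_nhds hm))
  have e1 : ∀ j, corr W t (z.noisy r e j) = monoCorr (fun x m => W t x z.θ m)
      ((hXj j).comp_measurePreserving (mτ j)) ((hYj j).comp_measurePreserving (mτ j)) := fun j =>
    monoCorr_eq_of_map_prod_eq hc _ _ _ _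
      (map_prod_comp (mτ j) (hXj j).1.aemeasurable (hYj j).1.aemeasurable).symm
  have e2 : monoCorr (fun x m => W t x z.θ m) hX₀ hY₀ = noisyCorr W t z r e := by
    have mX := hS.memLp_comp ht hX₀ z.θ (law hX₀)
    have mY := hS.memLp_comp ht hY₀ z.θ (law hY₀)
    have h1 := integral_noise (φ := fun x y => inner ℝ (W t x z.θ (law hX₀) - W t y z.θ (law hY₀))
      (x - y)) (B := z.X) (C := z.Y) (r := r) (e := e)
      (integrable_inner_of_L2 (mX.sub mY) (hX₀.sub hY₀))
    refine h1.trans ?_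
    rw [law_noise z.hX2 r e hX₀, law_noise z.hY2 r e hY₀]
    refine integral_congr_ae (Eventually.of_forall fun ω => ?_)
    simp only [add_sub_add_right_eq_sub]
    rw [← smul_sub, add_sub_add_comm, real_inner_smul_left, inner_add_left, smul_eq_mul]
  rw [← e2]
  exact hlim.congr fun j => (e1 j).symm

/-- Derivative of the pairing under a noise common to `X` and `Y`: the difference `X - Y` does not
move, so that only the generators of `W` appear. -/
theorem tendsto_noisyCorr (hS : IsSmooth T W J) (hq : HasDegree T J q) (ht : t ∈ Ioo 0 T)
    (z : Config n d q) (i : Fin d) :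
    Tendsto (fun h : ℝ => h⁻¹ * (noisyCorr W t z (Real.sqrt h) (basisVec i) - corr W t z)) (𝓝[>] 0)
      (𝓝 (∫ ω, inner ℝ (z.X ω - z.Y ω) (noiseGen J t z.θ i z.hX2 ω) ∂unifSeq -
        ∫ ω, inner ℝ (z.X ω - z.Y ω) (noiseGen J t z.θ i z.hY2 ω) ∂unifSeq)) := by
  have hR := z.hX.sub z.hY
  refine ((hS.tendsto_noise hq ht z.θ i z.hX hR z.hX2 (fun h => memLp_add_const z.hX2 _)
    (fun h => memLp_add_const z.hX2 _)).sub
    (hS.tendsto_noise hq ht z.θ i z.hY hR z.hY2 (fun h => memLp_add_const z.hY2 _)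
    (fun h => memLp_add_const z.hY2 _))).congr fun h => ?_
  have ht' := Ioo_subset_Ico_of_mem ht
  have m : ∀ {X : UnifSeq → E d} (hX : MemLp X 2 unifSeq) (v : E d) (μ : P2 d),
      MemLp (fun ω => W t (X ω + v) z.θ μ) 2 unifSeq := fun hX v μ =>
    hS.memLp_comp ht' (memLp_add_const hX v) z.θ μ
  rw [← mul_sub]
  congr 1
  exact (integral_inner_sub_sub (hS.memLp_comp ht' z.hX2 z.θ _) (hS.memLp_comp ht' z.hY2 z.θ _)
    (((m z.hX2 (Real.sqrt h • basisVec i) _).add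
      (m z.hX2 ((-Real.sqrt h) • basisVec i) _)).const_smul
      (1 / 2 : ℝ)) (((m z.hY2 (Real.sqrt h • basisVec i) _).add
      (m z.hY2 ((-Real.sqrt h) • basisVec i) _)).const_smul (1 / 2 : ℝ)) (z.hX2.sub z.hY2)).symm

end Config

end

/-! ### Nonnegativity of the pairing -/

section

/-- A one-sided bound on increments gives a bound on the right derivative. -/
theorem neg_limit_le {u : ℝ → ℝ} {u₀ L c : ℝ}
    (hlim : Tendsto (fun h => h⁻¹ * (u h - u₀)) (𝓝[>] 0) (𝓝 L))
    (h : ∀ h ∈ Ioc (0 : ℝ) 1, u₀ - u h ≤ c * h) : -L ≤ c := by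
  refine le_of_tendsto hlim.neg ?_
  filter_upwards [Ioc_mem_nhdsGT one_pos] with s hs
  rw [← mul_neg, neg_sub, inv_mul_le_iff₀ hs.1, mul_comm]
  exact h s hs

variable {d n q : ℕ} {T : ℝ} {W : ℝ → E d → E n → P2 d → E d} {J : Jet d n}

theorem continuous_velocity {t : ℝ} (hS : IsSmooth T W J) (ht : t ∈ Ico 0 T)
    {F : E d → E n → P2 d → E d → E d} (hF : IsLipschitzCoeff F) (θ : E n) (m : P2 d) :
    Continuous fun x => F x θ m (W t x θ m) :=
  (hF.continuous θ m).comp (continuous_id.prodMk (hS.continuous_x ht θ m))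

/-- The velocities are bounded in `L^p` by the weight of the configuration. -/
theorem exists_velocity_bound (hS : IsSmooth T W J) {a : ℝ} (ha : a < T)
    {F : E d → E n → P2 d → E d → E d} (hF : IsLipschitzCoeff F) (q : ℕ) :
    ∃ C : ℝ, 0 ≤ C ∧ ∀ t ∈ Icc 0 a, ∀ z : Config n d q,
      MemLp (velocity F W t z.θ z.hX2) (q + 2 : ℕ) unifSeq ∧
      MemLp (velocity F W t z.θ z.hY2) (q + 2 : ℕ) unifSeq ∧
      ∫ ω, ‖velocity F W t z.θ z.hX2 ω‖ ^ (q + 2) ∂unifSeq +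
        ∫ ω, ‖velocity F W t z.θ z.hY2 ω‖ ^ (q + 2) ∂unifSeq ≤ C * z.size := by
  obtain ⟨C₁, h₁, H₁⟩ := hF.exists_growth
  obtain ⟨C₂, h₂, H₂⟩ := hS.exists_growth ha
  refine ⟨2 * ((C₁ * (1 + C₂)) ^ (q + 2) * (2 * 6 ^ (q + 2))), by positivity, fun t ht z => ?_⟩
  have ht' : t ∈ Ico 0 T := ⟨ht.1, ht.2.trans_lt ha⟩
  have hmX := (law z.hX2).moment_nonneg
  have hmY := (law z.hY2).moment_nonneg
  have hpt : ∀ x m, ‖-F x z.θ m (W t x z.θ m)‖ ≤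
      C₁ * (1 + C₂) * (1 + ‖x‖ + ‖z.θ‖ + m.moment) := fun x m => by
    rw [norm_neg, mul_assoc]
    refine (H₁ _ _ _ _).trans ?_
    gcongr
    linarith [H₂ t ht x z.θ m]
  have bX : ∀ ω, ‖velocity F W t z.θ z.hX2 ω‖ ≤ C₁ * (1 + C₂) * z.weight ω := fun ω => by
    refine (hpt _ _).trans ?_
    gcongr
    unfold Config.weight
    linarith [norm_nonneg (z.Y ω)]
  have bY : ∀ ω, ‖velocity F W t z.θ z.hY2 ω‖ ≤ C₁ * (1 + C₂) * z.weight ω := fun ω => by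
    refine (hpt _ _).trans ?_
    gcongr
    unfold Config.weight
    linarith [norm_nonneg (z.X ω)]
  have main : ∀ {V : UnifSeq → E d}, AEStronglyMeasurable V unifSeq →
      (∀ ω, ‖V ω‖ ≤ C₁ * (1 + C₂) * z.weight ω) → MemLp V (q + 2 : ℕ) unifSeq ∧
      ∫ ω, ‖V ω‖ ^ (q + 2) ∂unifSeq ≤ (C₁ * (1 + C₂)) ^ (q + 2) * (2 * 6 ^ (q + 2)) * z.size := by
    intro V hVm hV
    have hVp : MemLp V (q + 2 : ℕ) unifSeq := (z.memLp_weight.const_mul (C₁ * (1 + C₂))).of_le hVm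
      (Eventually.of_forall fun ω => (hV ω).trans (Real.le_norm_self _))
    refine ⟨hVp, (integral_mono (Config.integrable_norm_pow hVp)
      (z.integrable_weight.const_mul ((C₁ * (1 + C₂)) ^ (q + 2))) fun ω => ?_).trans ?_⟩
    · simp only
      rw [← mul_pow]
      exact pow_le_pow_left₀ (norm_nonneg _) (hV ω) _
    · rw [integral_const_mul, mul_assoc]
      gcongr
      exact z.integral_weight_le
  have hc := fun m => (continuous_velocity hS ht' hF z.θ m).neg
  obtain ⟨h1, h2⟩ := main ((hc _).comp_aestronglyMeasurable z.hX.1) bX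
  obtain ⟨h3, h4⟩ := main ((hc _).comp_aestronglyMeasurable z.hY.1) bY
  exact ⟨h1, h3, (add_le_add h2 h4).trans_eq (by ring)⟩

/-- The velocity of the parameter is bounded by the size of the configuration. -/
theorem exists_param_bound {b : E n → E n} (hb : ∃ K, LipschitzWith K b) (d q : ℕ) :
    ∃ C : ℝ, 0 ≤ C ∧ ∀ z : Config n d q, ‖-b z.θ‖ ^ (q + 2) ≤ C * z.size := by
  obtain ⟨K, hK⟩ := hb
  refine ⟨2 ^ (q + 2) * (‖b 0‖ ^ (q + 2) + (K : ℝ) ^ (q + 2)), by positivity, fun z => ?_⟩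
  have h1 : ‖b z.θ - b 0‖ ≤ K * ‖z.θ‖ := by simpa using hK.norm_sub_le z.θ 0
  have h2 := norm_add_pow_le (b 0) (b z.θ - b 0) (q + 2)
  rw [add_sub_cancel] at h2
  have h3 : ‖b z.θ - b 0‖ ^ (q + 2) ≤ (K : ℝ) ^ (q + 2) * z.size := by
    refine (pow_le_pow_left₀ (norm_nonneg _) h1 _).trans ?_
    rw [mul_pow]
    gcongr
    have := Config.norm_pow_le_gap (Config.origin n d q) z
    simp only [Config.origin, sub_zero] at this
    exact this.trans (le_add_of_nonneg_left zero_le_one)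
  have h4 : ‖b 0‖ ^ (q + 2) ≤ ‖b 0‖ ^ (q + 2) * z.size :=
    le_mul_of_one_le_right (by positivity) z.one_le_size
  rw [norm_neg, mul_assoc]
  refine h2.trans ?_
  gcongr
  linarith

end

section

variable {Ω : Type*} [MeasurableSpace Ω] {P : Measure Ω} [IsProbabilityMeasure P] {d n q : ℕ}
  {T σx σθ : ℝ} {W : ℝ → E d → E n → P2 d → E d} {J : Jet d n}

/-- The initial value is monotone, also on the sample space `[0, 1]^ℕ`. -/
theorem corr_zero_nonneg
    (hΩ : ∃ ξ : Ω → ℝ, Measurable ξ ∧ P.map ξ = volume.restrict (Icc (0 : ℝ) 1))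
    (hS : IsSmooth T W J) (hT : 0 < T) {W₀ : E d → E n → P2 d → E d}
    (hW₀ : ∀ x θ m, W 0 x θ m = W₀ x θ m)
    (hmono : ∀ θ, IsL2Monotone P (fun x m => W₀ x θ m)) (z : Config n d q) :
    0 ≤ z.corr W 0 := by
  have h := hmono z.θ
  simp only [← hW₀] at h
  exact h.transfer hΩ (hS.continuous_x ⟨le_rfl, hT⟩ z.θ) z.hX2 z.hY2

/-- The pairing is nonnegative along every pair of random vectors with enough moments. -/
theorem corr_nonneg
    (hΩ : ∃ ξ : Ω → ℝ, Measurable ξ ∧ P.map ξ = volume.restrict (Icc (0 : ℝ) 1))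
    (hσx : 0 ≤ σx) (hσθ : 0 ≤ σθ) {b : E n → E n} {F G : E d → E n → P2 d → E d → E d}
    {W₀ : E d → E n → P2 d → E d} (hb : ∃ K, LipschitzWith K b)
    (hF : IsLipschitzCoeff F) (hG : IsLipschitzCoeff G)
    (hW₀mono : ∀ θ, IsL2Monotone P (fun x m => W₀ x θ m))
    (hFGmono : IsJointlyL2Monotone P F G) (hW₀ : ∀ x θ m, W 0 x θ m = W₀ x θ m)
    (hS : IsSmooth T W J) (hq : HasDegree T J q) (hq1 : 1 ≤ q) {k : ℕ} (hk : q + 2 = 2 * k)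
    (heq : ∀ t ∈ Ioo 0 T, ∀ x θ m,
      Integrable (fun y => J.dm t x θ m y (F y θ m (W t y θ m))) m.toMeasure ∧
      Integrable (fun y => trace₂ (J.dmy t x θ m y)) m.toMeasure ∧
      J.dt t x θ m + J.dx t x θ m (F x θ m (W t x θ m)) + J.dθ t x θ m (b θ)
        - σx • trace₂ (J.dxx t x θ m) - σθ • trace₂ (J.dθθ t x θ m)
        + (∫ y, J.dm t x θ m y (F y θ m (W t y θ m)) ∂m.toMeasure)
        - σx • (∫ y, trace₂ (J.dmy t x θ m y) ∂m.toMeasure)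
      = G x θ m (W t x θ m))
    {s : ℝ} (hs : s ∈ Ico 0 T) (z₀ : Config n d q) : 0 ≤ z₀.corr W s := by
  by_contra! hneg
  obtain ⟨C₁, hC₁, H₁⟩ := exists_velocity_bound hS hs.2 hF q
  obtain ⟨C₂, hC₂, H₂⟩ := exists_param_bound hb d q
  -- the growth rate of the barrier dominates all the other terms of the equation
  obtain ⟨l, hl⟩ : ∃ l : ℝ, l = 7 + 3 * 2 ^ (q + 2) *
    ((1 + C₁) + (1 + C₂) + 2 * σx * (d * 3) + 2 * σθ * (n * 2)) := ⟨_, rfl⟩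
  have hl0 : 0 ≤ l := by rw [hl]; positivity
  obtain ⟨ε, hε, t, ht, z, hz, htime, hspace⟩ := Config.exists_test hl0
    (hS.isSeqContinuous_corr hs.2 q) (fun η hη => hS.exists_le_corr hs.2 hq1 hη)
    ⟨s, ⟨hs.1, le_rfl⟩, z₀, hneg⟩
  have ht0 : 0 < t := lt_of_le_of_ne ht.1 fun h => by
    subst h
    exact absurd (corr_zero_nonneg hΩ hS (hs.1.trans_lt hs.2) hW₀ hW₀mono z) (not_le.2 hz)
  have ht' : t ∈ Ioo 0 T := ⟨ht0, ht.2.trans_lt hs.2⟩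
  have ht'' := Ioo_subset_Ico_of_mem ht'
  obtain ⟨hVX, hVY, hV⟩ := H₁ t ht z
  have hbz := H₂ z
  have hN := z.one_le_size
  have hR : MemLp (fun ω => z.X ω - z.Y ω) (q + 2 : ℕ) unifSeq := z.hX.sub z.hY
  obtain ⟨c, hc⟩ : ∃ c, c = 3 * ε * Real.exp (l * t) * 2 ^ (q + 2) := ⟨_, rfl⟩
  have hc0 : 0 ≤ c := by rw [hc]; positivity
  rw [← hc] at hspace
  -- the test along a step which needs no passage to the limit
  have step : ∀ (z₁ z₂ : Config n d q) (h D : ℝ), 0 ≤ h → 0 ≤ D →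
      (∀ e, (Config.gap e z₁ + Config.gap e z₂) / 2 ≤
        Config.gap e z + h * (2 ^ (q + 2) * (Config.gap e z + D))) →
      z.corr W t - (z₁.corr W t + z₂.corr W t) / 2 ≤ c * (z.size + D) * h :=
    fun z₁ z₂ h D hh hD hg => hspace (fun _ => z₁) (fun _ => z₂) _ _ _ _ h D hh hD
      (fun _ => tendsto_const_nhds) (fun _ => tendsto_const_nhds) hg tendsto_const_nhds
      tendsto_const_nhds
  -- the competitor at an earlier time; the barrier decreases at the rate `l`
  have s1 : -(∫ ω, inner ℝ (z.X ω - z.Y ω) (-J.dt t (z.X ω) z.θ (law z.hX2)) ∂unifSeq -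
        ∫ ω, inner ℝ (z.X ω - z.Y ω) (-J.dt t (z.Y ω) z.θ (law z.hY2)) ∂unifSeq) ≤
      ε * (-(l * Real.exp (l * t))) * z.size + 6 * ε := by
    have hd : HasDerivAt (fun h => Real.exp (l * (t - h))) (-(l * Real.exp (l * t))) 0 := by
      have h1 : HasDerivAt (fun h : ℝ => l * (t - h)) (l * (-1)) 0 :=
        ((hasDerivAt_id (0 : ℝ)).const_sub t).const_mul l
      have h2 := h1.exp
      simp only [sub_zero] at h2
      exact h2.congr_deriv (by ring)
    have h3 := hd.tendsto_slope_zero_right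
    simp only [zero_add, sub_zero, smul_eq_mul] at h3
    refine le_of_tendsto_of_tendsto (Config.tendsto_corr_time hS hq ht' z).neg
      (((h3.const_mul ε).mul_const z.size).add_const (6 * ε)) ?_
    filter_upwards [Ioc_mem_nhdsGT one_pos, Ioc_mem_nhdsGT ht0] with h hh hh'
    have h4 := htime h hh hh'.2
    have h5 : h⁻¹ * (z.corr W t - z.corr W (t - h)) ≤ h⁻¹ *
        (ε * (Real.exp (l * (t - h)) - Real.exp (l * t)) * z.size + 6 * ε * h) :=
      mul_le_mul_of_nonneg_left h4 (inv_nonneg.2 hh.1.le)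
    have h6 : h⁻¹ * (6 * ε * h) = 6 * ε := by
      have := hh.1.ne'
      field_simp
    rw [mul_add, h6] at h5
    linarith
  -- the variables moved along the velocities `-F`
  have s2 := neg_limit_le (Config.tendsto_corr_move hS hq ht' z hVX hVY) (c := c * (z.size +
      (∫ ω, ‖velocity F W t z.θ z.hX2 ω‖ ^ (q + 2) ∂unifSeq +
        ∫ ω, ‖velocity F W t z.θ z.hY2 ω‖ ^ (q + 2) ∂unifSeq))) fun h hh => by
    have := step (z.move hVX hVY h) (z.move hVX hVY h) h
      (∫ ω, ‖velocity F W t z.θ z.hX2 ω‖ ^ (q + 2) ∂unifSeq +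
        ∫ ω, ‖velocity F W t z.θ z.hY2 ω‖ ^ (q + 2) ∂unifSeq) hh.1.le (add_nonneg
      (integral_nonneg fun _ => by positivity) (integral_nonneg fun _ => by positivity)) fun e => by
        rw [add_self_div_two]
        exact Config.gap_move_le e z hVX hVY hh.1.le hh.2
    rwa [add_self_div_two] at this
  -- the parameter moved along `-b`
  have s3 := neg_limit_le (Config.tendsto_corr_param hS hq ht' z (-b z.θ))
      (c := c * (z.size + ‖-b z.θ‖ ^ (q + 2))) fun h hh => by
    have := step (z.withParam (z.θ + h • -b z.θ)) (z.withParam (z.θ + h • -b z.θ)) h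
      (‖-b z.θ‖ ^ (q + 2)) hh.1.le
      (by positivity) fun e => by
        rw [add_self_div_two]
        exact Config.gap_param_le e z _ hh.1.le hh.2
    rwa [add_self_div_two] at this
  -- a common noise on the two variables; the sign becomes independent only in the limit
  have s4 : ∀ i : Fin d, _ := fun i => neg_limit_le (Config.tendsto_noisyCorr hS hq ht' z i)
      (c := c * (z.size + 2 * ‖(basisVec i : E d)‖ ^ (q + 2))) fun h hh => by
    have := hspace (z.noisy (Real.sqrt h) (basisVec i)) (z.noisy (Real.sqrt h) (basisVec i)) _ _ _ _
      h (2 * ‖(basisVec i : E d)‖ ^ (q + 2)) hh.1.le (by positivity)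
      (fun e => Config.tendsto_gap_noisy e z _ _) (fun e => Config.tendsto_gap_noisy e z _ _)
      (fun e => by
        rw [add_self_div_two]
        exact Config.noisyGap_le hk e z _ hh.1.le hh.2)
      (Config.tendsto_corr_noisy hS ht'' z _ _) (Config.tendsto_corr_noisy hS ht'' z _ _)
    rwa [add_self_div_two] at this
  -- the parameter displaced symmetrically
  have s5 : ∀ j : Fin n, _ := fun j => neg_limit_le (Config.tendsto_corr_param_noise hS hq ht' z j)
      (c := c * (z.size + ‖(basisVec j : E n)‖ ^ (q + 2))) fun h hh =>
    step _ _ h (‖(basisVec j : E n)‖ ^ (q + 2)) hh.1.le (by positivity) fun e =>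
      Config.gap_param_symm_le hk e z (basisVec j) hh.1.le hh.2
  have eX := integral_equation hS hq ht' z.θ hF z.hX hR z.hX2 hVX (fun x m => heq t ht' x z.θ m)
  have eY := integral_equation hS hq ht' z.θ hF z.hY hR z.hY2 hVY (fun x m => heq t ht' x z.θ m)
  obtain ⟨C, -, hC⟩ := hS.exists_growth_slice ht'' z.θ
  have mono := hFGmono.transfer hΩ hF hG hC (hS.continuous_x ht'' z.θ) z.θ z.hX2 z.hY2
  -- applied to `G`, this bound only serves to split the integral of the monotonicity inequality
  obtain ⟨_, _, H₃⟩ := exists_velocity_bound hS hs.2 hG q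
  obtain ⟨hGX, hGY, -⟩ := H₃ t ht z
  have two : ∀ {Z : UnifSeq → E d}, MemLp Z (q + 2 : ℕ) unifSeq → MemLp Z 2 unifSeq := fun h =>
    MemLp.two_of_natCast (by omega) h
  have i1 := integrable_inner_of_L2 ((hS.memLp_comp ht'' z.hX2 z.θ (law z.hX2)).sub
    (hS.memLp_comp ht'' z.hY2 z.θ (law z.hY2))) ((two hVX).sub (two hVY))
  have i2 := integrable_inner_of_L2 (two hR) (two hGX)
  have i3 := integrable_inner_of_L2 (two hR) (two hGY)
  have e1 : ∫ ω, inner ℝ (z.X ω - z.Y ω) (velocity G W t z.θ z.hX2 ω) ∂unifSeq =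
      -∫ ω, inner ℝ (z.X ω - z.Y ω) (G (z.X ω) z.θ (law z.hX2) (W t (z.X ω) z.θ (law z.hX2)))
        ∂unifSeq := by
    rw [← integral_neg]
    simp only [velocity, inner_neg_right]
  have e2 : ∫ ω, inner ℝ (z.X ω - z.Y ω) (velocity G W t z.θ z.hY2 ω) ∂unifSeq =
      -∫ ω, inner ℝ (z.X ω - z.Y ω) (G (z.Y ω) z.θ (law z.hY2) (W t (z.Y ω) z.θ (law z.hY2)))
        ∂unifSeq := by
    rw [← integral_neg]
    simp only [velocity, inner_neg_right]
  have e3 : ∀ {X : UnifSeq → E d} (hX : MemLp X 2 unifSeq),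
      ∫ ω, inner ℝ (z.X ω - z.Y ω) (-J.dt t (X ω) z.θ (law hX)) ∂unifSeq =
      -∫ ω, inner ℝ (z.X ω - z.Y ω) (J.dt t (X ω) z.θ (law hX)) ∂unifSeq := fun hX => by
    rw [← integral_neg]
    simp only [inner_neg_right]
  -- `velocity F` is `-F` along the solution, whence the signs
  have mono' : 0 ≤ -(∫ ω, inner ℝ (W t (z.X ω) z.θ (law z.hX2) - W t (z.Y ω) z.θ (law z.hY2))
      (velocity F W t z.θ z.hX2 ω - velocity F W t z.θ z.hY2 ω) ∂unifSeq) -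
      (∫ ω, inner ℝ (z.X ω - z.Y ω) (velocity G W t z.θ z.hX2 ω) ∂unifSeq -
      ∫ ω, inner ℝ (z.X ω - z.Y ω) (velocity G W t z.θ z.hY2 ω) ∂unifSeq) := by
    rw [← integral_neg, ← integral_sub i2 i3]
    refine mono.trans_eq (Eq.trans ?_ (integral_sub i1.neg (i2.sub i3)))
    refine integral_congr_ae (Eventually.of_forall fun ω => ?_)
    simp only [velocity, inner_neg_right, inner_sub_right,
      inner_sub_left, real_inner_comm]
    ring
  rw [e1, e2] at mono'
  rw [e3, e3] at s1
  have s4' := Finset.sum_le_sum fun i (_ : i ∈ Finset.univ) => s4 i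
  have s5' := Finset.sum_le_sum fun j (_ : j ∈ Finset.univ) => s5 j
  have nd : ∀ i : Fin d, ‖(basisVec i : E d)‖ = 1 := fun i => by simp
  have nn : ∀ j : Fin n, ‖(basisVec j : E n)‖ = 1 := fun j => by simp
  simp only [nd, nn, one_pow, mul_one, Finset.sum_neg_distrib, Finset.sum_sub_distrib,
    Finset.sum_const, Finset.card_univ, Fintype.card_fin, nsmul_eq_mul] at s4' s5'
  have t2 : c * (z.size + (∫ ω, ‖velocity F W t z.θ z.hX2 ω‖ ^ (q + 2) ∂unifSeq +
      ∫ ω, ‖velocity F W t z.θ z.hY2 ω‖ ^ (q + 2) ∂unifSeq)) ≤ c * (z.size + C₁ * z.size) := by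
    gcongr
  have t3 : c * (z.size + ‖-b z.θ‖ ^ (q + 2)) ≤ c * (z.size + C₂ * z.size) := by gcongr
  have t4 : (d : ℝ) * (c * (z.size + 2)) ≤ d * (c * (3 * z.size)) := by
    gcongr
    linarith
  have t5 : (n : ℝ) * (c * (z.size + 1)) ≤ n * (c * (2 * z.size)) := by
    gcongr
    linarith
  have u4 := mul_le_mul_of_nonneg_left (s4'.trans t4) (by positivity : 0 ≤ 2 * σx)
  have u5 := mul_le_mul_of_nonneg_left (s5'.trans t5) (by positivity : 0 ≤ 2 * σθ)
  have hexp : 1 ≤ Real.exp (l * t) := Real.one_le_exp (mul_nonneg hl0 ht0.le)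
  have t6 : 6 * ε ≤ 6 * (ε * Real.exp (l * t) * z.size) := by
    have : ε * 1 * 1 ≤ ε * Real.exp (l * t) * z.size := by gcongr
    linarith
  have hpos : 0 < ε * Real.exp (l * t) * z.size := by positivity
  -- the choice of `l` makes the sum of all the upper bounds negative
  have total : ε * (-(l * Real.exp (l * t))) * z.size + 6 * (ε * Real.exp (l * t) * z.size) +
      c * (z.size + C₁ * z.size) + c * (z.size + C₂ * z.size) +
      2 * σx * (d * (c * (3 * z.size))) + 2 * σθ * (n * (c * (2 * z.size))) =
      -(ε * Real.exp (l * t) * z.size) := by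
    rw [hc]
    generalize Real.exp (l * t) = r
    rw [hl]
    ring
  linarith

/-- The sample space `[0, 1]^ℕ` carries a uniform variable. -/
theorem exists_uniform_unifSeq : ∃ ξ : UnifSeq → ℝ, Measurable ξ ∧
    unifSeq.map ξ = volume.restrict (Icc (0 : ℝ) 1) := by
  have h1 : MeasurePreserving (fun ω : UnifSeq => ω 0) unifSeq volume :=
    measurePreserving_eval_infinitePi (fun _ : ℕ => (volume : Measure unitInterval)) 0
  have h2 := unitInterval.measurePreserving_coe.comp h1
  exact ⟨_, h2.measurable, h2.map_eq⟩

/-- Square integrable variables are limits of bounded ones. -/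
theorem exists_tendsto_bounded {X : UnifSeq → E d} (hX : MemLp X 2 unifSeq) (p : ℝ≥0∞) :
    ∃ Y : ℕ → UnifSeq → E d, (∀ k, MemLp (Y k) p unifSeq) ∧
      Tendsto (fun k => eLpNorm (Y k - X) 2 unifSeq) atTop (𝓝 0) := by
  have h : ∀ k : ℕ, ∃ Y : UnifSeq → E d, MemLp Y p unifSeq ∧
      eLpNorm (X - Y) 2 unifSeq ≤ ((k : ℝ≥0∞) + 1)⁻¹ := fun k => by
    obtain ⟨g, hg, -⟩ := hX.exists_boundedContinuous_eLpNorm_sub_le ENNReal.ofNat_ne_top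
      (ε := ((k : ℝ≥0∞) + 1)⁻¹) (by simp)
    exact ⟨g, MemLp.of_bound g.continuous.aestronglyMeasurable ‖g‖
      (Eventually.of_forall fun ω => g.norm_coe_le_norm ω), hg⟩
  choose Y hY hYl using h
  refine ⟨Y, hY, ?_⟩
  have h0 : Tendsto (fun k : ℕ => ((k : ℝ≥0∞) + 1)⁻¹) atTop (𝓝 0) := by
    have := (tendsto_add_atTop_iff_nat 1).2 ENNReal.tendsto_inv_nat_nhds_zero
    simpa using this
  refine tendsto_of_tendsto_of_tendsto_of_le_of_le tendsto_const_nhds h0 (fun _ => zero_le)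
    fun k => ?_
  rw [eLpNorm_sub_comm]
  exact hYl k

end

end

theorem mainTheorem9 {Ω : Type*} [MeasurableSpace Ω] (P : Measure Ω) [IsProbabilityMeasure P]
    (hΩ : ∃ ξ : Ω → ℝ, Measurable ξ ∧ P.map ξ = volume.restrict (Icc (0 : ℝ) 1))
    (d n : ℕ) (T σx σθ : ℝ) (hσx : 0 ≤ σx) (hσθ : 0 ≤ σθ)
    (b : E n → E n) (F G : E d → E n → P2 d → E d → E d) (W₀ : E d → E n → P2 d → E d)
    (hb : ∃ K, LipschitzWith K b)
    (hF : IsLipschitzCoeff F) (hG : IsLipschitzCoeff G) (hW₀ : IsLipschitzInitial W₀)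
    (hW₀mono : ∀ θ, IsL2Monotone P (fun x m => W₀ x θ m))
    (hFGmono : IsJointlyL2Monotone P F G)
    (W : ℝ → E d → E n → P2 d → E d)
    (hW : IsSmoothSolution T σx σθ b F G W₀ W) :
    ∀ t ∈ Ico 0 T, ∀ θ, IsL2Monotone P (fun x m => W t x θ m) := by
  intro t ht θ X Y hX hY
  obtain ⟨hW0, J, hS, heq⟩ := hW
  obtain ⟨q, hq⟩ := hS.exists_hasDegree
  -- an even order of moments, beyond the growth of all the derivatives
  have hq' : HasDegree T J (2 * q + 2) := hq.mono (by omega)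
  obtain ⟨X', Y', mX, mY, h⟩ := exists_map_prod_eq exists_uniform_unifSeq hX.1.aemeasurable
    hY.1.aemeasurable
  obtain ⟨hX', hY'⟩ := memLp_of_map_prod_eq hX.1.aemeasurable hY.1.aemeasurable
    mX.aemeasurable mY.aemeasurable h.symm hX hY
  obtain ⟨A, hA, hAX⟩ := exists_tendsto_bounded hX' (2 * q + 2 + 2 : ℕ)
  obtain ⟨B, hB, hBY⟩ := exists_tendsto_bounded hY' (2 * q + 2 + 2 : ℕ)
  obtain ⟨C, hC0, hC⟩ := hS.exists_growth_slice ht θ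
  have hc := hS.continuous_x ht θ
  let z : ℕ → Config n d (2 * q + 2) := fun k => ⟨θ, A k, B k, hA k, hB k⟩
  have hlim := tendsto_monoCorr (U := fun _ x m => W t x θ m) (U₀ := fun x m => W t x θ m) hC0
    (fun _ => hC) hC (fun _ => hc) hc (fun k => (z k).hX2) (fun k => (z k).hY2) hX' hY' hAX hBY
    fun κ x x₀ m m₀ _ hx hm => ((hS.continuous_slice ht).tendsto (x₀, θ, m₀)).comp
      (hx.prodMk_nhds (tendsto_const_nhds.prodMk_nhds hm))
  have h0 : 0 ≤ monoCorr (fun x m => W t x θ m) hX' hY' := ge_of_tendsto' hlim fun k =>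
    corr_nonneg hΩ hσx hσθ hb hF hG hW₀mono hFGmono hW0 hS hq' (by omega)
      (k := q + 2) (by omega) heq ht (z k)
  rw [monoCorr_eq_of_map_prod_eq hc hX' hY' hX hY h] at h0
  exact h0
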